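/- Let $A$ (ancilla) and $S$ (system) be qubits, let $I(\rho)=S(\rho_A)+S(\rho_S)-S(\rho)$ be the quantum mutual information ($S(\cdot)$ the von Neumann entropy), and let $\sigma_x,\sigma_y,\sigma_z$ be the Pauli matrices. The random unitary qubit dynamics with continuous real rates $\gamma_x,\gamma_y,\gamma_z$ has the intermediate maps $V_{s,t}$, the linear maps with $V_{s,t}(\mathbb 1)=\mathbb 1$ and $V_{s,t}(\sigma_k)=\exp\big(-\int_t^s(\gamma_i+\gamma_j)\,d\tau\big)\,\sigma_k$ for $\{i,j,k\}=\{x,y,z\}$, and the dynamical maps $\Lambda_t=V_{t,0}$. The dynamics is P-divisible (CP-divisible) if for all $0\le t\le s$ there is a trace preserving positive (completely positive) linear $V$ with $\Lambda_s=V\Lambda_t$; it is non-Markovian if it is not CP-divisible. The stationary states are $\rho_A\otimes\mathbb 1/2$ with $\rho_A$ a state of $A$. "State" means density operator. One can assign to every triple of real numbers $g=(g_x,g_y,g_z)$ a set $U(g)$ of operators on $A\otimes S$ such that the following hold. (1) Neighbourhood. Let $g_i+g_j>0$ for all $i\ne j$. Then $U(g)$ consists of states, and: (a) $U(g)$ is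 a neighbourhood, relative to the set of all states of $AS$, of every stationary state $\rho_A\otimes\mathbb 1/2$ with $\rho_A$ of full rank; (b) for every state $\rho_A$ (also of rank one), $U(g)$ is a neighbourhood of $\rho_A\otimes\mathbb 1/2$ relative to the set of states of $AS$ with reduced ancilla state $\rho_A$; (c) there is $\varepsilon>0$ such that, whenever $c_x,c_y,c_z\in[-\varepsilon,\varepsilon]$ and $\Phi$ is the linear map with $\Phi(\mathbb 1)=\mathbb 1$, $\Phi(\sigma_k)=c_k\sigma_k$, one has $(\mathcal I_A\otimes\Phi)(\rho)\in U(g)$ for all states $\rho$ of $AS$; (d) for all continuous rates $\gamma$ on $[0,\infty)$, all $t\ge 0$ with $\gamma(t)=g$, and all $\rho\in U(g)$, the derivative $\frac{d}{ds}I\big((\mathcal I_A\otimes V_{s,t})(\rho)\big)\big|_{s=t}$ exists (one-sided if $t=0$) and is $\le 0$. (2) Quasi-eternal model. For all $\alpha,T>0$ there is $\tau_0>0$ such that for every $t_0\ge\tau_0$ the dynamics with rates $\gamma(t)=\frac{\alpha}{2}\,(1,1,-\tanh(t-t_0))$ satisfies: every $\Lambda_t$, $t\ge0$, is completely positive and trace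 preserving; $\gamma_i(t)+\gamma_j(t)>0$ for all $t$ and $i\neq j$; the dynamics is P-divisible and not CP-divisible, and for every $t>t_0$ the map $V_{s,t}$ is not completely positive for all $s>t$ close enough to $t$; $(\mathcal I_A\otimes\Lambda_t)(\rho)\in U(\gamma(t))$ for all $t\in[t_0,t_0+T]$ and all states $\rho$ of $AS$; and for every initial state $\rho$ of $AS$ the function $t\mapsto I\big((\mathcal I_A\otimes\Lambda_t)(\rho)\big)$ is non-increasing on $[0,t_0+T]$. (3) Let $0<t_1\le t_2$ and let $\gamma$ be continuous rates on $[t_1,t_2]$ with $\gamma_i+\gamma_j>0$ there for all $i\ne j$. Then there are continuous rates $\kappa_x,\kappa_y,\kappa_z>0$ on $[0,t_1]$, with dynamical maps $\Lambda^\kappa_t$, such that $(\mathcal I_A\otimes\Lambda^{\kappa}_{t_1})(\rho)\in U(\gamma(t_1))$ for all states $\rho$ of $AS$; all the maps $V_{s,t_1}\Lambda^\kappa_{t_1}$, $s\in[t_1,t_2]$, are completely positive and trace preserving; and for every state $\rho$ of $AS$ the mutual information is non-increasing along $(\mathcal I_A\otimes\Lambda^\kappa_s)(\rho)$ for $s\in[0,t_1]$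 and along $(\mathcal I_A\otimes V_{s,t_1}\Lambda^\kappa_{t_1})(\rho)$ for $s\in[t_1,t_2]$. (4) There are continuous rates on $[0,\infty)$ with $\gamma_i(t)+\gamma_j(t)>0$ for all $t\ge0$ and $i\ne j$, whose dynamical maps $\Lambda_t$, $t\ge 0$, are completely positive and trace preserving, and which define a P-divisible, non-Markovian (not CP-divisible) dynamics such that $t\mapsto I\big((\mathcal I_A\otimes\Lambda_t)(\rho)\big)$ is non-increasing on $[0,\infty)$ for every initial state $\rho$ of $AS$. -/

import Mathlib

open scoped Kronecker Topology ComplexOrder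

namespace QubitDyn

/-- Operators on the space of a qubit. -/
abbrev Op2 : Type := Matrix (Fin 2) (Fin 2) ℂ

/-- Operators on the space of the ancilla qubit (first factor) and the system qubit
(second factor). -/
abbrev OpAS : Type := Matrix (Fin 2 × Fin 2) (Fin 2 × Fin 2) ℂ

section States

variable {n m : Type*} [Fintype n] [Fintype m]

/-- Density operators. -/
def IsState (ρ : Matrix n n ℂ) : Prop := ρ.PosSemidef ∧ ρ.trace = 1

open Classical in
/-- The von Neumann entropy `-∑ p log p`, summed over the eigenvalues `p` of a Hermitian
matrix (with multiplicity; `0 log 0 = 0`). Only its values at states matter. -/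
noncomputable def entropy (ρ : Matrix n n ℂ) : ℝ :=
  if h : ρ.IsHermitian then ∑ i, Real.negMulLog (h.eigenvalues i) else 0

/-- The reduced operator of the first factor (the ancilla). -/
def marginalA (ρ : Matrix (n × m) (n × m) ℂ) : Matrix n n ℂ :=
  Matrix.of fun a b => ∑ i, ρ (a, i) (b, i)

/-- The reduced operator of the second factor (the system). -/
def marginalS (ρ : Matrix (n × m) (n × m) ℂ) : Matrix m m ℂ :=
  Matrix.of fun i j => ∑ a, ρ (a, i) (a, j)

/-- The quantum mutual information. -/
noncomputable def mutualInfo (ρ : Matrix (n × m) (n × m) ℂ) : ℝ :=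
  entropy (marginalA ρ) + entropy (marginalS ρ) - entropy ρ

end States

section Maps

/-- The action of `id ⊗ Φ` on operators on (an `n`-dimensional ancilla) ⊗ (qubit). -/
def ampl {n : Type*} (Φ : Op2 →ₗ[ℂ] Op2) (ρ : Matrix (n × Fin 2) (n × Fin 2) ℂ) :
    Matrix (n × Fin 2) (n × Fin 2) ℂ :=
  Matrix.of fun x y => Φ (Matrix.of fun i j => ρ (x.1, i) (y.1, j)) x.2 y.2

theorem ampl_kronecker {n : Type*} (Φ : Op2 →ₗ[ℂ] Op2) (A : Matrix n n ℂ) (B : Op2) :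
    ampl Φ (A ⊗ₖ B) = A ⊗ₖ Φ B := by
  ext x y
  have h : (Matrix.of fun i j => (A ⊗ₖ B) (x.1, i) (y.1, j)) = A x.1 y.1 • B := by
    ext i j
    simp [Matrix.kroneckerMap_apply]
  change Φ (Matrix.of fun i j => (A ⊗ₖ B) (x.1, i) (y.1, j)) x.2 y.2 = _
  rw [h, map_smul]
  simp [Matrix.kroneckerMap_apply]

/-- Trace preservation. -/
def IsTP (Φ : Op2 →ₗ[ℂ] Op2) : Prop := ∀ X, (Φ X).trace = X.trace

/-- Positivity of a map. -/
def IsPositive (Φ : Op2 →ₗ[ℂ] Op2) : Prop := ∀ X, X.PosSemidef → (Φ X).PosSemidef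

/-- Complete positivity of a map. -/
def IsCP (Φ : Op2 →ₗ[ℂ] Op2) : Prop :=
  ∀ (n : ℕ) (X : Matrix (Fin n × Fin 2) (Fin n × Fin 2) ℂ),
    X.PosSemidef → (ampl Φ X).PosSemidef

/-- Completely positive trace preserving maps. -/
def IsCPTP (Φ : Op2 →ₗ[ℂ] Op2) : Prop := IsCP Φ ∧ IsTP Φ

/-- P-divisibility of a family of maps (times `t ≥ 0`). -/
def IsPDivisible (Λ : ℝ → Op2 →ₗ[ℂ] Op2) : Prop :=
  ∀ t s : ℝ, 0 ≤ t → t ≤ s →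
    ∃ V : Op2 →ₗ[ℂ] Op2, IsTP V ∧ IsPositive V ∧ Λ s = V ∘ₗ Λ t

/-- CP-divisibility of a family of maps (times `t ≥ 0`), i.e. Markovianity. -/
def IsCPDivisible (Λ : ℝ → Op2 →ₗ[ℂ] Op2) : Prop :=
  ∀ t s : ℝ, 0 ≤ t → t ≤ s →
    ∃ V : Op2 →ₗ[ℂ] Op2, IsTP V ∧ IsCP V ∧ Λ s = V ∘ₗ Λ t

end Maps

section RandomUnitary

/-- The Pauli matrices `σ_x, σ_y, σ_z`, indexed by `0, 1, 2`. -/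
noncomputable def pauli : Fin 3 → Op2 :=
  ![!![0, 1; 1, 0], !![0, -Complex.I; Complex.I, 0], !![1, 0; 0, -1]]

/-- The linear map with `1 ↦ 1` and `σ_k ↦ c_k σ_k`. -/
noncomputable def pauliMap (c : Fin 3 → ℝ) : Op2 →ₗ[ℂ] Op2 where
  toFun X := (1 / 2 : ℂ) • (X.trace • (1 : Op2)
    + ∑ k, ((c k : ℂ) * (pauli k * X).trace) • pauli k)
  map_add' X Y := by
    simp only [mul_add, Matrix.trace_add, add_smul, Finset.sum_add_distrib, smul_add]
    abel
  map_smul' a X := by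
    simp only [Matrix.mul_smul, Matrix.trace_smul, smul_eq_mul, RingHom.id_apply, smul_add,
      Finset.smul_sum, smul_smul]
    congr 1
    · congr 1
      ring
    · refine Finset.sum_congr rfl fun k _ => ?_
      congr 1
      ring

theorem pauliMap_one (c : Fin 3 → ℝ) : pauliMap c 1 = 1 := by
  ext i j
  fin_cases i <;> fin_cases j <;>
    simp [pauliMap, pauli, Fin.sum_univ_three, Matrix.trace_fin_two] <;> norm_num

theorem pauliMap_pauli (c : Fin 3 → ℝ) (k : Fin 3) :
    pauliMap c (pauli k) = (c k : ℂ) • pauli k := by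
  ext i j
  fin_cases k <;> fin_cases i <;> fin_cases j <;>
    simp [pauliMap, pauli, Fin.sum_univ_three, Matrix.trace_fin_two] <;> ring

/-- The intermediate map `V_{s,t}` of the random unitary dynamics with rates
`γ_x, γ_y, γ_z`: it fixes `1` and multiplies `σ_k` by
`exp (-∫_t^s (γ_i + γ_j))`, where `i, j` are the two indices other than `k`
(`k + 1` and `k + 2` modulo `3`). -/
noncomputable def interMap (γ : Fin 3 → ℝ → ℝ) (s t : ℝ) : Op2 →ₗ[ℂ] Op2 :=
  pauliMap fun k => Real.exp (-∫ τ in t..s, (γ (k + 1) τ + γ (k + 2) τ))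

/-- The dynamical map `Λ_t` of the random unitary dynamics with rates `γ`. -/
noncomputable def dynMap (γ : Fin 3 → ℝ → ℝ) (t : ℝ) : Op2 →ₗ[ℂ] Op2 := interMap γ t 0

/-- All sums of two different rates are positive. -/
def PairwisePos (g : Fin 3 → ℝ) : Prop := ∀ i j, i ≠ j → 0 < g i + g j

/-- The rates `(α/2) (1, 1, -tanh (t - t₀))` of the quasi-eternal model. -/
noncomputable def quasiEternal (α t₀ : ℝ) : Fin 3 → ℝ → ℝ :=
  ![fun _ => α / 2, fun _ => α / 2, fun t => -(α / 2) * Real.tanh (t - t₀)]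

/-- The stationary state `ρ_A ⊗ 1/2`. -/
noncomputable def stationary (ρA : Op2) : OpAS := ρA ⊗ₖ ((1 / 2 : ℂ) • (1 : Op2))

end RandomUnitary

end QubitDyn

open QubitDyn

/-!
The set `U g` consists of the states whose correlation operators `R_k = tr_S (ρ (1 ⊗ σ_k))` satisfy
`-d ρ_A ≤ R_k ≤ d ρ_A` for a small `d = radius g`. Bounding `R_k` relative to `ρ_A`, and not in
norm, is what makes everything uniform up to pure ancilla states: every state is moved into `U g`
by strong enough damping, since `-ρ_A ≤ R_k ≤ ρ_A` always holds, and over a pure `ρ_A`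
the bound only says that the state is a product state with nearly maximally mixed system part.

The main point is the sign of the derivative of the mutual information on `U g`
(`exists_hasDerivWithinAt_mutualInfo`). With `M = ρ_A` one has
`2 ρ = W = M ⊗ 1 + ∑ R_k ⊗ σ_k`, twice the product of the marginals is
`N = M ⊗ 1 + ∑ (r_k M) ⊗ σ_k` with `r_k = tr R_k`, and the velocity of `W` is
`-K = -∑ Γ_k R_k ⊗ σ_k` with the damping rates `Γ_k = γ_i + γ_j > 0`. The derivative of the mutual
information is `-½ tr K (log W - log N)`. Writing the logarithms as integrals of resolvents and
expanding the resolvent of `W = N + Y` around that of `N`, the term of first order in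
`V = ∑ (Γ_k r_k M) ⊗ σ_k` integrates to `tr Y (1 ⊗ X) = 0`, because `Y` has vanishing system
marginal (`sum_log_le_of_resolvent`). What remains is, for each resolvent parameter `l`, a positive
quadratic form in `Y` bounded below by the smallest `Γ_k`, up to errors that carry a factor `d`.
After preconditioning with `(M + l)^(-1/2)` the errors are controlled by Frobenius norms, uniformly in
`M` and `l` (`resolvent_trace_le`).

The derivative of the entropy at a positive definite matrix comes from a two-sided scalar estimate of
the Bregman remainder of `x log x`, weighted with the overlaps of eigenprojections
(`hasDerivWithinAt_entropy`).

For nonnegative rates the maps are mixtures of Pauli conjugations, and the mutual information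
decreases by data processing (`mutualInfo_localMix_le`): it is a relative entropy, hence an integral
over `l` of quasi-entropies, and these are maxima of functionals linear in the pair of states
(`relEnt_mix_le`).

The global statements combine the two: a phase with nonnegative rates damps all Pauli components
below the least radius that occurs later, which by compactness is positive; from then on all states
lie in the sets `U` of the current rates, and the mutual information decreases whatever the sign of
a single rate. A negative rate violates `0 ≤ 1 + c₂ - c₀ - c₁`, which complete positivity requires
(`le_of_isCP_pauliMap`).
-/

set_option linter.unusedSectionVars false

namespace QubitDyn

/-! ### Spectral decompositions -/

section Spectral

variable {n m : Type*} [Fintype n] [Fintype m]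

/-- The real part of the trace, as a real-linear functional. -/
noncomputable def rtr : Matrix n n ℂ →ₗ[ℝ] ℝ :=
  Complex.reLm ∘ₗ (Matrix.traceLinearMap n ℝ ℂ)

theorem rtr_apply (A : Matrix n n ℂ) : rtr A = A.trace.re := rfl

theorem rtr_mul_comm (A : Matrix n m ℂ) (B : Matrix m n ℂ) : rtr (A * B) = rtr (B * A) := by
  rw [rtr_apply, rtr_apply, Matrix.trace_mul_comm]

theorem rtr_conjTranspose (A : Matrix n n ℂ) : rtr A.conjTranspose = rtr A := by
  simp [rtr_apply, Matrix.trace_conjTranspose]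

theorem rtr_nonneg {A : Matrix n n ℂ} (hA : A.PosSemidef) : 0 ≤ rtr A :=
  (Complex.le_def.1 hA.trace_nonneg).1

theorem PosSemidef.rsmul {A : Matrix n n ℂ} (hA : A.PosSemidef) {c : ℝ} (hc : 0 ≤ c) :
    (c • A).PosSemidef := by
  have := hA.smul (α := ℂ) (a := (c : ℂ)) (by exact_mod_cast hc)
  rwa [Complex.coe_smul] at this

variable [DecidableEq n] [DecidableEq m] {ι κ : Type*} [Fintype ι] [Fintype κ]

/-- A spectral decomposition `A = ∑ i, val i • proj i` of a Hermitian matrix into mutually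
orthogonal rank-one projections. Eigenvalues may repeat, so it is not unique; the index type is
free, which makes the decomposition of a tensor product one over pairs. -/
structure SpecDecomp (A : Matrix n n ℂ) (ι : Type*) [Fintype ι] where
  /-- the eigenvalues -/
  val : ι → ℝ
  /-- the eigenprojections -/
  proj : ι → Matrix n n ℂ
  proj_herm : ∀ i, (proj i).conjTranspose = proj i
  proj_idem : ∀ i, proj i * proj i = proj i
  proj_orth : ∀ i j, i ≠ j → proj i * proj j = 0
  trace_proj : ∀ i, (proj i).trace = 1
  sum_proj : ∑ i, proj i = 1
  sum_val : ∑ i, val i • proj i = A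

namespace SpecDecomp

/-- Every Hermitian matrix has a spectral decomposition, indexed by its eigenvalues. -/
noncomputable def ofIsHermitian {A : Matrix n n ℂ} (hA : A.IsHermitian) : SpecDecomp A n where
  val := hA.eigenvalues
  proj i := (hA.eigenvectorUnitary : Matrix n n ℂ) * Matrix.diagonal (Pi.single i 1)
    * (hA.eigenvectorUnitary : Matrix n n ℂ).conjTranspose
  proj_herm i := by
    have h : star (Pi.single i (1 : ℂ) : n → ℂ) = Pi.single i 1 := by
      ext j; by_cases hj : j = i
      · subst hj; simp
      · simp [hj]
    simp [Matrix.conjTranspose_mul, Matrix.diagonal_conjTranspose, mul_assoc, h]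
  proj_idem i := by
    have hU : (hA.eigenvectorUnitary : Matrix n n ℂ).conjTranspose
        * (hA.eigenvectorUnitary : Matrix n n ℂ) = 1 :=
      Unitary.coe_star_mul_self hA.eigenvectorUnitary
    have h : (Matrix.diagonal (Pi.single i 1) : Matrix n n ℂ) * Matrix.diagonal (Pi.single i 1)
        = Matrix.diagonal (Pi.single i 1) := by
      rw [Matrix.diagonal_mul_diagonal]
      congr 1; ext j; by_cases hj : j = i
      · subst hj; simp
      · simp [hj]
    calc _ = (hA.eigenvectorUnitary : Matrix n n ℂ) * (Matrix.diagonal (Pi.single i 1)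
          * ((hA.eigenvectorUnitary : Matrix n n ℂ).conjTranspose
            * (hA.eigenvectorUnitary : Matrix n n ℂ)) * Matrix.diagonal (Pi.single i 1))
          * (hA.eigenvectorUnitary : Matrix n n ℂ).conjTranspose := by simp only [mul_assoc]
      _ = _ := by rw [hU, mul_one, h]
  proj_orth i k hik := by
    have hU : (hA.eigenvectorUnitary : Matrix n n ℂ).conjTranspose
        * (hA.eigenvectorUnitary : Matrix n n ℂ) = 1 :=
      Unitary.coe_star_mul_self hA.eigenvectorUnitary
    have h : (Matrix.diagonal (Pi.single i 1) : Matrix n n ℂ) * Matrix.diagonal (Pi.single k 1)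
        = 0 := by
      rw [Matrix.diagonal_mul_diagonal, ← Matrix.diagonal_zero]
      congr 1; ext j; by_cases hj : j = i
      · subst hj; simp [hik]
      · simp [hj]
    calc _ = (hA.eigenvectorUnitary : Matrix n n ℂ) * (Matrix.diagonal (Pi.single i 1)
          * ((hA.eigenvectorUnitary : Matrix n n ℂ).conjTranspose
            * (hA.eigenvectorUnitary : Matrix n n ℂ)) * Matrix.diagonal (Pi.single k 1))
          * (hA.eigenvectorUnitary : Matrix n n ℂ).conjTranspose := by simp only [mul_assoc]
      _ = _ := by rw [hU, mul_one, h, mul_zero, zero_mul]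
  trace_proj i := by
    have hU : (hA.eigenvectorUnitary : Matrix n n ℂ).conjTranspose
        * (hA.eigenvectorUnitary : Matrix n n ℂ) = 1 :=
      Unitary.coe_star_mul_self hA.eigenvectorUnitary
    rw [Matrix.trace_mul_comm, ← mul_assoc, hU, one_mul, Matrix.trace_diagonal]
    simp
  sum_proj := by
    have hU : (hA.eigenvectorUnitary : Matrix n n ℂ)
        * (hA.eigenvectorUnitary : Matrix n n ℂ).conjTranspose = 1 :=
      Unitary.coe_mul_star_self hA.eigenvectorUnitary
    rw [← Finset.sum_mul, ← Finset.mul_sum]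
    have h : ∑ i, (Matrix.diagonal (Pi.single i 1) : Matrix n n ℂ) = 1 := by
      ext a b
      rw [Matrix.sum_apply]
      by_cases hab : a = b
      · subst hab; simp [Pi.single_apply]
      · simp [hab]
    rw [h, mul_one, hU]
  sum_val := by
    conv_rhs => rw [hA.spectral_theorem]
    rw [Unitary.conjStarAlgAut_apply]
    have h : ∀ i, hA.eigenvalues i • ((hA.eigenvectorUnitary : Matrix n n ℂ)
        * Matrix.diagonal (Pi.single i 1)
          * (hA.eigenvectorUnitary : Matrix n n ℂ).conjTranspose)
        = (hA.eigenvectorUnitary : Matrix n n ℂ)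
        * (hA.eigenvalues i • Matrix.diagonal (Pi.single i 1))
          * (hA.eigenvectorUnitary : Matrix n n ℂ).conjTranspose := fun i => by
      rw [mul_smul_comm, smul_mul_assoc]
    simp_rw [h]
    rw [← Finset.sum_mul, ← Finset.mul_sum]
    congr 2
    ext a b
    rw [Matrix.sum_apply]
    by_cases hab : a = b
    · subst hab; simp [Pi.single_apply]
    · simp [hab]

variable {A : Matrix n n ℂ} {B : Matrix n n ℂ} (D : SpecDecomp A ι) (E : SpecDecomp B κ)

/-- The matrix `∑ i, c i • proj i`; for `c i = f (val i)` this is the function `f` of the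
decomposed matrix. -/
noncomputable def comb (c : ι → ℝ) : Matrix n n ℂ := ∑ i, c i • D.proj i

theorem comb_val : D.comb D.val = A := D.sum_val

theorem comb_one : D.comb (fun _ => 1) = 1 := by simp [comb, D.sum_proj]

theorem comb_mul (c d : ι → ℝ) : D.comb c * D.comb d = D.comb (fun i => c i * d i) := by
  classical
  simp only [comb, Finset.sum_mul, Finset.mul_sum]
  refine Finset.sum_congr rfl fun i _ => ?_
  rw [Finset.sum_eq_single i]
  · rw [smul_mul_smul_comm, D.proj_idem]
  · intro j _ hj
    rw [smul_mul_smul_comm, D.proj_orth _ _ hj, smul_zero]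
  · simp

theorem comb_add (c d : ι → ℝ) : D.comb c + D.comb d = D.comb (fun i => c i + d i) := by
  simp [comb, add_smul, Finset.sum_add_distrib]

theorem comb_sub (c d : ι → ℝ) : D.comb c - D.comb d = D.comb (fun i => c i - d i) := by
  simp [comb, sub_smul, Finset.sum_sub_distrib]

theorem comb_smul (a : ℝ) (c : ι → ℝ) : a • D.comb c = D.comb (fun i => a * c i) := by
  simp [comb, Finset.smul_sum, mul_smul]

theorem comb_herm (c : ι → ℝ) : (D.comb c).conjTranspose = D.comb c := by
  simp [comb, Matrix.conjTranspose_sum, D.proj_herm]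

theorem isHermitian (D : SpecDecomp A ι) : A.IsHermitian := by
  have := D.comb_herm D.val
  rwa [D.comb_val] at this

theorem proj_psd (i : ι) : (D.proj i).PosSemidef := by
  have := Matrix.posSemidef_conjTranspose_mul_self (D.proj i)
  rwa [D.proj_herm, D.proj_idem] at this

theorem comb_psd {c : ι → ℝ} (hc : ∀ i, 0 ≤ c i) : (D.comb c).PosSemidef :=
  Matrix.posSemidef_sum _ fun i _ => PosSemidef.rsmul (D.proj_psd i) (hc i)

theorem rtr_proj (i : ι) : rtr (D.proj i) = 1 := by simp [rtr_apply, D.trace_proj]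

theorem rtr_proj_mul_nonneg (i : ι) {X : Matrix n n ℂ} (hX : X.PosSemidef) :
    0 ≤ rtr (D.proj i * X) := by
  have h := rtr_nonneg (hX.conjTranspose_mul_mul_same (D.proj i))
  rw [D.proj_herm, mul_assoc, rtr_mul_comm, mul_assoc, D.proj_idem, rtr_mul_comm] at h
  exact h

theorem rtr_comb_mul (c : ι → ℝ) (X : Matrix n n ℂ) :
    rtr (D.comb c * X) = ∑ i, c i * rtr (D.proj i * X) := by
  simp [comb, Finset.sum_mul]

theorem rtr_mul_comb (c : ι → ℝ) (X : Matrix n n ℂ) :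
    rtr (X * D.comb c) = ∑ i, c i * rtr (X * D.proj i) := by
  simp [comb, Finset.mul_sum]

theorem rtr_comb (c : ι → ℝ) : rtr (D.comb c) = ∑ i, c i := by
  simp [comb, D.rtr_proj]

theorem mul_proj (i : ι) : A * D.proj i = D.val i • D.proj i := by
  classical
  suffices h : D.comb D.val * D.proj i = D.val i • D.proj i by rwa [D.comb_val] at h
  rw [comb, Finset.sum_mul, Finset.sum_eq_single i]
  · rw [smul_mul_assoc, D.proj_idem]
  · intro j _ hj
    rw [smul_mul_assoc, D.proj_orth _ _ hj, smul_zero]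
  · simp

theorem proj_mul (i : ι) : D.proj i * A = D.val i • D.proj i := by
  classical
  suffices h : D.proj i * D.comb D.val = D.val i • D.proj i by rwa [D.comb_val] at h
  rw [comb, Finset.mul_sum, Finset.sum_eq_single i]
  · rw [mul_smul_comm, D.proj_idem]
  · intro j _ hj
    rw [mul_smul_comm, D.proj_orth _ _ hj.symm, smul_zero]
  · simp

theorem rtr_mul_proj_self (i : ι) : rtr (A * D.proj i) = D.val i := by
  rw [D.mul_proj, map_smul, D.rtr_proj, smul_eq_mul, mul_one]

theorem val_nonneg (hA : A.PosSemidef) (i : ι) : 0 ≤ D.val i := by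
  rw [← D.rtr_mul_proj_self, rtr_mul_comm]
  exact D.rtr_proj_mul_nonneg i hA

theorem val_pos (hA : A.PosDef) (i : ι) : 0 < D.val i := by
  rw [← D.rtr_mul_proj_self, ← D.proj_idem, ← mul_assoc, rtr_mul_comm, ← mul_assoc]
  have h1 := hA.posSemidef.conjTranspose_mul_mul_same (D.proj i)
  rw [D.proj_herm] at h1
  refine lt_of_le_of_ne (rtr_nonneg h1) fun h0 => ?_
  have h2 : (D.proj i * A * D.proj i).trace = 0 := by
    apply Complex.ext
    · exact h0.symm
    · exact (Complex.le_def.1 h1.trace_nonneg).2.symm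
  rw [h1.trace_eq_zero_iff, D.proj_mul, smul_mul_assoc, D.proj_idem] at h2
  have h3 : D.proj i ≠ 0 := fun h => by simpa [h] using D.trace_proj i
  have h4 : D.val i = 0 := (smul_eq_zero.1 h2).resolve_right h3
  have h5 : A * D.proj i = 0 := by rw [D.mul_proj, h4, zero_smul]
  exact h3 ((hA.isUnit.mul_right_eq_zero).1 h5)

theorem val_le {e : ℝ} (h : (e • (1 : Matrix n n ℂ) - A).PosSemidef) (i : ι) : D.val i ≤ e := by
  have := D.rtr_proj_mul_nonneg i h
  rw [mul_sub, map_sub, D.proj_mul, mul_smul_comm, mul_one, map_smul, map_smul, D.rtr_proj] at this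
  simpa using this

theorem le_val {e : ℝ} (h : (e • (1 : Matrix n n ℂ) + A).PosSemidef) (i : ι) : -e ≤ D.val i := by
  have := D.rtr_proj_mul_nonneg i h
  rw [mul_add, map_add, D.proj_mul, mul_smul_comm, mul_one, map_smul, map_smul, D.rtr_proj] at this
  simp only [smul_eq_mul, mul_one] at this
  linarith

theorem rtr_comb_mul_comb (c : ι → ℝ) (d : κ → ℝ) :
    rtr (D.comb c * E.comb d) = ∑ i, ∑ j, c i * d j * rtr (D.proj i * E.proj j) := by
  rw [rtr_comb_mul]
  refine Finset.sum_congr rfl fun i _ => ?_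
  rw [E.rtr_mul_comb, Finset.mul_sum]
  exact Finset.sum_congr rfl fun j _ => by ring

theorem overlap_nonneg (i : ι) (j : κ) : 0 ≤ rtr (D.proj i * E.proj j) :=
  D.rtr_proj_mul_nonneg i (E.proj_psd j)

/-- Eigenprojections of two decompositions of the same matrix are orthogonal unless they belong
to equal eigenvalues; hence any sum over the spectrum is independent of the decomposition. -/
theorem sum_eq_sum (D : SpecDecomp A ι) (E : SpecDecomp A κ) (f : ℝ → ℝ) :
    ∑ i, f (D.val i) = ∑ j, f (E.val j) := by
  have key : ∀ i j, f (D.val i) * rtr (D.proj i * E.proj j)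
      = f (E.val j) * rtr (D.proj i * E.proj j) := by
    intro i j
    have h : D.val i * rtr (D.proj i * E.proj j) = E.val j * rtr (D.proj i * E.proj j) := by
      have h1 : rtr (D.proj i * A * E.proj j) = D.val i * rtr (D.proj i * E.proj j) := by
        rw [D.proj_mul, smul_mul_assoc, map_smul, smul_eq_mul]
      rw [← h1, mul_assoc, E.mul_proj, mul_smul_comm, map_smul, smul_eq_mul]
    rcases mul_eq_mul_right_iff.1 h with h | h
    · rw [h]
    · rw [h, mul_zero, mul_zero]
  have h1 := D.rtr_comb_mul_comb E (fun i => f (D.val i)) (fun _ => 1)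
  have h2 := D.rtr_comb_mul_comb E (fun _ => 1) (fun j => f (E.val j))
  rw [E.comb_one, mul_one, rtr_comb] at h1
  rw [D.comb_one, one_mul, rtr_comb] at h2
  rw [h1, h2]
  refine Finset.sum_congr rfl fun i _ => Finset.sum_congr rfl fun j _ => ?_
  rw [mul_one, one_mul, key]

theorem entropy_eq (D : SpecDecomp A ι) : entropy A = ∑ i, Real.negMulLog (D.val i) := by
  rw [entropy, dif_pos D.isHermitian, ← sum_eq_sum (ofIsHermitian D.isHermitian) D Real.negMulLog]
  simp only [ofIsHermitian]
  congr!

/-- The decomposition of `a • A + b • 1`. -/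
noncomputable def affine (a b : ℝ) : SpecDecomp (a • A + b • (1 : Matrix n n ℂ)) ι where
  val i := a * D.val i + b
  proj := D.proj
  proj_herm := D.proj_herm
  proj_idem := D.proj_idem
  proj_orth := D.proj_orth
  trace_proj := D.trace_proj
  sum_proj := D.sum_proj
  sum_val := by
    change D.comb _ = _
    rw [← D.comb_add, ← D.comb_smul, D.comb_val]
    congr 1
    rw [← D.comb_one, D.comb_smul]
    simp

/-- The decomposition of a tensor product. -/
noncomputable def kron {C : Matrix m m ℂ} (F : SpecDecomp C κ) :
    SpecDecomp (A ⊗ₖ C) (ι × κ) where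
  val p := D.val p.1 * F.val p.2
  proj p := D.proj p.1 ⊗ₖ F.proj p.2
  proj_herm p := by rw [Matrix.conjTranspose_kronecker, D.proj_herm, F.proj_herm]
  proj_idem p := by rw [← Matrix.mul_kronecker_mul, D.proj_idem, F.proj_idem]
  proj_orth p q hpq := by
    rw [← Matrix.mul_kronecker_mul]
    by_cases h : p.1 = q.1
    · have h2 : p.2 ≠ q.2 := fun h2 => hpq (Prod.ext h h2)
      rw [F.proj_orth _ _ h2, Matrix.kronecker_zero]
    · rw [D.proj_orth _ _ h, Matrix.zero_kronecker]
  trace_proj p := by rw [Matrix.trace_kronecker, D.trace_proj, F.trace_proj, one_mul]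
  sum_proj := by
    rw [← Matrix.one_kronecker_one, ← D.sum_proj, ← F.sum_proj]
    ext a b
    simp only [Matrix.kroneckerMap_apply, Matrix.sum_apply, Fintype.sum_prod_type,
      Finset.sum_mul_sum]
  sum_val := by
    conv_rhs => rw [← D.sum_val, ← F.sum_val]
    ext a b
    simp only [Matrix.kroneckerMap_apply, Matrix.sum_apply, Fintype.sum_prod_type,
      Finset.sum_mul_sum, Matrix.smul_apply, Complex.real_smul, Complex.ofReal_mul]
    refine Finset.sum_congr rfl fun i _ => Finset.sum_congr rfl fun j _ => by ring

end SpecDecomp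

end Spectral

/-! ### The derivative of the entropy -/

section EntropyDerivative

variable {n : Type*} [Fintype n] [DecidableEq n] {ι κ : Type*} [Fintype ι] [Fintype κ]

/-- The Bregman remainder of `x log x`, from below. -/
theorem mul_log_remainder_nonneg {a b : ℝ} (ha : 0 ≤ a) (hb : 0 < b) :
    0 ≤ a * Real.log a - a * Real.log b - a + b := by
  rcases ha.eq_or_lt with rfl | ha
  · simpa using hb.le
  · have h := Real.log_le_sub_one_of_pos (div_pos hb ha)
    rw [Real.log_div hb.ne' ha.ne'] at h
    have h2 := mul_le_mul_of_nonneg_left h ha.le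
    have h3 : a * (b / a - 1) = b - a := by field_simp
    nlinarith

/-- The Bregman remainder of `x log x`, from above. -/
theorem mul_log_remainder_le {a b : ℝ} (ha : 0 ≤ a) (hb : 0 < b) :
    a * Real.log a - a * Real.log b - a + b ≤ a * a * b⁻¹ - 2 * a + b := by
  rcases ha.eq_or_lt with rfl | ha
  · simp
  · have h := Real.log_le_sub_one_of_pos (div_pos ha hb)
    rw [Real.log_div ha.ne' hb.ne'] at h
    have h2 := mul_le_mul_of_nonneg_left h ha.le
    have h3 : a * (a / b - 1) = a * a * b⁻¹ - a := by field_simp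
    nlinarith

/-- The remainder of the first-order expansion of the entropy at `B` is the overlap-weighted sum
of the scalar remainders over pairs of eigenvalues. -/
theorem entropy_remainder_eq {A B : Matrix n n ℂ} (D : SpecDecomp A ι) (E : SpecDecomp B κ) :
    entropy B - entropy A - (∑ j, Real.log (E.val j) * rtr ((A - B) * E.proj j))
        - rtr (A - B) =
      ∑ i, ∑ j, (D.val i * Real.log (D.val i) - D.val i * Real.log (E.val j) - D.val i + E.val j)
        * rtr (D.proj i * E.proj j) := by
  have hA : entropy A = -∑ i, ∑ j, D.val i * Real.log (D.val i) * rtr (D.proj i * E.proj j) := by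
    have h := D.rtr_comb_mul_comb E (fun i => D.val i * Real.log (D.val i)) (fun _ => 1)
    rw [E.comb_one, mul_one, D.rtr_comb] at h
    simp only [mul_one] at h
    rw [D.entropy_eq, ← h, ← Finset.sum_neg_distrib]
    exact Finset.sum_congr rfl fun i _ => by rw [Real.negMulLog]; ring
  have hB : entropy B = -∑ j, E.val j * Real.log (E.val j) := by
    rw [E.entropy_eq, ← Finset.sum_neg_distrib]
    exact Finset.sum_congr rfl fun i _ => by rw [Real.negMulLog]; ring
  have h1 : ∑ j, Real.log (E.val j) * rtr ((A - B) * E.proj j)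
      = (∑ i, ∑ j, D.val i * Real.log (E.val j) * rtr (D.proj i * E.proj j))
        - ∑ j, E.val j * Real.log (E.val j) := by
    have h := D.rtr_comb_mul_comb E D.val (fun j => Real.log (E.val j))
    rw [D.comb_val] at h
    rw [← h, E.rtr_mul_comb, ← Finset.sum_sub_distrib]
    refine Finset.sum_congr rfl fun j _ => ?_
    rw [sub_mul, map_sub, E.rtr_mul_proj_self]
    ring
  have h2 : rtr (A - B) = (∑ i, ∑ j, D.val i * rtr (D.proj i * E.proj j))
      - ∑ i, ∑ j, E.val j * rtr (D.proj i * E.proj j) := by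
    have h := D.rtr_comb_mul_comb E D.val (fun _ => 1)
    have h' := D.rtr_comb_mul_comb E (fun _ => 1) E.val
    rw [D.comb_val, E.comb_one, mul_one] at h
    rw [E.comb_val, D.comb_one, one_mul] at h'
    simp only [mul_one, one_mul] at h h'
    rw [map_sub, h, h']
  rw [hA, hB, h1, h2]
  simp only [add_mul, sub_mul, Finset.sum_add_distrib, Finset.sum_sub_distrib]
  ring

/-- The entropy differs from its first-order expansion at a positive definite `B` by at most a
quadratic expression; no continuity of the matrix logarithm is needed. -/
theorem abs_entropy_remainder_le {A B : Matrix n n ℂ} (hA : A.PosSemidef) (E : SpecDecomp B κ)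
    (hE : ∀ j, 0 < E.val j) :
    |entropy A - entropy B + (∑ j, Real.log (E.val j) * rtr ((A - B) * E.proj j))
        + rtr (A - B)| ≤ rtr ((A - B) * (A - B) * E.comb (fun j => (E.val j)⁻¹)) := by
  let D := SpecDecomp.ofIsHermitian hA.isHermitian
  have hr := entropy_remainder_eq D E
  have hq : rtr ((A - B) * (A - B) * E.comb (fun j => (E.val j)⁻¹)) =
      ∑ i, ∑ j, (D.val i * D.val i * (E.val j)⁻¹ - 2 * D.val i + E.val j)
        * rtr (D.proj i * E.proj j) := by
    have hBi : B * E.comb (fun j => (E.val j)⁻¹) = 1 := by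
      have h := E.comb_mul E.val (fun j => (E.val j)⁻¹)
      rw [E.comb_val] at h
      rw [h, ← E.comb_one]
      congr 1
      ext j
      exact mul_inv_cancel₀ (hE j).ne'
    have hBi' : E.comb (fun j => (E.val j)⁻¹) * B = 1 := mul_eq_one_comm.1 hBi
    have h1 := D.rtr_comb_mul_comb E (fun i => D.val i * D.val i) (fun j => (E.val j)⁻¹)
    rw [← D.comb_mul, D.comb_val] at h1
    have h2 := D.rtr_comb_mul_comb E D.val (fun _ => 1)
    rw [D.comb_val, E.comb_one, mul_one] at h2
    have h3 := D.rtr_comb_mul_comb E (fun _ => 1) E.val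
    rw [E.comb_val, D.comb_one, one_mul] at h3
    have e : rtr ((A - B) * (A - B) * E.comb (fun j => (E.val j)⁻¹))
        = rtr (A * A * E.comb (fun j => (E.val j)⁻¹)) - 2 * rtr A + rtr B := by
      set C := E.comb (fun j => (E.val j)⁻¹)
      have e1 : (A - B) * (A - B) * C = A * A * C - A * (B * C) - B * (A * C) + B * (B * C) := by
        noncomm_ring
      have e2 : rtr (B * (A * C)) = rtr A := by
        rw [rtr_mul_comm, mul_assoc, hBi', mul_one]
      rw [e1, map_add, map_sub, map_sub, e2, hBi, mul_one, mul_one]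
      ring
    rw [e, h1, h2, h3]
    simp only [Finset.mul_sum, ← Finset.sum_sub_distrib, ← Finset.sum_add_distrib]
    exact Finset.sum_congr rfl fun i _ => Finset.sum_congr rfl fun j _ => by ring
  have hs : entropy A - entropy B + (∑ j, Real.log (E.val j) * rtr ((A - B) * E.proj j))
      + rtr (A - B) = -∑ i, ∑ j, (D.val i * Real.log (D.val i) - D.val i * Real.log (E.val j)
        - D.val i + E.val j) * rtr (D.proj i * E.proj j) := by
    rw [← hr]; ring
  rw [hs, hq, abs_neg, abs_of_nonneg]
  · exact Finset.sum_le_sum fun i _ => Finset.sum_le_sum fun j _ =>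
      mul_le_mul_of_nonneg_right (mul_log_remainder_le (D.val_nonneg hA i) (hE j))
        (D.overlap_nonneg E i j)
  · exact Finset.sum_nonneg fun i _ => Finset.sum_nonneg fun j _ =>
      mul_nonneg (mul_log_remainder_nonneg (D.val_nonneg hA i) (hE j)) (D.overlap_nonneg E i j)

theorem hasDerivWithinAt_matrix_mul {X Y : ℝ → Matrix n n ℂ} {X' Y' : Matrix n n ℂ} {S : Set ℝ}
    {t : ℝ} (hX : ∀ i j, HasDerivWithinAt (fun s => X s i j) (X' i j) S t)
    (hY : ∀ i j, HasDerivWithinAt (fun s => Y s i j) (Y' i j) S t) (i j : n) :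
    HasDerivWithinAt (fun s => (X s * Y s) i j) ((X' * Y t + X t * Y') i j) S t := by
  simp only [Matrix.mul_apply, Matrix.add_apply, ← Finset.sum_add_distrib]
  exact HasDerivWithinAt.fun_sum fun k _ => (hX i k).mul (hY k j)

theorem hasDerivWithinAt_rtr {X : ℝ → Matrix n n ℂ} {X' : Matrix n n ℂ} {S : Set ℝ}
    {t : ℝ} (hX : ∀ i j, HasDerivWithinAt (fun s => X s i j) (X' i j) S t) :
    HasDerivWithinAt (fun s => rtr (X s)) (rtr X') S t := by
  simp only [rtr_apply, Matrix.trace, Matrix.diag_apply, Complex.re_sum]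
  exact HasDerivWithinAt.fun_sum fun k _ =>
    (Complex.reCLM.hasFDerivAt.comp_hasDerivWithinAt t (hX k k))

theorem hasDerivWithinAt_zero_of_abs_le {u g : ℝ → ℝ} {S : Set ℝ} {t : ℝ}
    (hg : HasDerivWithinAt g 0 S t) (hgt : g t = 0) (hut : u t = 0)
    (h : ∀ᶠ s in 𝓝[S] t, |u s| ≤ g s) : HasDerivWithinAt u 0 S t := by
  rw [hasDerivWithinAt_iff_isLittleO] at hg ⊢
  refine Asymptotics.IsBigO.trans_isLittleO ?_ hg
  refine Asymptotics.IsBigO.of_bound 1 ?_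
  filter_upwards [h] with s hs
  simpa [hut, hgt] using hs.trans (le_abs_self _)

/-- The derivative of the entropy along a curve of positive semidefinite matrices at a point where
it is positive definite: `-tr (A' log B) - tr A'`. -/
theorem hasDerivWithinAt_entropy {A : ℝ → Matrix n n ℂ} {A' B : Matrix n n ℂ} {S : Set ℝ} {t : ℝ}
    (E : SpecDecomp B κ) (hE : ∀ j, 0 < E.val j) (hAt : A t = B)
    (hA : ∀ i j, HasDerivWithinAt (fun s => A s i j) (A' i j) S t)
    (hpsd : ∀ᶠ s in 𝓝[S] t, (A s).PosSemidef) :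
    HasDerivWithinAt (fun s => entropy (A s))
      (-(∑ j, Real.log (E.val j) * rtr (A' * E.proj j)) - rtr A') S t := by
  have hconst : ∀ (C : Matrix n n ℂ) (i j : n),
      HasDerivWithinAt (fun _ : ℝ => C i j) ((0 : Matrix n n ℂ) i j) S t :=
    fun C i j => hasDerivWithinAt_const t S (C i j)
  have hX : ∀ i j, HasDerivWithinAt (fun s => (A s - B) i j) (A' i j) S t := fun i j => by
    simpa using (hA i j).sub_const (B i j)
  have hlin : HasDerivWithinAt
      (fun s => (∑ j, Real.log (E.val j) * rtr ((A s - B) * E.proj j)) + rtr (A s - B))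
      ((∑ j, Real.log (E.val j) * rtr (A' * E.proj j)) + rtr A') S t := by
    refine HasDerivWithinAt.add (HasDerivWithinAt.fun_sum fun j _ => ?_) (hasDerivWithinAt_rtr hX)
    have h := hasDerivWithinAt_rtr (hasDerivWithinAt_matrix_mul hX (hconst (E.proj j)))
    simp only [mul_zero, add_zero] at h
    exact h.const_mul _
  have hquad : HasDerivWithinAt
      (fun s => rtr ((A s - B) * (A s - B) * E.comb (fun j => (E.val j)⁻¹))) 0 S t := by
    have h := hasDerivWithinAt_rtr (hasDerivWithinAt_matrix_mul
      (hasDerivWithinAt_matrix_mul hX hX) (hconst (E.comb (fun j => (E.val j)⁻¹))))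
    simpa [hAt] using h
  have hu := hasDerivWithinAt_zero_of_abs_le
    (u := fun s => entropy (A s) - entropy B
      + ((∑ j, Real.log (E.val j) * rtr ((A s - B) * E.proj j)) + rtr (A s - B)))
    hquad (by simp [hAt]) (by simp [hAt]) (by
      filter_upwards [hpsd] with s hs
      rw [← add_assoc]
      exact abs_entropy_remainder_le hs E hE)
  have h := (hu.sub hlin).add_const (entropy B)
  refine HasDerivWithinAt.congr_deriv (h.congr_of_eventuallyEq ?_ ?_) (by ring)
  · exact Filter.Eventually.of_forall fun s => by simp
  · simp

end EntropyDerivative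

/-! ### Relative entropy and mixing -/

section RelativeEntropy

variable {n : Type*} [Fintype n] [DecidableEq n]
  {ι κ ι' κ' ν : Type*} [Fintype ι] [Fintype κ] [Fintype ι'] [Fintype κ'] [Fintype ν]

/-- The quadratic functional of `X` whose maximum is the quasi-entropy `quasiEnt`. -/
noncomputable def varForm (ρ σ : Matrix n n ℂ) (l : ℝ) (X : Matrix n n ℂ) : ℝ :=
  2 * rtr (ρ * X) - rtr (X * σ * X.conjTranspose) - l * rtr (X.conjTranspose * ρ * X)

/-- The quasi-entropy `⟨√ρ, (Δ + l)⁻¹ √ρ⟩` of the relative modular operator `Δ` of `σ` and `ρ`,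
in terms of the spectral decompositions of `ρ` and `σ`. -/
noncomputable def quasiEnt {ρ σ : Matrix n n ℂ} (D : SpecDecomp ρ ι) (E : SpecDecomp σ κ)
    (l : ℝ) : ℝ :=
  ∑ i, ∑ j, D.val i * D.val i / (E.val j + l * D.val i) * rtr (D.proj i * E.proj j)

/-- The relative entropy `tr ρ log ρ - tr ρ log σ`, in terms of spectral decompositions. -/
noncomputable def relEnt {ρ σ : Matrix n n ℂ} (D : SpecDecomp ρ ι) (E : SpecDecomp σ κ) : ℝ :=
  (∑ i, D.val i * Real.log (D.val i))
    - ∑ i, ∑ j, D.val i * Real.log (E.val j) * rtr (D.proj i * E.proj j)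

/-- A primitive of `quasiEnt`; it interpolates between `tr ρ log σ` at `l = 0` and
`tr ρ log ρ + log l * tr ρ` at infinity. -/
noncomputable def logInterp {ρ σ : Matrix n n ℂ} (D : SpecDecomp ρ ι) (E : SpecDecomp σ κ)
    (l : ℝ) : ℝ :=
  ∑ i, ∑ j, D.val i * Real.log (E.val j + l * D.val i) * rtr (D.proj i * E.proj j)

theorem varForm_eq {ρ σ : Matrix n n ℂ} (D : SpecDecomp ρ ι) (E : SpecDecomp σ κ) (l : ℝ)
    (X : Matrix n n ℂ) :
    varForm ρ σ l X = ∑ i, ∑ j, (2 * D.val i * rtr (D.proj i * X * E.proj j)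
      - (E.val j + l * D.val i) * rtr (D.proj i * X * E.proj j * X.conjTranspose)) := by
  have h1 : rtr (ρ * X) = ∑ i, ∑ j, D.val i * rtr (D.proj i * X * E.proj j) := by
    conv_lhs => rw [← D.comb_val, D.rtr_comb_mul]
    refine Finset.sum_congr rfl fun i _ => ?_
    rw [← Finset.mul_sum, ← map_sum, ← Finset.mul_sum, E.sum_proj, mul_one]
  have h2 : rtr (X * σ * X.conjTranspose)
      = ∑ i, ∑ j, E.val j * rtr (D.proj i * X * E.proj j * X.conjTranspose) := by
    rw [Finset.sum_comm]
    simp_rw [← Finset.mul_sum, ← map_sum, mul_assoc, ← Finset.sum_mul, D.sum_proj, one_mul]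
    have h : rtr (X * (E.comb E.val * X.conjTranspose))
        = ∑ j, E.val j * rtr (X * (E.proj j * X.conjTranspose)) := by
      simp only [SpecDecomp.comb, Finset.sum_mul, Finset.mul_sum, map_sum, smul_mul_assoc,
        mul_smul_comm, map_smul, smul_eq_mul]
    rwa [E.comb_val] at h
  have h3 : rtr (X.conjTranspose * ρ * X)
      = ∑ i, ∑ j, D.val i * rtr (D.proj i * X * E.proj j * X.conjTranspose) := by
    simp_rw [← Finset.mul_sum, ← map_sum, ← Finset.sum_mul, ← Finset.mul_sum, E.sum_proj, mul_one]
    rw [mul_assoc, rtr_mul_comm, mul_assoc]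
    conv_lhs => rw [← D.comb_val, D.rtr_comb_mul]
    simp only [mul_assoc]
  rw [varForm, h1, h2, h3]
  simp only [Finset.mul_sum, ← Finset.sum_sub_distrib]
  exact Finset.sum_congr rfl fun i _ => Finset.sum_congr rfl fun j _ => by ring

/-- Completing the square in each pair of eigenprojections bounds the functional `varForm`. -/
theorem varForm_le_quasiEnt {ρ σ : Matrix n n ℂ} (D : SpecDecomp ρ ι) (E : SpecDecomp σ κ)
    (hD : ∀ i, 0 < D.val i) (hE : ∀ j, 0 < E.val j) {l : ℝ} (hl : 0 ≤ l) (X : Matrix n n ℂ) :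
    varForm ρ σ l X ≤ quasiEnt D E l := by
  rw [varForm_eq D E, quasiEnt]
  refine Finset.sum_le_sum fun i _ => Finset.sum_le_sum fun j _ => ?_
  have hs : 0 < E.val j + l * D.val i :=
    add_pos_of_pos_of_nonneg (hE j) (mul_nonneg hl (hD i).le)
  set s := E.val j + l * D.val i
  set t := D.val i / s
  -- completing the square around the multiple `t` of the identity
  have h := D.rtr_proj_mul_nonneg i
    ((E.proj_psd j).mul_mul_conjTranspose_same (X - t • (1 : Matrix n n ℂ)))
  have hx : rtr (D.proj i * (E.proj j * X.conjTranspose)) = rtr (D.proj i * X * E.proj j) := by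
    rw [← rtr_conjTranspose]
    simp only [Matrix.conjTranspose_mul, Matrix.conjTranspose_conjTranspose, D.proj_herm,
      E.proj_herm]
    rw [rtr_mul_comm, mul_assoc]
  have e : D.proj i * ((X - t • (1 : Matrix n n ℂ)) * E.proj j
      * (X - t • (1 : Matrix n n ℂ)).conjTranspose)
      = D.proj i * X * E.proj j * X.conjTranspose - t • (D.proj i * X * E.proj j)
        - t • (D.proj i * (E.proj j * X.conjTranspose)) + (t * t) • (D.proj i * E.proj j) := by
    simp only [Matrix.conjTranspose_sub, Matrix.conjTranspose_smul, star_trivial,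
      Matrix.conjTranspose_one, sub_mul, mul_sub, smul_mul_assoc, mul_smul_comm, one_mul, mul_one,
      smul_sub, mul_smul, mul_assoc]
    abel
  rw [e] at h
  simp only [map_add, map_sub, map_smul, smul_eq_mul, hx] at h
  have h2 := mul_nonneg hs.le h
  have e2 : s * t = D.val i := by simp only [t]; field_simp
  have e3 : D.val i * D.val i / s = s * t * t := by simp only [t]; field_simp
  rw [e3]
  rw [← e2]
  nlinarith

/-- The maximum is attained at `∑ tᵢⱼ Pᵢ Qⱼ`, where `tᵢⱼ` completes the square for the pair
`(i, j)`. -/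
theorem exists_varForm_eq_quasiEnt {ρ σ : Matrix n n ℂ} (D : SpecDecomp ρ ι) (E : SpecDecomp σ κ)
    (hD : ∀ i, 0 < D.val i) (hE : ∀ j, 0 < E.val j) {l : ℝ} (hl : 0 ≤ l) :
    ∃ X, varForm ρ σ l X = quasiEnt D E l := by
  classical
  set t : ι → κ → ℝ := fun i j => D.val i / (E.val j + l * D.val i) with ht
  refine ⟨∑ i, ∑ j, t i j • (D.proj i * E.proj j), ?_⟩
  set X : Matrix n n ℂ := ∑ i, ∑ j, t i j • (D.proj i * E.proj j) with hX
  have hPXQ : ∀ i j, D.proj i * X * E.proj j = t i j • (D.proj i * E.proj j) := by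
    intro i j
    rw [hX, Finset.mul_sum, Finset.sum_mul, Finset.sum_eq_single i, Finset.mul_sum,
      Finset.sum_mul, Finset.sum_eq_single j]
    · rw [mul_smul_comm, smul_mul_assoc, ← mul_assoc, D.proj_idem, mul_assoc, E.proj_idem]
    · intro k _ hk
      rw [mul_smul_comm, smul_mul_assoc, mul_assoc, mul_assoc, E.proj_orth _ _ hk, mul_zero,
        mul_zero, smul_zero]
    · simp
    · intro k _ hk
      rw [Finset.mul_sum, Finset.sum_mul]
      refine Finset.sum_eq_zero fun j' _ => ?_
      rw [mul_smul_comm, smul_mul_assoc, ← mul_assoc, D.proj_orth _ _ hk.symm, zero_mul, zero_mul,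
        smul_zero]
    · simp
  have hu : ∀ i j, rtr (D.proj i * X * E.proj j * X.conjTranspose)
      = t i j * t i j * rtr (D.proj i * E.proj j) := by
    intro i j
    have h1 : rtr (D.proj i * X * E.proj j * X.conjTranspose)
        = rtr ((D.proj i * X * E.proj j) * (D.proj i * X * E.proj j).conjTranspose) := by
      simp only [Matrix.conjTranspose_mul, D.proj_herm, E.proj_herm]
      have h2 : D.proj i * X * E.proj j * (E.proj j * (X.conjTranspose * D.proj i))
          = D.proj i * X * (E.proj j * E.proj j) * X.conjTranspose * D.proj i := by
        simp only [mul_assoc]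
      rw [h2, E.proj_idem, rtr_mul_comm _ (D.proj i)]
      simp only [← mul_assoc]
      rw [D.proj_idem]
    rw [h1, hPXQ, Matrix.conjTranspose_smul, Matrix.conjTranspose_mul, D.proj_herm, E.proj_herm,
      star_trivial, smul_mul_smul_comm, map_smul, smul_eq_mul]
    congr 1
    have h3 : D.proj i * E.proj j * (E.proj j * D.proj i)
        = D.proj i * (E.proj j * E.proj j) * D.proj i := by simp only [mul_assoc]
    rw [h3, E.proj_idem, rtr_mul_comm, ← mul_assoc, D.proj_idem]
  rw [varForm_eq D E, quasiEnt]
  refine Finset.sum_congr rfl fun i _ => Finset.sum_congr rfl fun j _ => ?_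
  have hs : 0 < E.val j + l * D.val i :=
    add_pos_of_pos_of_nonneg (hE j) (mul_nonneg hl (hD i).le)
  rw [hu, hPXQ, map_smul, smul_eq_mul]
  simp only [ht]
  field_simp
  ring

/-- The quasi-entropies do not increase under mixtures of unitary conjugations: a maximizer `X`
for the mixed pair yields the trial matrices `Vₖᴴ X Vₖ` for the original pair. -/
theorem quasiEnt_mix_le {ρ σ ρ' σ' : Matrix n n ℂ} (D : SpecDecomp ρ ι) (E : SpecDecomp σ κ)
    (D' : SpecDecomp ρ' ι') (E' : SpecDecomp σ' κ')
    (hD : ∀ i, 0 < D.val i) (hE : ∀ j, 0 < E.val j)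
    (hD' : ∀ i, 0 < D'.val i) (hE' : ∀ j, 0 < E'.val j)
    {p : ν → ℝ} (hp : ∀ k, 0 ≤ p k) (hp1 : ∑ k, p k = 1) {V : ν → Matrix n n ℂ}
    (hV : ∀ k, (V k).conjTranspose * V k = 1)
    (hρ : ρ' = ∑ k, p k • (V k * ρ * (V k).conjTranspose))
    (hσ : σ' = ∑ k, p k • (V k * σ * (V k).conjTranspose)) {l : ℝ} (hl : 0 ≤ l) :
    quasiEnt D' E' l ≤ quasiEnt D E l := by
  obtain ⟨X, hX⟩ := exists_varForm_eq_quasiEnt D' E' hD' hE' hl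
  have hV' : ∀ k, V k * (V k).conjTranspose = 1 := fun k => mul_eq_one_comm.1 (hV k)
  have hsum : varForm ρ' σ' l X
      = ∑ k, p k * varForm ρ σ l ((V k).conjTranspose * X * V k) := by
    have h1 : rtr (ρ' * X) = ∑ k, p k * rtr (ρ * ((V k).conjTranspose * X * V k)) := by
      rw [hρ, Finset.sum_mul, map_sum]
      refine Finset.sum_congr rfl fun k _ => ?_
      rw [smul_mul_assoc, map_smul, smul_eq_mul, mul_assoc, mul_assoc, rtr_mul_comm]
      simp only [mul_assoc]
    have h2 : rtr (X * σ' * X.conjTranspose) = ∑ k, p k * rtr (((V k).conjTranspose * X * V k) * σ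
        * ((V k).conjTranspose * X * V k).conjTranspose) := by
      rw [hσ, Finset.mul_sum, Finset.sum_mul, map_sum]
      refine Finset.sum_congr rfl fun k _ => ?_
      rw [mul_smul_comm, smul_mul_assoc, map_smul, smul_eq_mul]
      congr 1
      have e : (V k).conjTranspose * X * V k * σ
          * ((V k).conjTranspose * X * V k).conjTranspose
          = (V k).conjTranspose * (X * (V k * σ * (V k).conjTranspose) * X.conjTranspose
            * V k) := by
        simp only [Matrix.conjTranspose_mul, Matrix.conjTranspose_conjTranspose, mul_assoc]
      rw [e, rtr_mul_comm (V k).conjTranspose, mul_assoc (_ * _) (V k), hV', mul_one]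
    have h3 : rtr (X.conjTranspose * ρ' * X)
        = ∑ k, p k * rtr (((V k).conjTranspose * X * V k).conjTranspose * ρ
        * ((V k).conjTranspose * X * V k)) := by
      rw [hρ, Finset.mul_sum, Finset.sum_mul, map_sum]
      refine Finset.sum_congr rfl fun k _ => ?_
      rw [mul_smul_comm, smul_mul_assoc, map_smul, smul_eq_mul]
      congr 1
      have e : ((V k).conjTranspose * X * V k).conjTranspose * ρ
          * ((V k).conjTranspose * X * V k)
          = (V k).conjTranspose * (X.conjTranspose * (V k * ρ * (V k).conjTranspose) * X
            * V k) := by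
        simp only [Matrix.conjTranspose_mul, Matrix.conjTranspose_conjTranspose, mul_assoc]
      rw [e, rtr_mul_comm (V k).conjTranspose, mul_assoc (_ * _) (V k), hV', mul_one]
    rw [varForm, h1, h2, h3]
    simp only [varForm, mul_sub, Finset.sum_sub_distrib, Finset.mul_sum]
    congr 1
    · congr 1
      exact Finset.sum_congr rfl fun k _ => by ring
    · exact Finset.sum_congr rfl fun k _ => by ring
  rw [← hX, hsum]
  calc _ ≤ ∑ k, p k * quasiEnt D E l := Finset.sum_le_sum fun k _ =>
        mul_le_mul_of_nonneg_left (varForm_le_quasiEnt D E hD hE hl _) (hp k)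
    _ = _ := by rw [← Finset.sum_mul, hp1, one_mul]

theorem hasDerivAt_logInterp {ρ σ : Matrix n n ℂ} (D : SpecDecomp ρ ι) (E : SpecDecomp σ κ)
    (hD : ∀ i, 0 < D.val i) (hE : ∀ j, 0 < E.val j) {l : ℝ} (hl : 0 ≤ l) :
    HasDerivAt (logInterp D E) (quasiEnt D E l) l := by
  unfold logInterp quasiEnt
  refine HasDerivAt.fun_sum fun i _ => HasDerivAt.fun_sum fun j _ => ?_
  have hs : 0 < E.val j + l * D.val i :=
    add_pos_of_pos_of_nonneg (hE j) (mul_nonneg hl (hD i).le)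
  have h1 : HasDerivAt (fun l => E.val j + l * D.val i) (D.val i) l := by
    simpa using ((hasDerivAt_id l).mul_const (D.val i)).const_add (E.val j)
  have h2 := ((h1.log hs.ne').const_mul (D.val i)).mul_const (rtr (D.proj i * E.proj j))
  refine h2.congr_deriv ?_
  ring

theorem tendsto_logInterp {ρ σ : Matrix n n ℂ} (D : SpecDecomp ρ ι) (E : SpecDecomp σ κ)
    (hD : ∀ i, 0 < D.val i) :
    Filter.Tendsto (fun l => logInterp D E l - Real.log l * rtr ρ) Filter.atTop
      (𝓝 (∑ i, D.val i * Real.log (D.val i))) := by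
  have h1 := D.rtr_comb_mul_comb E D.val (fun _ => 1)
  rw [D.comb_val, E.comb_one, mul_one] at h1
  have h2 := D.rtr_comb_mul_comb E (fun i => D.val i * Real.log (D.val i)) (fun _ => 1)
  rw [D.rtr_comb_mul, E.comb_one] at h2
  simp only [mul_one, D.rtr_proj] at h1 h2
  rw [h1, h2]
  have h3 : Filter.Tendsto (fun l : ℝ => ∑ i, ∑ j, D.val i
      * Real.log (E.val j / l + D.val i) * rtr (D.proj i * E.proj j)) Filter.atTop
      (𝓝 (∑ i, ∑ j, D.val i * Real.log (D.val i) * rtr (D.proj i * E.proj j))) := by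
    refine tendsto_finsetSum _ fun i _ => tendsto_finsetSum _ fun j _ => ?_
    refine Filter.Tendsto.mul_const _ (Filter.Tendsto.const_mul _ ?_)
    have h4 : Filter.Tendsto (fun l : ℝ => E.val j / l + D.val i) Filter.atTop
        (𝓝 (0 + D.val i)) :=
      (Filter.Tendsto.div_atTop tendsto_const_nhds Filter.tendsto_id).add_const _
    rw [zero_add] at h4
    exact h4.log (hD i).ne'
  have h5 : ∀ᶠ l : ℝ in Filter.atTop, ∀ i j, 0 < E.val j / l + D.val i := by
    rw [Filter.eventually_all]
    intro i
    rw [Filter.eventually_all]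
    intro j
    have h4 : Filter.Tendsto (fun l : ℝ => E.val j / l + D.val i) Filter.atTop
        (𝓝 (0 + D.val i)) :=
      (Filter.Tendsto.div_atTop tendsto_const_nhds Filter.tendsto_id).add_const _
    rw [zero_add] at h4
    exact h4.eventually_const_lt (hD i)
  refine h3.congr' ?_
  filter_upwards [h5, Filter.eventually_gt_atTop 0] with l hl5 hl
  rw [logInterp, Finset.mul_sum, ← Finset.sum_sub_distrib]
  refine Finset.sum_congr rfl fun i _ => ?_
  rw [Finset.mul_sum, ← Finset.sum_sub_distrib]
  refine Finset.sum_congr rfl fun j _ => ?_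
  have e : E.val j + l * D.val i = l * (E.val j / l + D.val i) := by field_simp
  rw [e, Real.log_mul hl.ne' (hl5 i j).ne']
  ring

/-- Monotonicity of the relative entropy under mixtures of unitary conjugations, obtained by
integrating the inequality for the quasi-entropies over `l ∈ [0, ∞)`. -/
theorem relEnt_mix_le {ρ σ ρ' σ' : Matrix n n ℂ} (D : SpecDecomp ρ ι) (E : SpecDecomp σ κ)
    (D' : SpecDecomp ρ' ι') (E' : SpecDecomp σ' κ')
    (hD : ∀ i, 0 < D.val i) (hE : ∀ j, 0 < E.val j)
    (hD' : ∀ i, 0 < D'.val i) (hE' : ∀ j, 0 < E'.val j)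
    {p : ν → ℝ} (hp : ∀ k, 0 ≤ p k) (hp1 : ∑ k, p k = 1) {V : ν → Matrix n n ℂ}
    (hV : ∀ k, (V k).conjTranspose * V k = 1)
    (hρ : ρ' = ∑ k, p k • (V k * ρ * (V k).conjTranspose))
    (hσ : σ' = ∑ k, p k • (V k * σ * (V k).conjTranspose)) :
    relEnt D' E' ≤ relEnt D E := by
  have htr : rtr ρ' = rtr ρ := by
    rw [hρ, map_sum]
    calc _ = ∑ k, p k * rtr ρ := Finset.sum_congr rfl fun k _ => by
          rw [map_smul, rtr_mul_comm, ← mul_assoc, hV, one_mul, smul_eq_mul]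
      _ = _ := by rw [← Finset.sum_mul, hp1, one_mul]
  have hmono : MonotoneOn (fun l => logInterp D E l - logInterp D' E' l) (Set.Ici 0) := by
    have hd : ∀ l, 0 ≤ l → HasDerivAt (fun l => logInterp D E l - logInterp D' E' l)
        (quasiEnt D E l - quasiEnt D' E' l) l := fun l hl =>
      (hasDerivAt_logInterp D E hD hE hl).sub (hasDerivAt_logInterp D' E' hD' hE' hl)
    refine monotoneOn_of_deriv_nonneg (convex_Ici 0)
      (fun l hl => (hd l hl).continuousAt.continuousWithinAt)
      (fun l hl => (hd l (interior_subset hl)).differentiableAt.differentiableWithinAt)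
      fun l hl => ?_
    rw [(hd l (interior_subset hl)).deriv, sub_nonneg]
    exact quasiEnt_mix_le D E D' E' hD hE hD' hE' hp hp1 hV hρ hσ (interior_subset hl)
  have hlim := (tendsto_logInterp D E hD).sub (tendsto_logInterp D' E' hD')
  have h0 : logInterp D E 0 - logInterp D' E' 0
      ≤ (∑ i, D.val i * Real.log (D.val i)) - ∑ i, D'.val i * Real.log (D'.val i) := by
    refine ge_of_tendsto hlim ?_
    filter_upwards [Filter.eventually_ge_atTop 0] with l hl
    have := hmono (Set.mem_Ici.2 le_rfl) (Set.mem_Ici.2 hl) hl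
    simp only at this
    rw [htr]
    linarith
  simp only [logInterp, zero_mul, add_zero] at h0
  rw [relEnt, relEnt]
  linarith

end RelativeEntropy

/-! ### Marginals, mutual information and data processing -/

section Marginals

variable {n m : Type*} [Fintype n] [Fintype m]

theorem marginalA_add (X Y : Matrix (n × m) (n × m) ℂ) :
    marginalA (X + Y) = marginalA X + marginalA Y := by
  ext a b; simp [marginalA, Finset.sum_add_distrib]

theorem marginalS_add (X Y : Matrix (n × m) (n × m) ℂ) :
    marginalS (X + Y) = marginalS X + marginalS Y := by
  ext a b; simp [marginalS, Finset.sum_add_distrib]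

theorem marginalA_rsmul (c : ℝ) (X : Matrix (n × m) (n × m) ℂ) :
    marginalA (c • X) = c • marginalA X := by
  ext a b; simp [marginalA, Finset.mul_sum]

theorem marginalS_rsmul (c : ℝ) (X : Matrix (n × m) (n × m) ℂ) :
    marginalS (c • X) = c • marginalS X := by
  ext a b; simp [marginalS, Finset.mul_sum]

theorem marginalA_sum {ν : Type*} (s : Finset ν) (X : ν → Matrix (n × m) (n × m) ℂ) :
    marginalA (∑ k ∈ s, X k) = ∑ k ∈ s, marginalA (X k) := by
  ext a b
  simp only [marginalA, Matrix.of_apply, Matrix.sum_apply]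
  exact Finset.sum_comm

theorem marginalS_sum {ν : Type*} (s : Finset ν) (X : ν → Matrix (n × m) (n × m) ℂ) :
    marginalS (∑ k ∈ s, X k) = ∑ k ∈ s, marginalS (X k) := by
  ext a b
  simp only [marginalS, Matrix.of_apply, Matrix.sum_apply]
  exact Finset.sum_comm

theorem marginalA_kronecker (A : Matrix n n ℂ) (B : Matrix m m ℂ) :
    marginalA (A ⊗ₖ B) = B.trace • A := by
  ext a b
  simp [marginalA, Matrix.trace, mul_comm, Finset.mul_sum]

theorem marginalS_kronecker (A : Matrix n n ℂ) (B : Matrix m m ℂ) :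
    marginalS (A ⊗ₖ B) = A.trace • B := by
  ext a b
  simp [marginalS, Matrix.trace, Finset.sum_mul]

theorem marginalA_posSemidef {X : Matrix (n × m) (n × m) ℂ} (hX : X.PosSemidef) :
    (marginalA X).PosSemidef := by
  have e : marginalA X = ∑ i, X.submatrix (fun a => (a, i)) (fun a => (a, i)) := by
    ext a b; simp [marginalA, Matrix.sum_apply]
  rw [e]
  exact Matrix.posSemidef_sum _ fun i _ => hX.submatrix _

theorem marginalS_posSemidef {X : Matrix (n × m) (n × m) ℂ} (hX : X.PosSemidef) :
    (marginalS X).PosSemidef := by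
  have e : marginalS X = ∑ i, X.submatrix (fun a => (i, a)) (fun a => (i, a)) := by
    ext a b; simp [marginalS, Matrix.sum_apply]
  rw [e]
  exact Matrix.posSemidef_sum _ fun i _ => hX.submatrix _

theorem marginalA_posDef [Nonempty m] {X : Matrix (n × m) (n × m) ℂ} (hX : X.PosDef) :
    (marginalA X).PosDef := by
  have e : marginalA X = ∑ i, X.submatrix (fun a => (a, i)) (fun a => (a, i)) := by
    ext a b; simp [marginalA, Matrix.sum_apply]
  rw [e]
  exact Matrix.posDef_sum Finset.univ_nonempty fun i _ =>
    hX.submatrix fun a b h => (Prod.ext_iff.1 h).1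

theorem marginalS_posDef [Nonempty n] {X : Matrix (n × m) (n × m) ℂ} (hX : X.PosDef) :
    (marginalS X).PosDef := by
  have e : marginalS X = ∑ i, X.submatrix (fun a => (i, a)) (fun a => (i, a)) := by
    ext a b; simp [marginalS, Matrix.sum_apply]
  rw [e]
  exact Matrix.posDef_sum Finset.univ_nonempty fun i _ =>
    hX.submatrix fun a b h => (Prod.ext_iff.1 h).2

theorem trace_marginalA (X : Matrix (n × m) (n × m) ℂ) : (marginalA X).trace = X.trace := by
  simp [Matrix.trace, marginalA, Fintype.sum_prod_type]

theorem trace_marginalS (X : Matrix (n × m) (n × m) ℂ) : (marginalS X).trace = X.trace := by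
  simp only [Matrix.trace, marginalS, Fintype.sum_prod_type, Matrix.diag_apply, Matrix.of_apply]
  exact Finset.sum_comm

variable [DecidableEq n] [DecidableEq m]

theorem trace_mul_kronecker_one (X : Matrix (n × m) (n × m) ℂ) (A : Matrix n n ℂ) :
    (X * (A ⊗ₖ (1 : Matrix m m ℂ))).trace = (marginalA X * A).trace := by
  simp only [Matrix.trace, Matrix.diag_apply, Matrix.mul_apply, Fintype.sum_prod_type,
    Matrix.kroneckerMap_apply, Matrix.one_apply, mul_ite, mul_one, mul_zero,
    Finset.sum_ite_eq', Finset.mem_univ, if_true, marginalA, Matrix.of_apply, Finset.sum_mul]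
  refine Finset.sum_congr rfl fun a _ => ?_
  rw [Finset.sum_comm]

theorem trace_mul_one_kronecker (X : Matrix (n × m) (n × m) ℂ) (B : Matrix m m ℂ) :
    (X * ((1 : Matrix n n ℂ) ⊗ₖ B)).trace = (marginalS X * B).trace := by
  have h : ∀ a i, ∑ b, ∑ j, X (a, i) (b, j) * ((1 : Matrix n n ℂ) b a * B j i)
      = ∑ j, X (a, i) (a, j) * B j i := fun a i => by
    rw [Finset.sum_eq_single a]
    · simp
    · intro b _ hb
      simp [Matrix.one_apply_ne hb]
    · simp
  simp only [Matrix.trace, Matrix.diag_apply, Matrix.mul_apply, Fintype.sum_prod_type,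
    Matrix.kroneckerMap_apply, h, marginalS, Matrix.of_apply, Finset.sum_mul]
  rw [Finset.sum_comm]
  exact Finset.sum_congr rfl fun i _ => Finset.sum_comm

theorem marginalA_conj_one_kronecker (X : Matrix (n × m) (n × m) ℂ) {u : Matrix m m ℂ}
    (hu : u.conjTranspose * u = 1) :
    marginalA ((1 : Matrix n n ℂ) ⊗ₖ u * X * ((1 : Matrix n n ℂ) ⊗ₖ u).conjTranspose)
      = marginalA X := by
  refine Matrix.ext_iff_trace_mul_right.2 fun A => ?_
  rw [← trace_mul_kronecker_one, ← trace_mul_kronecker_one, Matrix.conjTranspose_kronecker,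
    Matrix.conjTranspose_one, mul_assoc, ← Matrix.mul_kronecker_mul, one_mul, mul_one, mul_assoc,
    Matrix.trace_mul_comm, mul_assoc, ← Matrix.mul_kronecker_mul, mul_one, hu]

theorem marginalS_conj_one_kronecker (X : Matrix (n × m) (n × m) ℂ) (u : Matrix m m ℂ) :
    marginalS ((1 : Matrix n n ℂ) ⊗ₖ u * X * ((1 : Matrix n n ℂ) ⊗ₖ u).conjTranspose)
      = u * marginalS X * u.conjTranspose := by
  refine Matrix.ext_iff_trace_mul_right.2 fun A => ?_
  rw [← trace_mul_one_kronecker, Matrix.conjTranspose_kronecker, Matrix.conjTranspose_one,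
    mul_assoc, ← Matrix.mul_kronecker_mul, one_mul, mul_assoc, Matrix.trace_mul_comm, mul_assoc,
    ← Matrix.mul_kronecker_mul, one_mul, trace_mul_one_kronecker,
    ← mul_assoc, Matrix.trace_mul_comm, ← mul_assoc, ← mul_assoc]

end Marginals

section DataProcessing

variable {n m : Type*} [Fintype n] [Fintype m] [DecidableEq n] [DecidableEq m]
  {ν : Type*} [Fintype ν]

/-- The mutual information is the relative entropy to the product of the marginals. -/
theorem mutualInfo_eq_relEnt {ι κ η : Type*} [Fintype ι] [Fintype κ] [Fintype η]
    {ρ : Matrix (n × m) (n × m) ℂ} (D : SpecDecomp ρ ι) (F : SpecDecomp (marginalA ρ) κ)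
    (G : SpecDecomp (marginalS ρ) η) (hF : ∀ a, 0 < F.val a) (hG : ∀ i, 0 < G.val i) :
    mutualInfo ρ = relEnt D (F.kron G) := by
  have h1 : ∑ i, ∑ j, D.val i * Real.log ((F.kron G).val j) * rtr (D.proj i * (F.kron G).proj j)
      = (∑ a, F.val a * Real.log (F.val a)) + ∑ i, G.val i * Real.log (G.val i) := by
    have h := D.rtr_comb_mul_comb (F.kron G) D.val (fun j => Real.log ((F.kron G).val j))
    rw [← h, D.comb_val, (F.kron G).rtr_mul_comb, Fintype.sum_prod_type]
    have e : ∀ a i, Real.log ((F.kron G).val (a, i)) * rtr (ρ * (F.kron G).proj (a, i))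
        = Real.log (F.val a) * rtr (ρ * (F.proj a ⊗ₖ G.proj i))
          + Real.log (G.val i) * rtr (ρ * (F.proj a ⊗ₖ G.proj i)) := fun a i => by
      change Real.log (F.val a * G.val i) * rtr (ρ * (F.proj a ⊗ₖ G.proj i)) = _
      rw [Real.log_mul (hF a).ne' (hG i).ne', add_mul]
    simp_rw [e, Finset.sum_add_distrib]
    congr 1
    · refine Finset.sum_congr rfl fun a _ => ?_
      rw [← Finset.mul_sum, ← map_sum, ← Finset.mul_sum]
      have e2 : ∑ i, F.proj a ⊗ₖ G.proj i = F.proj a ⊗ₖ (1 : Matrix m m ℂ) := by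
        rw [← G.sum_proj]
        ext x y
        simp [Matrix.sum_apply, Finset.mul_sum]
      rw [e2, rtr_apply, trace_mul_kronecker_one, ← rtr_apply, F.rtr_mul_proj_self, mul_comm]
    · rw [Finset.sum_comm]
      refine Finset.sum_congr rfl fun i _ => ?_
      rw [← Finset.mul_sum, ← map_sum, ← Finset.mul_sum]
      have e2 : ∑ a, F.proj a ⊗ₖ G.proj i = (1 : Matrix n n ℂ) ⊗ₖ G.proj i := by
        rw [← F.sum_proj]
        ext x y
        simp [Matrix.sum_apply, Finset.sum_mul]
      rw [e2, rtr_apply, trace_mul_one_kronecker, ← rtr_apply, G.rtr_mul_proj_self, mul_comm]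
  rw [relEnt, h1, mutualInfo, D.entropy_eq, F.entropy_eq, G.entropy_eq]
  simp only [Real.negMulLog, neg_mul, Finset.sum_neg_distrib]
  ring

/-- The local unitary mixture `∑ₖ pₖ (1 ⊗ uₖ) ρ (1 ⊗ uₖ)ᴴ`. -/
noncomputable def localMix (p : ν → ℝ) (u : ν → Matrix m m ℂ) (ρ : Matrix (n × m) (n × m) ℂ) :
    Matrix (n × m) (n × m) ℂ :=
  ∑ k, p k • ((1 : Matrix n n ℂ) ⊗ₖ u k * ρ * ((1 : Matrix n n ℂ) ⊗ₖ u k).conjTranspose)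

variable {p : ν → ℝ} {u : ν → Matrix m m ℂ}

theorem one_kronecker_unitary {u : Matrix m m ℂ} (hu : u.conjTranspose * u = 1) :
    ((1 : Matrix n n ℂ) ⊗ₖ u).conjTranspose * ((1 : Matrix n n ℂ) ⊗ₖ u) = 1 := by
  rw [Matrix.conjTranspose_kronecker, ← Matrix.mul_kronecker_mul, hu, Matrix.conjTranspose_one,
    mul_one, Matrix.one_kronecker_one]

theorem localMix_posSemidef (hp : ∀ k, 0 ≤ p k) {ρ : Matrix (n × m) (n × m) ℂ}
    (hρ : ρ.PosSemidef) : (localMix p u ρ).PosSemidef :=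
  Matrix.posSemidef_sum _ fun k _ =>
    PosSemidef.rsmul (hρ.mul_mul_conjTranspose_same _) (hp k)

theorem marginalA_localMix (hp1 : ∑ k, p k = 1) (hu : ∀ k, (u k).conjTranspose * u k = 1)
    (ρ : Matrix (n × m) (n × m) ℂ) : marginalA (localMix p u ρ) = marginalA ρ := by
  simp only [localMix, marginalA_sum, marginalA_rsmul, marginalA_conj_one_kronecker _ (hu _)]
  rw [← Finset.sum_smul, hp1, one_smul]

theorem marginalS_localMix (ρ : Matrix (n × m) (n × m) ℂ) :
    marginalS (localMix p u ρ) = ∑ k, p k • (u k * marginalS ρ * (u k).conjTranspose) := by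
  simp only [localMix, marginalS_sum, marginalS_rsmul, marginalS_conj_one_kronecker]

theorem localMix_add_smul_one (hp1 : ∑ k, p k = 1) (hu : ∀ k, (u k).conjTranspose * u k = 1)
    (ρ : Matrix (n × m) (n × m) ℂ) (e : ℝ) :
    localMix p u (ρ + e • (1 : Matrix (n × m) (n × m) ℂ)) = localMix p u ρ + e • 1 := by
  have h : ∀ k, (1 : Matrix n n ℂ) ⊗ₖ u k * ((1 : Matrix n n ℂ) ⊗ₖ u k).conjTranspose = 1 :=
    fun k => mul_eq_one_comm.1 (one_kronecker_unitary (hu k))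
  simp only [localMix, mul_add, add_mul, smul_add, Finset.sum_add_distrib, mul_smul_comm, mul_one,
    smul_mul_assoc, h]
  congr 1
  rw [← Finset.sum_smul, hp1, one_smul]

/-- Local unitary mixtures do not increase the mutual information of a positive definite
operator. -/
theorem mutualInfo_localMix_le_of_posDef [Nonempty n] [Nonempty m] (hp : ∀ k, 0 ≤ p k)
    (hp1 : ∑ k, p k = 1) (hu : ∀ k, (u k).conjTranspose * u k = 1)
    {ρ : Matrix (n × m) (n × m) ℂ} (hρ : ρ.PosDef) (hρ' : (localMix p u ρ).PosDef) :
    mutualInfo (localMix p u ρ) ≤ mutualInfo ρ := by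
  have hA := marginalA_posDef hρ
  have hS := marginalS_posDef hρ
  have hA' := marginalA_posDef hρ'
  have hS' := marginalS_posDef hρ'
  let D := SpecDecomp.ofIsHermitian hρ.isHermitian
  let F := SpecDecomp.ofIsHermitian hA.isHermitian
  let G := SpecDecomp.ofIsHermitian hS.isHermitian
  let D' := SpecDecomp.ofIsHermitian hρ'.isHermitian
  let F' := SpecDecomp.ofIsHermitian hA'.isHermitian
  let G' := SpecDecomp.ofIsHermitian hS'.isHermitian
  rw [mutualInfo_eq_relEnt D F G (F.val_pos hA) (G.val_pos hS),
    mutualInfo_eq_relEnt D' F' G' (F'.val_pos hA') (G'.val_pos hS')]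
  refine relEnt_mix_le D (F.kron G) D' (F'.kron G') (D.val_pos hρ)
    (fun j => mul_pos (F.val_pos hA _) (G.val_pos hS _)) (D'.val_pos hρ')
    (fun j => mul_pos (F'.val_pos hA' _) (G'.val_pos hS' _)) hp hp1
    (fun k => one_kronecker_unitary (hu k)) rfl ?_
  rw [marginalA_localMix hp1 hu, marginalS_localMix]
  have e : ∀ k, (1 : Matrix n n ℂ) ⊗ₖ u k * (marginalA ρ ⊗ₖ marginalS ρ)
      * ((1 : Matrix n n ℂ) ⊗ₖ u k).conjTranspose
      = marginalA ρ ⊗ₖ (u k * marginalS ρ * (u k).conjTranspose) := fun k => by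
    rw [Matrix.conjTranspose_kronecker, ← Matrix.mul_kronecker_mul, ← Matrix.mul_kronecker_mul,
      one_mul, Matrix.conjTranspose_one, mul_one]
  simp_rw [e, ← Matrix.kronecker_smul]
  ext x y
  simp [Matrix.sum_apply, Finset.mul_sum]

theorem tendsto_entropy_add_smul_one {k : Type*} [Fintype k] [DecidableEq k] {A : Matrix k k ℂ}
    (hA : A.IsHermitian) (c : ℝ) :
    Filter.Tendsto (fun e : ℝ => entropy (A + (e * c) • (1 : Matrix k k ℂ))) (𝓝[>] 0)
      (𝓝 (entropy A)) := by
  let D := SpecDecomp.ofIsHermitian hA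
  have h : ∀ e : ℝ, entropy (A + (e * c) • (1 : Matrix k k ℂ))
      = ∑ i, Real.negMulLog (1 * D.val i + e * c) := fun e => by
    have := (D.affine 1 (e * c)).entropy_eq
    simp only [one_smul] at this
    exact this
  simp_rw [h]
  have hc : Continuous fun e : ℝ => ∑ i, Real.negMulLog (1 * D.val i + e * c) :=
    continuous_finsetSum _ fun i _ => Real.continuous_negMulLog.comp (by fun_prop)
  have := (hc.tendsto 0).mono_left (nhdsWithin_le_nhds (s := Set.Ioi 0))
  simpa [D.entropy_eq] using this

theorem tendsto_mutualInfo_add_smul_one {ρ : Matrix (n × m) (n × m) ℂ} (hρ : ρ.PosSemidef) :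
    Filter.Tendsto (fun e : ℝ => mutualInfo (ρ + e • (1 : Matrix (n × m) (n × m) ℂ))) (𝓝[>] 0)
      (𝓝 (mutualInfo ρ)) := by
  have h := ((tendsto_entropy_add_smul_one (marginalA_posSemidef hρ).isHermitian
    (Fintype.card m : ℝ)).add (tendsto_entropy_add_smul_one (marginalS_posSemidef hρ).isHermitian
    (Fintype.card n : ℝ))).sub (tendsto_entropy_add_smul_one hρ.isHermitian 1)
  refine h.congr fun e => ?_
  rw [mutualInfo, marginalA_add, marginalS_add, marginalA_rsmul, marginalS_rsmul, mul_one]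
  have h1 : marginalA (1 : Matrix (n × m) (n × m) ℂ) = (Fintype.card m : ℝ) • 1 := by
    rw [← Matrix.one_kronecker_one, marginalA_kronecker, Matrix.trace_one]
    ext a b; simp
  have h2 : marginalS (1 : Matrix (n × m) (n × m) ℂ) = (Fintype.card n : ℝ) • 1 := by
    rw [← Matrix.one_kronecker_one, marginalS_kronecker, Matrix.trace_one]
    ext a b; simp
  rw [h1, h2, smul_smul, smul_smul]

/-- **Data processing**: local unitary mixtures do not increase the mutual information. -/
theorem mutualInfo_localMix_le [Nonempty n] [Nonempty m] (hp : ∀ k, 0 ≤ p k)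
    (hp1 : ∑ k, p k = 1) (hu : ∀ k, (u k).conjTranspose * u k = 1)
    {ρ : Matrix (n × m) (n × m) ℂ} (hρ : ρ.PosSemidef) :
    mutualInfo (localMix p u ρ) ≤ mutualInfo ρ := by
  have hρ' : (localMix p u ρ).PosSemidef := localMix_posSemidef hp hρ
  refine le_of_tendsto_of_tendsto (tendsto_mutualInfo_add_smul_one hρ')
    (tendsto_mutualInfo_add_smul_one hρ) ?_
  filter_upwards [self_mem_nhdsWithin] with e he
  have he1 : (e • (1 : Matrix (n × m) (n × m) ℂ)).PosDef := by
    have := (Matrix.PosDef.one (n := n × m) (R := ℂ)).smul (α := ℂ) (a := (e : ℂ))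
      (by exact_mod_cast he)
    rwa [Complex.coe_smul] at this
  rw [← localMix_add_smul_one hp1 hu]
  refine mutualInfo_localMix_le_of_posDef hp hp1 hu (he1.posSemidef_add hρ) ?_
  rw [localMix_add_smul_one hp1 hu]
  exact he1.posSemidef_add hρ'

end DataProcessing

/-! ### Perturbation of commuting differences -/

section Frobenius

variable {n : Type*} [Fintype n] [DecidableEq n] {ι κ η : Type*} [Fintype ι] [Fintype κ]
  [Fintype η]

/-- The Frobenius norm. -/
noncomputable def frob (A : Matrix n n ℂ) : ℝ := √(rtr (A.conjTranspose * A))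

theorem rtr_conjTranspose_mul_self_nonneg (A : Matrix n n ℂ) :
    0 ≤ rtr (A.conjTranspose * A) :=
  rtr_nonneg (Matrix.posSemidef_conjTranspose_mul_self A)

theorem frob_nonneg (A : Matrix n n ℂ) : 0 ≤ frob A := Real.sqrt_nonneg _

theorem frob_sq (A : Matrix n n ℂ) : frob A ^ 2 = rtr (A.conjTranspose * A) :=
  Real.sq_sqrt (rtr_conjTranspose_mul_self_nonneg A)

theorem frob_conjTranspose (A : Matrix n n ℂ) : frob A.conjTranspose = frob A := by
  rw [frob, frob, Matrix.conjTranspose_conjTranspose, rtr_mul_comm]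

/-- The Cauchy-Schwarz inequality for the Frobenius norm. -/
theorem abs_rtr_mul_le (A B : Matrix n n ℂ) : |rtr (A * B)| ≤ frob A * frob B := by
  have h : ∀ s : ℝ, 0 ≤ rtr (B.conjTranspose * B) * (s * s) + (2 * rtr (A * B)) * s
      + rtr (A.conjTranspose * A) := by
    intro s
    have h1 := rtr_conjTranspose_mul_self_nonneg (A.conjTranspose + s • B)
    have h2 : rtr (B.conjTranspose * A.conjTranspose) = rtr (A * B) := by
      rw [← Matrix.conjTranspose_mul, rtr_conjTranspose]
    have h3 : rtr (A * A.conjTranspose) = rtr (A.conjTranspose * A) := rtr_mul_comm _ _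
    simp only [Matrix.conjTranspose_add, Matrix.conjTranspose_smul, star_trivial,
      Matrix.conjTranspose_conjTranspose, add_mul, mul_add, smul_mul_assoc, mul_smul_comm,
      map_add, map_smul, smul_eq_mul, h2, h3] at h1
    nlinarith
  have hd := discrim_le_zero h
  rw [discrim] at hd
  refine abs_le_of_sq_le_sq ?_ (mul_nonneg (frob_nonneg A) (frob_nonneg B))
  rw [mul_pow, frob_sq, frob_sq]
  nlinarith

theorem frob_comb_mul_le {A : Matrix n n ℂ} (D : SpecDecomp A ι) {c : ι → ℝ} {e : ℝ}
    (he : 0 ≤ e) (hc : ∀ i, |c i| ≤ e) (Y : Matrix n n ℂ) :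
    frob (D.comb c * Y) ≤ e * frob Y := by
  refine Real.sqrt_le_iff.2 ⟨mul_nonneg he (frob_nonneg Y), ?_⟩
  have h1 : rtr ((D.comb c * Y).conjTranspose * (D.comb c * Y))
      = ∑ i, c i * c i * rtr (D.proj i * (Y * Y.conjTranspose)) := by
    rw [← D.rtr_comb_mul (fun i => c i * c i), ← D.comb_mul, Matrix.conjTranspose_mul, D.comb_herm,
      ← mul_assoc (D.comb c * D.comb c), rtr_mul_comm _ Y.conjTranspose]
    simp only [mul_assoc]
  have h2 : rtr (Y.conjTranspose * Y) = ∑ i, 1 * rtr (D.proj i * (Y * Y.conjTranspose)) := by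
    rw [← D.rtr_comb_mul (fun _ => 1), D.comb_one, one_mul, rtr_mul_comm]
  rw [h1, mul_pow, frob_sq, h2, Finset.mul_sum]
  refine Finset.sum_le_sum fun i _ => ?_
  rw [one_mul]
  refine mul_le_mul_of_nonneg_right ?_
    (D.rtr_proj_mul_nonneg i (Matrix.posSemidef_self_mul_conjTranspose Y))
  rw [← sq]
  exact sq_le_sq' (abs_le.1 (hc i)).1 (abs_le.1 (hc i)).2

theorem frob_mul_comb_le {A : Matrix n n ℂ} (D : SpecDecomp A ι) {c : ι → ℝ} {e : ℝ}
    (he : 0 ≤ e) (hc : ∀ i, |c i| ≤ e) (Y : Matrix n n ℂ) :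
    frob (Y * D.comb c) ≤ e * frob Y := by
  have h := frob_comb_mul_le D he hc Y.conjTranspose
  rw [frob_conjTranspose] at h
  rwa [← frob_conjTranspose, Matrix.conjTranspose_mul, D.comb_herm]

/-- A perturbative estimate: if the form `tr Z Y` dominates `‖Y‖²`, then so does
`tr Z (1+E₁)⁻¹ Y (1+E₁)⁻¹`, and this beats the term `tr K (1+E₁)⁻¹ Y (1+E₂)⁻¹ Y (1+E₁)⁻¹`, which
is of the same order in `Y` but has the small factor `K`. -/
theorem rtr_perturbation_le {E₁ E₂ K Y Z : Matrix n n ℂ} (D₁ : SpecDecomp E₁ ι)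
    (D₂ : SpecDecomp E₂ κ) (D₃ : SpecDecomp K η) {e k G c : ℝ} (he : 0 ≤ e) (he1 : e < 1)
    (hk : 0 ≤ k) (hG : 0 ≤ G) (h₁ : ∀ i, |D₁.val i| ≤ e) (h₂ : ∀ i, |D₂.val i| ≤ e)
    (h₃ : ∀ i, |D₃.val i| ≤ k) (hZY : c * frob Y ^ 2 ≤ rtr (Z * Y)) (hZ : frob Z ≤ G * frob Y)
    (hc : (2 * (e / (1 - e)) + (e / (1 - e)) ^ 2) * G + k * (1 / (1 - e)) ^ 3 ≤ c) :
    rtr (K * (D₁.comb fun i => (1 + D₁.val i)⁻¹) * Y * (D₂.comb fun i => (1 + D₂.val i)⁻¹) * Y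
        * (D₁.comb fun i => (1 + D₁.val i)⁻¹))
      ≤ rtr (Z * (D₁.comb fun i => (1 + D₁.val i)⁻¹) * Y
        * (D₁.comb fun i => (1 + D₁.val i)⁻¹)) := by
  have h1e : 0 < 1 - e := by linarith
  set f := e / (1 - e) with hf
  set r := 1 / (1 - e) with hr
  have hf0 : 0 ≤ f := by positivity
  have hr0 : 0 ≤ r := by positivity
  have hinv : ∀ x : ℝ, |x| ≤ e → |(1 + x)⁻¹| ≤ r := by
    intro x hx
    have hx' : 1 - e ≤ 1 + x := by linarith [(abs_le.1 hx).1]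
    rw [abs_of_pos (inv_pos.2 (h1e.trans_le hx')), hr, one_div]
    exact inv_anti₀ h1e hx'
  have hinv' : ∀ x : ℝ, |x| ≤ e → |(1 + x)⁻¹ - 1| ≤ f := by
    intro x hx
    have hx' : 1 - e ≤ 1 + x := by linarith [(abs_le.1 hx).1]
    have hx0 : 0 < 1 + x := h1e.trans_le hx'
    have e1 : (1 + x)⁻¹ - 1 = -x / (1 + x) := by field_simp; ring
    rw [e1, abs_div, abs_neg, abs_of_pos hx0]
    exact div_le_div₀ he hx h1e hx'
  set y := frob Y with hy
  have hy0 : 0 ≤ y := frob_nonneg Y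
  set F := D₁.comb fun i => (1 + D₁.val i)⁻¹ - 1 with hF
  set Ni := D₁.comb fun i => (1 + D₁.val i)⁻¹ with hNi
  set Wi := D₂.comb fun i => (1 + D₂.val i)⁻¹ with hWi
  have hNF : Ni = 1 + F := by
    rw [hF, ← D₁.comb_sub, D₁.comb_one]; abel
  have hFle : ∀ X, frob (F * X) ≤ f * frob X :=
    fun X => frob_comb_mul_le D₁ hf0 (fun i => hinv' _ (h₁ i)) X
  have hFle' : ∀ X, frob (X * F) ≤ f * frob X :=
    fun X => frob_mul_comb_le D₁ hf0 (fun i => hinv' _ (h₁ i)) X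
  have hNle : ∀ X, frob (Ni * X) ≤ r * frob X :=
    fun X => frob_comb_mul_le D₁ hr0 (fun i => hinv _ (h₁ i)) X
  have hNle' : ∀ X, frob (X * Ni) ≤ r * frob X :=
    fun X => frob_mul_comb_le D₁ hr0 (fun i => hinv _ (h₁ i)) X
  have hWle : ∀ X, frob (Wi * X) ≤ r * frob X :=
    fun X => frob_comb_mul_le D₂ hr0 (fun i => hinv _ (h₂ i)) X
  have hKle : ∀ X, frob (K * X) ≤ k * frob X := fun X => by
    have := frob_comb_mul_le D₃ hk h₃ X
    rwa [D₃.comb_val] at this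
  have hZ0 := frob_nonneg Z
  -- the three error terms from the first factor
  have t1 : -(f * G * y ^ 2) ≤ rtr (Z * (F * Y)) := by
    have h := (abs_le.1 (abs_rtr_mul_le Z (F * Y))).1
    have h' : frob Z * frob (F * Y) ≤ (G * y) * (f * y) :=
      mul_le_mul hZ (hFle Y) (frob_nonneg _) (by positivity)
    nlinarith
  have t2 : -(f * G * y ^ 2) ≤ rtr (Z * (Y * F)) := by
    have h := (abs_le.1 (abs_rtr_mul_le Z (Y * F))).1
    have h' : frob Z * frob (Y * F) ≤ (G * y) * (f * y) :=
      mul_le_mul hZ (hFle' Y) (frob_nonneg _) (by positivity)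
    nlinarith
  have t3 : -(f ^ 2 * G * y ^ 2) ≤ rtr ((Z * F) * (Y * F)) := by
    have h := (abs_le.1 (abs_rtr_mul_le (Z * F) (Y * F))).1
    have h'' : frob (Z * F) ≤ f * (G * y) :=
      (hFle' Z).trans (mul_le_mul_of_nonneg_left hZ hf0)
    have h' : frob (Z * F) * frob (Y * F) ≤ (f * (G * y)) * (f * y) :=
      mul_le_mul h'' (hFle' Y) (frob_nonneg _) (by positivity)
    nlinarith
  have hexp : Z * Ni * Y * Ni = Z * Y + Z * (F * Y) + Z * (Y * F) + (Z * F) * (Y * F) := by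
    rw [hNF]; noncomm_ring
  have t4 : rtr (K * Ni * Y * Wi * Y * Ni) ≤ k * r ^ 3 * y ^ 2 := by
    have e1 : K * Ni * Y * Wi * Y * Ni = (K * (Ni * Y)) * (Wi * (Y * Ni)) := by
      simp only [mul_assoc]
    rw [e1]
    refine (le_abs_self _).trans ((abs_rtr_mul_le _ _).trans ?_)
    have a1 : frob (K * (Ni * Y)) ≤ k * (r * y) :=
      (hKle _).trans (mul_le_mul_of_nonneg_left (hNle Y) hk)
    have a2 : frob (Wi * (Y * Ni)) ≤ r * (r * y) :=
      (hWle _).trans (mul_le_mul_of_nonneg_left (hNle' Y) hr0)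
    calc _ ≤ (k * (r * y)) * (r * (r * y)) :=
          mul_le_mul a1 a2 (frob_nonneg _) (by positivity)
      _ = _ := by ring
  rw [hexp, map_add, map_add, map_add]
  have t5 := mul_le_mul_of_nonneg_right hc (sq_nonneg y)
  nlinarith

end Frobenius

/-! ### The resolvent estimate -/

section PauliSum

variable {n : Type*} [Fintype n] [DecidableEq n]

theorem pauli_conjTranspose (k : Fin 3) : (pauli k).conjTranspose = pauli k := by
  ext i j
  fin_cases k <;> fin_cases i <;> fin_cases j <;> simp [pauli]

theorem pauli_mul_self (k : Fin 3) : pauli k * pauli k = 1 := by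
  ext i j
  fin_cases k <;> fin_cases i <;> fin_cases j <;> simp [pauli]

theorem trace_pauli (k : Fin 3) : (pauli k).trace = 0 := by
  fin_cases k <;> simp [pauli, Matrix.trace_fin_two]

theorem trace_pauli_mul (k l : Fin 3) :
    (pauli k * pauli l).trace = if k = l then 2 else 0 := by
  fin_cases k <;> fin_cases l <;> simp [pauli, Matrix.trace_fin_two] <;> norm_num

theorem one_add_pauli_posSemidef (k : Fin 3) : (1 + pauli k).PosSemidef := by
  have h := Matrix.posSemidef_conjTranspose_mul_self (1 + pauli k)
  have e : (1 + pauli k).conjTranspose * (1 + pauli k) = (2 : ℝ) • (1 + pauli k) := by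
    rw [Matrix.conjTranspose_add, pauli_conjTranspose, Matrix.conjTranspose_one, two_smul]
    simp only [add_mul, mul_add, pauli_mul_self, one_mul, mul_one]
    abel
  rw [e] at h
  have := PosSemidef.rsmul h (c := 1 / 2) (by norm_num)
  rwa [smul_smul, one_div, inv_mul_cancel₀ two_ne_zero, one_smul] at this

theorem one_sub_pauli_posSemidef (k : Fin 3) : (1 - pauli k).PosSemidef := by
  have h := Matrix.posSemidef_conjTranspose_mul_self (1 - pauli k)
  have e : (1 - pauli k).conjTranspose * (1 - pauli k) = (2 : ℝ) • (1 - pauli k) := by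
    rw [Matrix.conjTranspose_sub, pauli_conjTranspose, Matrix.conjTranspose_one, two_smul]
    simp only [sub_mul, mul_sub, pauli_mul_self, one_mul, mul_one]
    abel
  rw [e] at h
  have := PosSemidef.rsmul h (c := 1 / 2) (by norm_num)
  rwa [smul_smul, one_div, inv_mul_cancel₀ two_ne_zero, one_smul] at this

/-- The operator `∑ₖ Rₖ ⊗ σₖ`. -/
noncomputable def pauliSum (R : Fin 3 → Matrix n n ℂ) : Matrix (n × Fin 2) (n × Fin 2) ℂ :=
  ∑ k, R k ⊗ₖ pauli k

theorem pauliSum_add (R R' : Fin 3 → Matrix n n ℂ) :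
    pauliSum (fun k => R k + R' k) = pauliSum R + pauliSum R' := by
  simp [pauliSum, Matrix.add_kronecker, Finset.sum_add_distrib]

theorem pauliSum_conj (h : Matrix n n ℂ) (R : Fin 3 → Matrix n n ℂ) :
    (h ⊗ₖ (1 : Op2)) * pauliSum R * (h ⊗ₖ (1 : Op2)) = pauliSum fun k => h * R k * h := by
  simp only [pauliSum, Finset.mul_sum, Finset.sum_mul, ← Matrix.mul_kronecker_mul, one_mul, mul_one]

theorem marginalA_pauliSum (R : Fin 3 → Matrix n n ℂ) : marginalA (pauliSum R) = 0 := by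
  simp [pauliSum, marginalA_sum, marginalA_kronecker, trace_pauli]

theorem marginalS_pauliSum (R : Fin 3 → Matrix n n ℂ) :
    marginalS (pauliSum R) = ∑ k, (R k).trace • pauli k := by
  simp [pauliSum, marginalS_sum, marginalS_kronecker]

theorem pauliSum_herm {R : Fin 3 → Matrix n n ℂ} (hR : ∀ k, (R k).IsHermitian) :
    (pauliSum R).IsHermitian := by
  simp only [pauliSum, Matrix.IsHermitian, Matrix.conjTranspose_sum, Matrix.conjTranspose_kronecker,
    pauli_conjTranspose]
  exact Finset.sum_congr rfl fun k _ => by rw [(hR k).eq]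

theorem rtr_pauliSum_mul (Q Q' : Fin 3 → Matrix n n ℂ) :
    rtr (pauliSum Q * pauliSum Q') = 2 * ∑ k, rtr (Q k * Q' k) := by
  simp only [pauliSum, Finset.sum_mul, Finset.mul_sum, ← Matrix.mul_kronecker_mul, map_sum]
  refine Finset.sum_congr rfl fun k _ => ?_
  rw [Finset.sum_eq_single k]
  · rw [rtr_apply, rtr_apply, Matrix.trace_kronecker, trace_pauli_mul]
    simp [mul_comm]
  · intro l _ hl
    rw [rtr_apply, Matrix.trace_kronecker, trace_pauli_mul]
    simp [hl]
  · simp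

/-- If `-d M ≤ Rₖ ≤ d M` then `∑ₖ Rₖ ⊗ σₖ ≤ 3 d (M ⊗ 1)`. -/
theorem pauliSum_le {M : Matrix n n ℂ} {R : Fin 3 → Matrix n n ℂ} {d : ℝ}
    (h₁ : ∀ k, (d • M - R k).PosSemidef) (h₂ : ∀ k, (d • M + R k).PosSemidef) :
    ((3 * d) • (M ⊗ₖ (1 : Op2)) - pauliSum R).PosSemidef := by
  have e : (3 * d) • (M ⊗ₖ (1 : Op2)) - pauliSum R
      = ∑ k, (1 / 2 : ℝ) • ((d • M - R k) ⊗ₖ (1 + pauli k) + (d • M + R k) ⊗ₖ (1 - pauli k)) := by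
    rw [pauliSum, Fin.sum_univ_three, Fin.sum_univ_three]
    ext x y
    simp only [Matrix.sub_apply, Matrix.add_apply, Matrix.smul_apply, Matrix.kroneckerMap_apply,
      Complex.real_smul]
    push_cast
    ring
  rw [e]
  exact Matrix.posSemidef_sum _ fun k _ => PosSemidef.rsmul
    (((h₁ k).kronecker (one_add_pauli_posSemidef k)).add
      ((h₂ k).kronecker (one_sub_pauli_posSemidef k))) (by norm_num)

theorem neg_le_pauliSum {M : Matrix n n ℂ} {R : Fin 3 → Matrix n n ℂ} {d : ℝ}
    (h₁ : ∀ k, (d • M - R k).PosSemidef) (h₂ : ∀ k, (d • M + R k).PosSemidef) :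
    ((3 * d) • (M ⊗ₖ (1 : Op2)) + pauliSum R).PosSemidef := by
  have h := pauliSum_le (M := M) (R := fun k => -R k) (d := d)
    (fun k => by simpa using h₂ k) (fun k => by simpa [sub_eq_add_neg] using h₁ k)
  have e : pauliSum (fun k => -R k) = -pauliSum R := by
    simp only [pauliSum, ← Finset.sum_neg_distrib]
    refine Finset.sum_congr rfl fun k _ => ?_
    ext x y; simp
  rwa [e, sub_neg_eq_add] at h

end PauliSum

section Resolvent

variable {N : Type*} [Fintype N] [DecidableEq N] {ι κ : Type*} [Fintype ι] [Fintype κ]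

/-- The resolvent `(A + l)⁻¹`. -/
noncomputable def SpecDecomp.res {A : Matrix N N ℂ} (D : SpecDecomp A ι) (l : ℝ) : Matrix N N ℂ :=
  D.comb fun i => (D.val i + l)⁻¹

theorem SpecDecomp.mul_res {A : Matrix N N ℂ} (D : SpecDecomp A ι) {l : ℝ}
    (hD : ∀ i, D.val i + l ≠ 0) : (A + l • 1) * D.res l = 1 := by
  have h : A + l • 1 = D.comb fun i => D.val i + l := by
    have h2 : l • (1 : Matrix N N ℂ) = D.comb fun _ => l := by
      rw [← D.comb_one, D.comb_smul]; simp
    rw [h2, ← D.comb_add, D.comb_val]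
  rw [h, res, D.comb_mul, ← D.comb_one]
  congr 1
  ext i
  exact mul_inv_cancel₀ (hD i)

/-- The second resolvent expansion. -/
theorem resolvent_expansion {A Y RA RW : Matrix N N ℂ} {l : ℝ} (hA : (A + l • 1) * RA = 1)
    (hW : (A + Y + l • 1) * RW = 1) :
    RW - RA = -(RA * Y * RA) + RA * Y * RW * Y * RA := by
  have hA' : RA * (A + l • 1) = 1 := mul_eq_one_comm.1 hA
  have hW' : RW * (A + Y + l • 1) = 1 := mul_eq_one_comm.1 hW
  have e : A + Y + l • 1 = (A + l • 1) + Y := by abel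
  have h1 : RA = RW + RA * Y * RW := by
    calc RA = RA * ((A + Y + l • 1) * RW) := by rw [hW, mul_one]
      _ = (RA * (A + l • 1)) * RW + RA * Y * RW := by rw [e]; noncomm_ring
      _ = _ := by rw [hA', one_mul]
  have h2 : RA = RW + RW * Y * RA := by
    calc RA = (RW * (A + Y + l • 1)) * RA := by rw [hW', one_mul]
      _ = RW * ((A + l • 1) * RA) + RW * Y * RA := by rw [e]; noncomm_ring
      _ = _ := by rw [hA, mul_one]
  have h3 : RW = RA - RW * Y * RA := eq_sub_of_add_eq h2.symm
  calc RW - RA = -(RA * Y * RW) := by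
        rw [← sub_eq_of_eq_add' h1, neg_sub]
    _ = -(RA * Y * (RA - RW * Y * RA)) := by rw [← h3]
    _ = _ := by noncomm_ring

/-- Preconditioning of a resolvent: if `T H T = 1` and `T (X - H) T = E`, then
`X⁻¹ = T (1 + E)⁻¹ T`. -/
theorem inverse_eq_precond {X R T H E : Matrix N N ℂ} (D : SpecDecomp E ι)
    (hD : ∀ i, 1 + D.val i ≠ 0) (hT : T * H * T = 1) (hX : T * (X - H) * T = E)
    (hR : X * R = 1) : R = T * (D.comb fun i => (1 + D.val i)⁻¹) * T := by
  have hC : (1 + E) * (D.comb fun i => (1 + D.val i)⁻¹) = 1 := by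
    have h : 1 + E = D.comb fun i => 1 + D.val i := by
      rw [← D.comb_add, D.comb_val, D.comb_one]
    rw [h, D.comb_mul, ← D.comb_one]
    congr 1
    ext i
    exact mul_inv_cancel₀ (hD i)
  set C := D.comb fun i => (1 + D.val i)⁻¹
  have h1 : T * X * T = 1 + E := by rw [← hX, ← hT]; noncomm_ring
  have hTl : T * (X * T * C) = 1 := by
    calc _ = (T * X * T) * C := by simp only [mul_assoc]
      _ = 1 := by rw [h1, hC]
  have hTr : X * T * C * T = 1 := mul_eq_one_comm.1 hTl
  calc R = R * (X * T * C * T) := by rw [hTr, mul_one]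
    _ = (R * X) * (T * C * T) := by simp only [mul_assoc]
    _ = _ := by rw [mul_eq_one_comm.1 hR, one_mul]

end Resolvent

section Pointwise

variable {n : Type*} [Fintype n] [DecidableEq n] {ι κ η : Type*} [Fintype ι] [Fintype κ] [Fintype η]

/-- The inverse square root of `M + l`. -/
noncomputable def SpecDecomp.invSqrt {M : Matrix n n ℂ} (D : SpecDecomp M ι) (l : ℝ) :
    Matrix n n ℂ :=
  D.comb fun i => (√(D.val i + l))⁻¹

theorem SpecDecomp.invSqrt_conj {M : Matrix n n ℂ} (D : SpecDecomp M ι) {l : ℝ}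
    (hl : ∀ i, 0 < D.val i + l) :
    (D.invSqrt l ⊗ₖ (1 : Op2)) * (M ⊗ₖ (1 : Op2) + l • 1) * (D.invSqrt l ⊗ₖ (1 : Op2)) = 1 := by
  have e : M ⊗ₖ (1 : Op2) + l • 1 = (M + l • 1) ⊗ₖ (1 : Op2) := by
    rw [Matrix.add_kronecker, Matrix.smul_kronecker, Matrix.one_kronecker_one]
  have h : M + l • 1 = D.comb fun i => D.val i + l := by
    have h2 : l • (1 : Matrix n n ℂ) = D.comb fun _ => l := by
      rw [← D.comb_one, D.comb_smul]; simp
    rw [h2, ← D.comb_add, D.comb_val]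
  rw [e, ← Matrix.mul_kronecker_mul, ← Matrix.mul_kronecker_mul, mul_one, mul_one, h, invSqrt,
    D.comb_mul, D.comb_mul]
  have h3 : (D.comb fun i => (√(D.val i + l))⁻¹ * (D.val i + l) * (√(D.val i + l))⁻¹) = 1 := by
    rw [← D.comb_one]
    congr 1
    ext i
    have h4 := Real.sqrt_pos.2 (hl i)
    have h5 := Real.mul_self_sqrt (hl i).le
    field_simp
    nlinarith
  rw [h3, Matrix.one_kronecker_one]

theorem SpecDecomp.invSqrt_herm {M : Matrix n n ℂ} (D : SpecDecomp M ι) (l : ℝ) :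
    (D.invSqrt l).conjTranspose = D.invSqrt l := D.comb_herm _

/-- A bound `X ≤ e (M ⊗ 1)` becomes a bound by the number `e` after preconditioning with
`(M + l)^(-1/2)`, whatever `l ≥ 0`. -/
theorem SpecDecomp.precond_bound {M : Matrix n n ℂ} (D : SpecDecomp M ι) {l : ℝ}
    (hl0 : 0 ≤ l) (hl : ∀ i, 0 < D.val i + l) {e : ℝ} (he : 0 ≤ e)
    {X : Matrix (n × Fin 2) (n × Fin 2) ℂ} (hX : (e • (M ⊗ₖ (1 : Op2)) - X).PosSemidef) :
    (e • (1 : Matrix (n × Fin 2) (n × Fin 2) ℂ)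
      - (D.invSqrt l ⊗ₖ (1 : Op2)) * X * (D.invSqrt l ⊗ₖ (1 : Op2))).PosSemidef := by
  set T := D.invSqrt l ⊗ₖ (1 : Op2) with hT
  have hTh : T.conjTranspose = T := by
    rw [hT, Matrix.conjTranspose_kronecker, D.invSqrt_herm, Matrix.conjTranspose_one]
  have h1 : (e • (M ⊗ₖ (1 : Op2)) - X + (e * l) • 1).PosSemidef :=
    hX.add (PosSemidef.rsmul Matrix.PosSemidef.one (mul_nonneg he hl0))
  have h2 := h1.conjTranspose_mul_mul_same T
  have h3 := D.invSqrt_conj hl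
  rw [← hT] at h3
  rw [hTh] at h2
  convert h2 using 1
  conv_lhs => rw [← h3]
  simp only [mul_one, mul_add, add_mul, mul_sub, sub_mul, smul_add, mul_smul_comm, smul_mul_assoc,
    mul_smul]
  abel

/-- The integrand estimate behind the decay of the mutual information. Here `M ⊗ 1 + ∑ Rₖ ⊗ σₖ`
is twice the state, `M ⊗ 1 + ∑ (rₖ M) ⊗ σₖ` twice the product of its marginals, and
`-∑ Γₖ Rₖ ⊗ σₖ` its velocity. The smallness `d` of `Rₖ` and of `rₖ M` is relative to `M`, so that
the estimate is uniform in `M`. -/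
theorem resolvent_trace_le {M : Matrix n n ℂ} (DM : SpecDecomp M ι) (hM : ∀ i, 0 < DM.val i)
    {R : Fin 3 → Matrix n n ℂ} {r Γ : Fin 3 → ℝ} {d c G : ℝ} (hd : 0 ≤ d) (hd1 : d ≤ 1 / 60)
    (h₁ : ∀ k, (d • M - R k).PosSemidef) (h₂ : ∀ k, (d • M + R k).PosSemidef)
    (hr : ∀ k, |r k| ≤ d) (hΓ0 : 0 < c) (hΓ : ∀ k, c ≤ Γ k) (hΓ' : ∀ k, Γ k ≤ G)
    (hdc : 20 * G * d ≤ c)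
    {Wm Nm : Matrix (n × Fin 2) (n × Fin 2) ℂ} (hWm : Wm = M ⊗ₖ (1 : Op2) + pauliSum R)
    (hNm : Nm = M ⊗ₖ (1 : Op2) + pauliSum fun k => r k • M)
    (DW : SpecDecomp Wm κ) (hW : ∀ i, 0 < DW.val i)
    (DN : SpecDecomp Nm η) (hN : ∀ i, 0 < DN.val i)
    {l : ℝ} (hl : 0 ≤ l) :
    rtr (pauliSum (fun k => Γ k • R k) * (DW.res l - DN.res l))
      + rtr (pauliSum (fun k => R k - r k • M)
        * (DN.res l * pauliSum (fun k => (Γ k * r k) • M) * DN.res l)) ≤ 0 := by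
  set Y := pauliSum (fun k => R k - r k • M) with hY
  set V := pauliSum (fun k => (Γ k * r k) • M) with hV
  set Z := pauliSum (fun k => Γ k • (R k - r k • M)) with hZ
  set K := pauliSum (fun k => Γ k • R k) with hK
  have hG0 : 0 ≤ G := hΓ0.le.trans ((hΓ 0).trans (hΓ' 0))
  have hMpsd : M.PosSemidef := by
    rw [← DM.comb_val]; exact DM.comb_psd fun i => (hM i).le
  have hMh := hMpsd.isHermitian
  have hRh : ∀ k, (R k).IsHermitian := fun k => by
    have h := (h₂ k).isHermitian.sub (hMh.smul (k := d) (star_trivial d))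
    rwa [add_sub_cancel_left] at h
  have hWY : Wm = Nm + Y := by
    rw [hWm, hNm, hY, add_assoc, ← pauliSum_add]
    congr 3
    ext1 k
    abel
  have hKVZ : K = V + Z := by
    rw [hK, hV, hZ, ← pauliSum_add]
    congr 1
    ext1 k
    rw [smul_sub, mul_smul]
    abel
  have hresN : (Nm + l • 1) * DN.res l = 1 :=
    DN.mul_res fun i => (add_pos_of_pos_of_nonneg (hN i) hl).ne'
  have hresW : (Nm + Y + l • 1) * DW.res l = 1 := by
    rw [← hWY]
    exact DW.mul_res fun i => (add_pos_of_pos_of_nonneg (hW i) hl).ne'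
  -- preconditioning with the inverse square root of `M + l`
  have hMl : ∀ i, 0 < DM.val i + l := fun i => add_pos_of_pos_of_nonneg (hM i) hl
  set T := DM.invSqrt l ⊗ₖ (1 : Op2) with hT
  have hTh : T.conjTranspose = T := by
    rw [hT, Matrix.conjTranspose_kronecker, DM.invSqrt_herm, Matrix.conjTranspose_one]
  have hTHT : T * (M ⊗ₖ (1 : Op2) + l • 1) * T = 1 := DM.invSqrt_conj hMl
  have hherm : ∀ {X : Matrix (n × Fin 2) (n × Fin 2) ℂ}, X.IsHermitian → (T * X * T).IsHermitian :=
    fun {X} hX => by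
      rw [Matrix.IsHermitian, Matrix.conjTranspose_mul, Matrix.conjTranspose_mul, hTh, hX.eq,
        mul_assoc]
  have hbd : ∀ {S : Fin 3 → Matrix n n ℂ} {a : ℝ}, 0 ≤ a → (∀ k, (a • M - S k).PosSemidef) →
      (∀ k, (a • M + S k).PosSemidef) → ∀ D : SpecDecomp (T * pauliSum S * T) (n × Fin 2),
      ∀ i, |D.val i| ≤ 3 * a := by
    intro S a ha h h' D i
    have hp := DM.precond_bound hl hMl (by positivity) (pauliSum_le h h')
    have hm := DM.precond_bound hl hMl (e := 3 * a) (X := -pauliSum S) (by positivity)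
      (by rw [sub_neg_eq_add]; exact neg_le_pauliSum h h')
    rw [mul_neg, neg_mul, sub_neg_eq_add] at hm
    exact abs_le.2 ⟨D.le_val hm i, D.val_le hp i⟩
  have hsm : ∀ {a b : ℝ}, |a| ≤ b → (b • M - a • M).PosSemidef ∧ (b • M + a • M).PosSemidef := by
    intro a b hab
    rw [← sub_smul, ← add_smul]
    exact ⟨PosSemidef.rsmul hMpsd (by linarith [(abs_le.1 hab).2]),
      PosSemidef.rsmul hMpsd (by linarith [(abs_le.1 hab).1])⟩
  have hrM : ∀ k, (r k • M).IsHermitian := fun k => hMh.smul (star_trivial _)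
  let D₁ := SpecDecomp.ofIsHermitian (hherm (pauliSum_herm hrM))
  let D₂ := SpecDecomp.ofIsHermitian (hherm (pauliSum_herm hRh))
  let D₃ := SpecDecomp.ofIsHermitian
    (hherm (pauliSum_herm fun k => (hRh k).smul (k := Γ k) (star_trivial _)))
  have b₁ : ∀ i, |D₁.val i| ≤ 3 * d := hbd hd (fun k => (hsm (hr k)).1) (fun k => (hsm (hr k)).2) D₁
  have b₂ : ∀ i, |D₂.val i| ≤ 3 * d := hbd hd h₁ h₂ D₂
  have b₃ : ∀ i, |D₃.val i| ≤ 3 * (G * d) := by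
    have hΓ0' : ∀ k, 0 ≤ Γ k := fun k => hΓ0.le.trans (hΓ k)
    refine hbd (by positivity) (fun k => ?_) (fun k => ?_) D₃
    · have e : (G * d) • M - Γ k • R k = Γ k • (d • M - R k) + ((G - Γ k) * d) • M := by
        module
      rw [e]
      exact (PosSemidef.rsmul (h₁ k) (hΓ0' k)).add
        (PosSemidef.rsmul hMpsd (mul_nonneg (by linarith [hΓ' k]) hd))
    · have e : (G * d) • M + Γ k • R k = Γ k • (d • M + R k) + ((G - Γ k) * d) • M := by
        module
      rw [e]
      exact (PosSemidef.rsmul (h₂ k) (hΓ0' k)).add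
        (PosSemidef.rsmul hMpsd (mul_nonneg (by linarith [hΓ' k]) hd))
  have hne : ∀ {x : ℝ}, |x| ≤ 3 * d → 1 + x ≠ 0 := fun {x} hx => by
    have := (abs_le.1 hx).1
    intro h0
    linarith
  have hRN : DN.res l = T * (D₁.comb fun i => (1 + D₁.val i)⁻¹) * T := by
    refine inverse_eq_precond D₁ (fun i => hne (b₁ i)) hTHT ?_ hresN
    congr 2
    rw [hNm]; abel
  have hRW : DW.res l = T * (D₂.comb fun i => (1 + D₂.val i)⁻¹) * T := by
    refine inverse_eq_precond D₂ (fun i => hne (b₂ i)) hTHT ?_ hresW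
    congr 2
    rw [← hWY, hWm]; abel
  set Ni := D₁.comb fun i => (1 + D₁.val i)⁻¹ with hNi
  set Wi := D₂.comb fun i => (1 + D₂.val i)⁻¹ with hWi
  -- the quadratic forms in the preconditioned matrices
  set h := DM.invSqrt l with hh
  set Q : Fin 3 → Matrix n n ℂ := fun k => h * (R k - r k • M) * h with hQ
  have hQh : ∀ k, (Q k).conjTranspose = Q k := fun k => by
    have h3 : (R k - r k • M).conjTranspose = R k - r k • M := ((hRh k).sub (hrM k)).eq
    simp only [hQ, Matrix.conjTranspose_mul, h3, hh, DM.invSqrt_herm, mul_assoc]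
  have hYQ : T * Y * T = pauliSum Q := pauliSum_conj _ _
  have hZQ : T * Z * T = pauliSum fun k => Γ k • Q k := by
    rw [hZ, hT, pauliSum_conj]
    congr 1
    ext1 k
    rw [mul_smul_comm, smul_mul_assoc]
  have hQpos : ∀ k, 0 ≤ rtr (Q k * Q k) := fun k => by
    have := rtr_conjTranspose_mul_self_nonneg (Q k)
    rwa [hQh] at this
  have hYsq : frob (T * Y * T) ^ 2 = 2 * ∑ k, rtr (Q k * Q k) := by
    rw [frob_sq, hYQ, (pauliSum_herm hQh).eq, rtr_pauliSum_mul]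
  have hZY : c * frob (T * Y * T) ^ 2 ≤ rtr (T * Z * T * (T * Y * T)) := by
    rw [hYsq, hZQ, hYQ, rtr_pauliSum_mul, mul_left_comm, Finset.mul_sum]
    refine mul_le_mul_of_nonneg_left (Finset.sum_le_sum fun k _ => ?_) zero_le_two
    rw [smul_mul_assoc, map_smul, smul_eq_mul]
    exact mul_le_mul_of_nonneg_right (hΓ k) (hQpos k)
  have hZZ : frob (T * Z * T) ≤ G * frob (T * Y * T) := by
    refine Real.sqrt_le_iff.2 ⟨mul_nonneg hG0 (frob_nonneg _), ?_⟩
    rw [mul_pow, hYsq, hZQ, (pauliSum_herm fun k => ?_).eq, rtr_pauliSum_mul, mul_left_comm,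
      Finset.mul_sum _ _ (G ^ 2)]
    · refine mul_le_mul_of_nonneg_left (Finset.sum_le_sum fun k _ => ?_) zero_le_two
      rw [smul_mul_smul_comm, map_smul, smul_eq_mul, sq]
      exact mul_le_mul_of_nonneg_right (mul_self_le_mul_self (hΓ0.le.trans (hΓ k)) (hΓ' k))
        (hQpos k)
    · rw [Matrix.IsHermitian, Matrix.conjTranspose_smul, hQh, star_trivial]
  have hmain := rtr_perturbation_le D₁ D₂ D₃ (Y := T * Y * T) (Z := T * Z * T)
    (e := 3 * d) (k := 3 * (G * d)) (G := G) (c := c) (by positivity) (by linarith) (by positivity)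
    hG0 b₁ b₂ b₃ hZY hZZ (by
      have h19 : 19 / 20 ≤ 1 - 3 * d := by linarith
      have hpos : 0 < 1 - 3 * d := by linarith
      have i1 : 1 / (1 - 3 * d) ≤ 20 / 19 := by
        rw [div_le_div_iff₀ hpos (by norm_num)]; linarith
      have i1' : 0 ≤ 1 / (1 - 3 * d) := by positivity
      have i2 : 3 * d / (1 - 3 * d) ≤ 60 / 19 * d := by
        rw [div_le_iff₀ hpos]; nlinarith
      have i2' : 0 ≤ 3 * d / (1 - 3 * d) := by positivity
      have i3 : (1 / (1 - 3 * d)) ^ 3 ≤ 2 :=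
        (pow_le_pow_left₀ i1' i1 3).trans (by norm_num)
      have i4 : (3 * d / (1 - 3 * d)) ^ 2 ≤ d := by
        have := pow_le_pow_left₀ i2' i2 2
        nlinarith
      have i5 : (2 * (3 * d / (1 - 3 * d)) + (3 * d / (1 - 3 * d)) ^ 2) * G ≤ 8 * d * G :=
        mul_le_mul_of_nonneg_right (by linarith) hG0
      have i6 : 3 * (G * d) * (1 / (1 - 3 * d)) ^ 3 ≤ 3 * (G * d) * 2 :=
        mul_le_mul_of_nonneg_left i3 (by positivity)
      have i7 : 0 ≤ G * d := by positivity
      linarith)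
  -- assembling the resolvent expansion
  have hcyc : rtr (V * (DN.res l * Y * DN.res l)) = rtr (Y * (DN.res l * V * DN.res l)) := by
    calc _ = rtr ((V * DN.res l) * (Y * DN.res l)) := by simp only [mul_assoc]
      _ = rtr ((Y * DN.res l) * (V * DN.res l)) := rtr_mul_comm _ _
      _ = _ := by simp only [mul_assoc]
  have hZt : rtr (Z * (DN.res l * Y * DN.res l))
      = rtr (T * Z * T * Ni * (T * Y * T) * Ni) := by
    rw [hRN]
    calc _ = rtr ((Z * T * Ni * T * Y * T * Ni) * T) := by simp only [mul_assoc]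
      _ = rtr (T * (Z * T * Ni * T * Y * T * Ni)) := rtr_mul_comm _ _
      _ = _ := by simp only [mul_assoc]
  have hKt : rtr (K * (DN.res l * Y * DW.res l * Y * DN.res l))
      = rtr (T * K * T * Ni * (T * Y * T) * Wi * (T * Y * T) * Ni) := by
    rw [hRN, hRW]
    calc _ = rtr ((K * T * Ni * T * Y * T * Wi * T * Y * T * Ni) * T) := by simp only [mul_assoc]
      _ = rtr (T * (K * T * Ni * T * Y * T * Wi * T * Y * T * Ni)) := rtr_mul_comm _ _
      _ = _ := by simp only [mul_assoc]
  rw [resolvent_expansion hresN hresW, mul_add, map_add, hKt, mul_neg, map_neg]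
  nth_rewrite 1 [hKVZ]
  rw [add_mul, map_add, hcyc, hZt]
  linarith

end Pointwise

/-! ### Integration over the resolvent parameter -/

section LogDiv

/-- The divided difference of the logarithm. -/
noncomputable def logDiv (x y : ℝ) : ℝ :=
  if x = y then x⁻¹ else (Real.log x - Real.log y) / (x - y)

theorem hasDerivAt_logDiv_add {x y l : ℝ} (hx : 0 < x + l) (hy : 0 < y + l) :
    HasDerivAt (fun l => logDiv (x + l) (y + l)) (-((x + l)⁻¹ * (y + l)⁻¹)) l := by
  have hx' : HasDerivAt (fun l => x + l) 1 l := (hasDerivAt_id l).const_add x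
  have hy' : HasDerivAt (fun l => y + l) 1 l := (hasDerivAt_id l).const_add y
  by_cases h : x = y
  · subst h
    simp only [logDiv, if_true]
    refine (hx'.inv hx.ne').congr_deriv ?_
    field_simp
  · have h0 : x - y ≠ 0 := sub_ne_zero.2 h
    simp only [logDiv, add_left_inj, h, if_false, add_sub_add_right_eq_sub]
    refine (((hx'.log hx.ne').sub (hy'.log hy.ne')).div_const (x - y)).congr_deriv ?_
    field_simp
    ring

/-- Homogeneity: the eigenvalues of `M` drop out of the divided differences of
`log (M ⊗ w)` in the direction `M ⊗ v`. -/
theorem logDiv_mul {m x y : ℝ} (hm : 0 < m) (hx : 0 < x) (hy : 0 < y) :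
    m * logDiv (m * x) (m * y) = logDiv x y := by
  by_cases h : x = y
  · subst h
    simp only [logDiv, if_true]
    field_simp
  · have h' : m * x ≠ m * y := fun e => h (mul_left_cancel₀ hm.ne' e)
    have h0 : x - y ≠ 0 := sub_ne_zero.2 h
    simp only [logDiv, h, h', if_false]
    rw [Real.log_mul hm.ne' hx.ne', Real.log_mul hm.ne' hy.ne', ← mul_sub]
    field_simp
    ring

theorem tendsto_log_add_sub_log (x : ℝ) :
    Filter.Tendsto (fun l => Real.log (x + l) - Real.log l) Filter.atTop (𝓝 0) := by
  have h4 : Filter.Tendsto (fun l : ℝ => x / l + 1) Filter.atTop (𝓝 (0 + 1)) :=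
    (Filter.Tendsto.div_atTop tendsto_const_nhds Filter.tendsto_id).add_const _
  rw [zero_add] at h4
  have h5 := h4.log one_ne_zero
  rw [Real.log_one] at h5
  refine h5.congr' ?_
  filter_upwards [Filter.eventually_gt_atTop 0, Filter.eventually_gt_atTop (-x)] with l hl hl'
  have e : x / l + 1 = (x + l) / l := by field_simp
  rw [e, Real.log_div (by linarith) hl.ne']

theorem tendsto_logDiv_add (x y : ℝ) :
    Filter.Tendsto (fun l => logDiv (x + l) (y + l)) Filter.atTop (𝓝 0) := by
  by_cases h : x = y
  · subst h
    simp only [logDiv, if_true]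
    exact tendsto_inv_atTop_zero.comp (Filter.tendsto_atTop_add_const_left _ _ Filter.tendsto_id)
  · simp only [logDiv, add_left_inj, h, if_false, add_sub_add_right_eq_sub]
    have h1 := ((tendsto_log_add_sub_log x).sub (tendsto_log_add_sub_log y)).div_const (x - y)
    simpa using h1

/-- The divergent `log l` cancels against coefficients that sum to zero. -/
theorem tendsto_sum_log_add {ι : Type*} [Fintype ι] (x c : ι → ℝ) (hc : ∑ i, c i = 0) :
    Filter.Tendsto (fun l => ∑ i, Real.log (x i + l) * c i) Filter.atTop (𝓝 0) := by
  have h : Filter.Tendsto (fun l => ∑ i, (Real.log (x i + l) - Real.log l) * c i) Filter.atTop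
      (𝓝 (∑ i, 0 * c i)) :=
    tendsto_finsetSum _ fun i _ => (tendsto_log_add_sub_log (x i)).mul_const _
  simp only [zero_mul, Finset.sum_const_zero] at h
  refine h.congr fun l => ?_
  simp only [sub_mul, Finset.sum_sub_distrib]
  rw [← Finset.mul_sum, hc, mul_zero, sub_zero]

end LogDiv

section LogIntegral

variable {n m : Type*} [Fintype n] [DecidableEq n] [Fintype m] [DecidableEq m]
  {ι κ η : Type*} [Fintype ι] [Fintype κ] [Fintype η]

theorem kron_res_mul_mul_res {M : Matrix n n ℂ} {w : Matrix m m ℂ} (DM : SpecDecomp M ι)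
    (Dw : SpecDecomp w κ) (v : Matrix m m ℂ) (l : ℝ) :
    (DM.kron Dw).res l * (M ⊗ₖ v) * (DM.kron Dw).res l
      = ∑ a, ∑ i, ∑ j, (DM.val a * ((DM.val a * Dw.val i + l)⁻¹ * (DM.val a * Dw.val j + l)⁻¹))
        • (DM.proj a ⊗ₖ (Dw.proj i * v * Dw.proj j)) := by
  classical
  have e : (DM.kron Dw).res l
      = ∑ a, ∑ i, (DM.val a * Dw.val i + l)⁻¹ • (DM.proj a ⊗ₖ Dw.proj i) := by
    rw [SpecDecomp.res, SpecDecomp.comb, Fintype.sum_prod_type]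
    rfl
  rw [e]
  simp only [Finset.sum_mul]
  refine Finset.sum_congr rfl fun a _ => Finset.sum_congr rfl fun i _ => ?_
  rw [Finset.mul_sum, Finset.sum_eq_single a]
  · rw [Finset.mul_sum]
    refine Finset.sum_congr rfl fun j _ => ?_
    rw [smul_mul_assoc, smul_mul_smul_comm, ← Matrix.mul_kronecker_mul, ← Matrix.mul_kronecker_mul,
      DM.proj_mul, smul_mul_assoc, DM.proj_idem, Matrix.smul_kronecker, smul_smul]
    congr 1
    ring
  · intro b _ hb
    rw [Finset.mul_sum]
    refine Finset.sum_eq_zero fun j _ => ?_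
    rw [smul_mul_assoc, smul_mul_smul_comm, ← Matrix.mul_kronecker_mul, ← Matrix.mul_kronecker_mul,
      DM.proj_mul, smul_mul_assoc, DM.proj_orth _ _ hb.symm, smul_zero, Matrix.zero_kronecker,
      smul_zero]
  · simp

theorem hasDerivAt_rtr_mul_log {A : Matrix n n ℂ} (D : SpecDecomp A ι) (hD : ∀ j, 0 < D.val j)
    (K : Matrix n n ℂ) {l : ℝ} (hl : 0 ≤ l) :
    HasDerivAt (fun l => ∑ j, Real.log (D.val j + l) * rtr (K * D.proj j))
      (rtr (K * D.res l)) l := by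
  rw [SpecDecomp.res, D.rtr_mul_comb]
  refine HasDerivAt.fun_sum fun j _ => HasDerivAt.mul_const ?_ _
  have h1 : HasDerivAt (fun l => D.val j + l) 1 l := (hasDerivAt_id l).const_add _
  have h2 := h1.log (add_pos_of_pos_of_nonneg (hD j) hl).ne'
  rwa [one_div] at h2

theorem sum_rtr_mul_proj {A K : Matrix n n ℂ} (D : SpecDecomp A ι) (hK : rtr K = 0) :
    ∑ j, rtr (K * D.proj j) = 0 := by
  rw [← map_sum, ← Finset.mul_sum, D.sum_proj, mul_one, hK]

/-- Integration of the resolvent estimate over `l`: it yields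
`tr K (log W - log (M ⊗ w)) ≥ 0`. The first-order term integrates to the derivative of
`log (M ⊗ w) = log M ⊗ 1 + 1 ⊗ log w` in the direction `M ⊗ v`, which has the form `1 ⊗ X` and is
therefore not seen by an operator `Y` with vanishing marginal. -/
theorem sum_log_le_of_resolvent {M : Matrix n n ℂ} {w : Matrix m m ℂ}
    {W K Y : Matrix (n × m) (n × m) ℂ} {v : Matrix m m ℂ} (DM : SpecDecomp M ι)
    (Dw : SpecDecomp w κ) (DW : SpecDecomp W η) (hM : ∀ a, 0 < DM.val a) (hw : ∀ i, 0 < Dw.val i)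
    (hW : ∀ j, 0 < DW.val j) (hK : marginalA K = 0) (hY : marginalS Y = 0)
    (h : ∀ l, 0 ≤ l → rtr (K * (DW.res l - (DM.kron Dw).res l))
      + rtr (Y * ((DM.kron Dw).res l * (M ⊗ₖ v) * (DM.kron Dw).res l)) ≤ 0) :
    ∑ i, Real.log (Dw.val i) * rtr (marginalS K * Dw.proj i)
      ≤ ∑ j, Real.log (DW.val j) * rtr (K * DW.proj j) := by
  set DN := DM.kron Dw with hDN
  have hN : ∀ p, 0 < DN.val p := fun p => mul_pos (hM _) (hw _)
  have hK0 : rtr K = 0 := by rw [rtr_apply, ← trace_marginalA, hK]; simp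
  let y : ι → κ → κ → ℝ := fun a i j => rtr (Y * (DM.proj a ⊗ₖ (Dw.proj i * v * Dw.proj j)))
  let corr : ℝ → ℝ := fun l => ∑ a, ∑ i, ∑ j,
    DM.val a * logDiv (DM.val a * Dw.val i + l) (DM.val a * Dw.val j + l) * y a i j
  let ψ : ℝ → ℝ := fun l => (∑ j, Real.log (DW.val j + l) * rtr (K * DW.proj j))
    - (∑ p, Real.log (DN.val p + l) * rtr (K * DN.proj p)) - corr l
  have hder : ∀ l, 0 ≤ l → HasDerivAt ψ (rtr (K * (DW.res l - DN.res l))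
      + rtr (Y * (DN.res l * (M ⊗ₖ v) * DN.res l))) l := by
    intro l hl
    have d2 : HasDerivAt corr (-rtr (Y * (DN.res l * (M ⊗ₖ v) * DN.res l))) l := by
      rw [kron_res_mul_mul_res]
      simp only [Finset.mul_sum, map_sum, mul_smul_comm, map_smul, smul_eq_mul,
        ← Finset.sum_neg_distrib]
      refine HasDerivAt.fun_sum fun a _ => HasDerivAt.fun_sum fun i _ =>
        HasDerivAt.fun_sum fun j _ => ?_
      have h1 := hasDerivAt_logDiv_add (add_pos_of_pos_of_nonneg (mul_pos (hM a) (hw i)) hl)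
        (add_pos_of_pos_of_nonneg (mul_pos (hM a) (hw j)) hl)
      refine ((h1.const_mul (DM.val a)).mul_const (y a i j)).congr_deriv ?_
      simp only [y]
      ring
    refine (((hasDerivAt_rtr_mul_log DW hW K hl).sub
      (hasDerivAt_rtr_mul_log DN hN K hl)).sub d2).congr_deriv ?_
    rw [mul_sub, map_sub]
    ring
  have hanti : AntitoneOn ψ (Set.Ici 0) := by
    refine antitoneOn_of_deriv_nonpos (convex_Ici 0)
      (fun l hl => (hder l hl).continuousAt.continuousWithinAt)
      (fun l hl => (hder l (interior_subset hl)).differentiableAt.differentiableWithinAt)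
      fun l hl => ?_
    rw [(hder l (interior_subset hl)).deriv]
    exact h l (interior_subset hl)
  have hlim : Filter.Tendsto ψ Filter.atTop (𝓝 0) := by
    have c1 : Filter.Tendsto corr Filter.atTop
        (𝓝 (∑ a, ∑ i, ∑ j, DM.val a * 0 * y a i j)) :=
      tendsto_finsetSum _ fun a _ => tendsto_finsetSum _ fun i _ => tendsto_finsetSum _ fun j _ =>
        ((tendsto_logDiv_add _ _).const_mul _).mul_const _
    have c2 := ((tendsto_sum_log_add DW.val _ (sum_rtr_mul_proj DW hK0)).sub
      (tendsto_sum_log_add DN.val _ (sum_rtr_mul_proj DN hK0))).sub c1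
    simpa using c2
  have h0 : 0 ≤ ψ 0 := by
    refine le_of_tendsto hlim ?_
    filter_upwards [Filter.eventually_ge_atTop 0] with l hl
    exact hanti (Set.mem_Ici.2 le_rfl) (Set.mem_Ici.2 hl) hl
  have hc0 : corr 0 = 0 := by
    have e : ∀ a i j, DM.val a * logDiv (DM.val a * Dw.val i + 0) (DM.val a * Dw.val j + 0)
        * y a i j = logDiv (Dw.val i) (Dw.val j) * y a i j := fun a i j => by
      rw [add_zero, add_zero, logDiv_mul (hM a) (hw i) (hw j)]
    simp only [corr, e]
    rw [Finset.sum_comm]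
    refine Finset.sum_eq_zero fun i _ => ?_
    rw [Finset.sum_comm]
    refine Finset.sum_eq_zero fun j _ => ?_
    rw [← Finset.mul_sum, ← map_sum, ← Finset.mul_sum]
    have e2 : ∑ a, DM.proj a ⊗ₖ (Dw.proj i * v * Dw.proj j)
        = (1 : Matrix n n ℂ) ⊗ₖ (Dw.proj i * v * Dw.proj j) := by
      rw [← DM.sum_proj]
      ext x z
      simp [Matrix.sum_apply, Finset.sum_mul]
    rw [e2, rtr_apply, trace_mul_one_kronecker, hY]
    simp
  have hN0 : ∑ p, Real.log (DN.val p + 0) * rtr (K * DN.proj p)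
      = ∑ i, Real.log (Dw.val i) * rtr (marginalS K * Dw.proj i) := by
    rw [Fintype.sum_prod_type]
    have e : ∀ a i, Real.log (DN.val (a, i) + 0) * rtr (K * DN.proj (a, i))
        = Real.log (DM.val a) * rtr (K * (DM.proj a ⊗ₖ Dw.proj i))
          + Real.log (Dw.val i) * rtr (K * (DM.proj a ⊗ₖ Dw.proj i)) := fun a i => by
      change Real.log (DM.val a * Dw.val i + 0) * rtr (K * (DM.proj a ⊗ₖ Dw.proj i)) = _
      rw [add_zero, Real.log_mul (hM a).ne' (hw i).ne', add_mul]
    simp_rw [e, Finset.sum_add_distrib]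
    have e1 : ∑ a, ∑ i, Real.log (DM.val a) * rtr (K * (DM.proj a ⊗ₖ Dw.proj i)) = 0 := by
      refine Finset.sum_eq_zero fun a _ => ?_
      rw [← Finset.mul_sum, ← map_sum, ← Finset.mul_sum]
      have e2 : ∑ i, DM.proj a ⊗ₖ Dw.proj i = DM.proj a ⊗ₖ (1 : Matrix m m ℂ) := by
        rw [← Dw.sum_proj]
        ext x z
        simp [Matrix.sum_apply, Finset.mul_sum]
      rw [e2, rtr_apply, trace_mul_kronecker_one, hK]
      simp
    rw [e1, zero_add, Finset.sum_comm]
    refine Finset.sum_congr rfl fun i _ => ?_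
    rw [← Finset.mul_sum, ← map_sum, ← Finset.mul_sum]
    have e2 : ∑ a, DM.proj a ⊗ₖ Dw.proj i = (1 : Matrix n n ℂ) ⊗ₖ Dw.proj i := by
      rw [← DM.sum_proj]
      ext x z
      simp [Matrix.sum_apply, Finset.sum_mul]
    rw [e2, rtr_apply, trace_mul_one_kronecker, ← rtr_apply]
  simp only [ψ] at h0
  rw [hc0, hN0] at h0
  simp only [add_zero, sub_zero] at h0
  linarith

end LogIntegral

/-! ### Pauli diagonal maps -/

section PauliMaps

theorem pauliMap_fin_two (c : Fin 3 → ℝ) (x y z w : ℂ) :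
    pauliMap c !![x, y; z, w]
      = (1 / 2 : ℂ) • !![x + w + c 2 * (x - w), c 0 * (y + z) + c 1 * (y - z);
        c 0 * (y + z) - c 1 * (y - z), x + w - c 2 * (x - w)] := by
  have hI : Complex.I ^ 2 = -1 := Complex.I_sq
  ext i j
  fin_cases i <;> fin_cases j <;>
    simp [pauliMap, pauli, Fin.sum_univ_three, Matrix.trace_fin_two]
  · ring
  · linear_combination (-(c 1 : ℂ) * (y - z)) * hI
  · linear_combination ((c 1 : ℂ) * (y - z)) * hI
  · ring

theorem pauliMap_one_eq_id : pauliMap (fun _ => 1) = LinearMap.id := by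
  refine LinearMap.ext fun X => ?_
  rw [Matrix.eta_fin_two X, pauliMap_fin_two]
  ext i j
  fin_cases i <;> fin_cases j <;> simp <;> ring

theorem pauliMap_comp (c c' : Fin 3 → ℝ) :
    pauliMap c ∘ₗ pauliMap c' = pauliMap fun k => c k * c' k := by
  refine LinearMap.ext fun X => ?_
  rw [Matrix.eta_fin_two X, LinearMap.comp_apply, pauliMap_fin_two, map_smul, pauliMap_fin_two,
    pauliMap_fin_two]
  ext i j
  fin_cases i <;> fin_cases j <;> simp <;> ring

theorem isTP_pauliMap (c : Fin 3 → ℝ) : IsTP (pauliMap c) := by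
  intro X
  rw [Matrix.eta_fin_two X, pauliMap_fin_two]
  simp [Matrix.trace_fin_two]
  ring

/-- The unitaries `1, σ_x, σ_y, σ_z`. -/
noncomputable def pauliU : Fin 4 → Op2 := ![1, pauli 0, pauli 1, pauli 2]

/-- The weights of the Pauli channel `pauliMap c` as a mixture of `pauliU`-conjugations; they are
the eigenvalues of its Choi matrix up to normalization. -/
noncomputable def pauliWeight (c : Fin 3 → ℝ) : Fin 4 → ℝ :=
  ![(1 + c 0 + c 1 + c 2) / 4, (1 + c 0 - c 1 - c 2) / 4, (1 - c 0 + c 1 - c 2) / 4,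
    (1 - c 0 - c 1 + c 2) / 4]

theorem pauliU_unitary (k : Fin 4) : (pauliU k).conjTranspose * pauliU k = 1 := by
  fin_cases k <;> simp [pauliU, pauli_conjTranspose, pauli_mul_self]

theorem sum_pauliWeight (c : Fin 3 → ℝ) : ∑ k, pauliWeight c k = 1 := by
  simp [Fin.sum_univ_four, pauliWeight]; ring

theorem pauliMap_eq_mix (c : Fin 3 → ℝ) (X : Op2) :
    pauliMap c X = ∑ k, pauliWeight c k • (pauliU k * X * (pauliU k).conjTranspose) := by
  have hI : Complex.I ^ 2 = -1 := Complex.I_sq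
  rw [Matrix.eta_fin_two X, pauliMap_fin_two]
  simp only [Fin.sum_univ_four, pauliWeight, pauliU, Matrix.cons_val_zero, Matrix.cons_val_one,
    Matrix.cons_val, pauli_conjTranspose, Matrix.conjTranspose_one, one_mul, mul_one]
  simp only [pauli, Matrix.cons_val_zero, Matrix.cons_val_one, Matrix.cons_val, Matrix.mul_fin_two]
  ext i j
  fin_cases i <;> fin_cases j <;> simp <;> ring_nf <;> simp only [hI] <;> ring

theorem one_kronecker_conj_apply {n : Type*} [Fintype n] [DecidableEq n] (u : Op2)
    (ρ : Matrix (n × Fin 2) (n × Fin 2) ℂ) (x y : n × Fin 2) :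
    ((1 : Matrix n n ℂ) ⊗ₖ u * ρ * ((1 : Matrix n n ℂ) ⊗ₖ u).conjTranspose) x y
      = (u * (Matrix.of fun i j => ρ (x.1, i) (y.1, j)) * u.conjTranspose) x.2 y.2 := by
  obtain ⟨a, i⟩ := x
  obtain ⟨b, j⟩ := y
  simp only [Matrix.mul_apply, Fintype.sum_prod_type, Matrix.kroneckerMap_apply,
    Matrix.conjTranspose_apply, Matrix.of_apply, star_mul']
  rw [Finset.sum_eq_single b]
  · refine Finset.sum_congr rfl fun k _ => ?_
    rw [Finset.sum_eq_single a]
    · simp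
    · intro a' _ ha'
      simp [Matrix.one_apply_ne ha'.symm]
    · simp
  · intro b' _ hb'
    simp [Matrix.one_apply_ne hb'.symm]
  · simp

theorem ampl_pauliMap_eq_localMix {n : Type*} [Fintype n] [DecidableEq n] (c : Fin 3 → ℝ)
    (ρ : Matrix (n × Fin 2) (n × Fin 2) ℂ) :
    ampl (pauliMap c) ρ = localMix (pauliWeight c) pauliU ρ := by
  ext x y
  change pauliMap c (Matrix.of fun i j => ρ (x.1, i) (y.1, j)) x.2 y.2 = _
  rw [pauliMap_eq_mix, localMix, Matrix.sum_apply, Matrix.sum_apply]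
  refine Finset.sum_congr rfl fun k _ => ?_
  rw [Matrix.smul_apply, Matrix.smul_apply, one_kronecker_conj_apply]

theorem isCP_pauliMap {c : Fin 3 → ℝ} (hc : ∀ k, 0 ≤ pauliWeight c k) : IsCP (pauliMap c) := by
  intro n X hX
  rw [ampl_pauliMap_eq_localMix]
  exact localMix_posSemidef hc hX

theorem isCPTP_pauliMap {c : Fin 3 → ℝ} (hc : ∀ k, 0 ≤ pauliWeight c k) : IsCPTP (pauliMap c) :=
  ⟨isCP_pauliMap hc, isTP_pauliMap c⟩

theorem mutualInfo_ampl_pauliMap_le {c : Fin 3 → ℝ} (hc : ∀ k, 0 ≤ pauliWeight c k) {ρ : OpAS}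
    (hρ : IsState ρ) : mutualInfo (ampl (pauliMap c) ρ) ≤ mutualInfo ρ := by
  rw [ampl_pauliMap_eq_localMix]
  exact mutualInfo_localMix_le hc (sum_pauliWeight c) pauliU_unitary hρ.1

theorem isState_ampl_pauliMap {c : Fin 3 → ℝ} (hc : ∀ k, 0 ≤ pauliWeight c k) {ρ : OpAS}
    (hρ : IsState ρ) : IsState (ampl (pauliMap c) ρ) := by
  rw [ampl_pauliMap_eq_localMix]
  refine ⟨localMix_posSemidef hc hρ.1, ?_⟩
  rw [← trace_marginalA, marginalA_localMix (sum_pauliWeight c) pauliU_unitary, trace_marginalA,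
    hρ.2]

theorem pauliWeight_nonneg_of_abs_le {c : Fin 3 → ℝ} (hc : ∀ k, |c k| ≤ 1 / 3) (k : Fin 4) :
    0 ≤ pauliWeight c k := by
  have h0 := abs_le.1 (hc 0)
  have h1 := abs_le.1 (hc 1)
  have h2 := abs_le.1 (hc 2)
  fin_cases k <;> simp [pauliWeight] <;> linarith [h0.1, h0.2, h1.1, h1.2, h2.1, h2.2]

/-- Nonnegative integrated rates `a` give a mixture of unitary conjugations. -/
theorem pauliWeight_nonneg_of_rates {a : Fin 3 → ℝ} (ha : ∀ k, 0 ≤ a k) (k : Fin 4) :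
    0 ≤ pauliWeight (fun k => Real.exp (-(a (k + 1) + a (k + 2)))) k := by
  have hx : ∀ i, 0 < Real.exp (-a i) ∧ Real.exp (-a i) ≤ 1 := fun i =>
    ⟨Real.exp_pos _, Real.exp_le_one_iff.2 (neg_nonpos.2 (ha i))⟩
  obtain ⟨p0, q0⟩ := hx 0
  obtain ⟨p1, q1⟩ := hx 1
  obtain ⟨p2, q2⟩ := hx 2
  have f0 : (1 + 1 : Fin 3) = 2 := rfl
  have f1 : (1 + 2 : Fin 3) = 0 := rfl
  have f2 : (2 + 1 : Fin 3) = 0 := rfl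
  have f3 : (2 + 2 : Fin 3) = 1 := rfl
  have m01 := mul_nonneg (sub_nonneg.2 q0) (sub_nonneg.2 q1)
  have m02 := mul_nonneg (sub_nonneg.2 q0) (sub_nonneg.2 q2)
  have m12 := mul_nonneg (sub_nonneg.2 q1) (sub_nonneg.2 q2)
  have r01 := mul_pos p0 p1
  have r02 := mul_pos p0 p2
  have r12 := mul_pos p1 p2
  have s0 := mul_le_of_le_one_left p1.le q0
  have t0 := mul_le_of_le_one_left p2.le q0
  have u0 := mul_le_of_le_one_left p2.le q1
  have s1 := mul_le_of_le_one_right p0.le q1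
  have t1 := mul_le_of_le_one_right p0.le q2
  have u1 := mul_le_of_le_one_right p1.le q2
  fin_cases k <;> simp [pauliWeight, Real.exp_add, f0, f1, f2, f3] <;> nlinarith

/-- A Hermitian `2 × 2` matrix is positive semidefinite if its trace and determinant are
nonnegative. -/
theorem posSemidef_of_trace_det {A : Op2} (hA : A.IsHermitian) (ht : 0 ≤ A.trace.re)
    (hd : 0 ≤ A.det.re) : A.PosSemidef := by
  rw [hA.posSemidef_iff_eigenvalues_nonneg]
  have h1 := hA.trace_eq_sum_eigenvalues
  have h2 := hA.det_eq_prod_eigenvalues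
  rw [Fin.sum_univ_two] at h1
  rw [Fin.prod_univ_two] at h2
  have h1' : A.trace.re = hA.eigenvalues 0 + hA.eigenvalues 1 := by rw [h1]; simp
  have h2' : A.det.re = hA.eigenvalues 0 * hA.eigenvalues 1 := by rw [h2]; simp
  rw [h1'] at ht
  rw [h2'] at hd
  intro i
  fin_cases i
  · change 0 ≤ hA.eigenvalues 0
    by_contra h
    push Not at h
    nlinarith
  · change 0 ≤ hA.eigenvalues 1
    by_contra h
    push Not at h
    nlinarith

/-- A Pauli map that contracts the Bloch ball along the axes is positive. -/
theorem isPositive_pauliMap {c : Fin 3 → ℝ} (hc : ∀ k, |c k| ≤ 1) : IsPositive (pauliMap c) := by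
  intro X hX
  have hXh := hX.isHermitian
  have hsq : ∀ k, c k ^ 2 ≤ 1 := fun k => (sq_le_one_iff_abs_le_one _).2 (hc k)
  refine posSemidef_of_trace_det ?_ ?_ ?_
  · rw [pauliMap_eq_mix, Matrix.IsHermitian, Matrix.conjTranspose_sum]
    refine Finset.sum_congr rfl fun k _ => ?_
    rw [Matrix.conjTranspose_smul, star_trivial, Matrix.conjTranspose_mul,
      Matrix.conjTranspose_mul, hXh.eq, Matrix.conjTranspose_conjTranspose, mul_assoc]
  · rw [isTP_pauliMap]
    exact (Complex.le_def.1 hX.trace_nonneg).1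
  · have hdet := (Complex.le_def.1 hX.det_nonneg).1
    have h10 : X 1 0 = star (X 0 1) := (hXh.apply 1 0).symm
    have h00 : (X 0 0).im = 0 := by
      have := congrArg Complex.im (hXh.apply 0 0)
      simp at this
      linarith
    have h11 : (X 1 1).im = 0 := by
      have := congrArg Complex.im (hXh.apply 1 1)
      simp at this
      linarith
    rw [Matrix.det_fin_two, h10] at hdet
    rw [Matrix.eta_fin_two X, pauliMap_fin_two, Matrix.det_fin_two, h10]
    simp [h00, h11] at hdet ⊢
    nlinarith [hsq 0, hsq 1, hsq 2,
      mul_le_mul_of_nonneg_right (hsq 0) (sq_nonneg (X 0 1).re),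
      mul_le_mul_of_nonneg_right (hsq 1) (sq_nonneg (X 0 1).im),
      mul_le_mul_of_nonneg_right (hsq 2) (sq_nonneg ((X 0 0).re - (X 1 1).re))]

/-- Complete positivity, tested on a maximally entangled state. -/
theorem le_of_isCP_pauliMap {c : Fin 3 → ℝ} (h : IsCP (pauliMap c)) : 0 ≤ 1 + c 2 - c 0 - c 1 := by
  let ω : Fin 2 × Fin 2 → ℂ := fun x => if x.1 = x.2 then 1 else 0
  let φ : Fin 2 × Fin 2 → ℂ := fun x => if x.1 = x.2 then (if x.1 = 0 then 1 else -1) else 0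
  have h1 := (h 2 _ (Matrix.posSemidef_vecMulVec_self_star ω)).dotProduct_mulVec_nonneg φ
  have hblock : ∀ a b : Fin 2, (Matrix.of fun i j => Matrix.vecMulVec ω (star ω) (a, i) (b, j))
      = Matrix.single a b (1 : ℂ) := by
    intro a b
    ext i j
    fin_cases a <;> fin_cases b <;> fin_cases i <;> fin_cases j <;>
      simp [ω, Matrix.vecMulVec_apply]
  have h2 : star φ ⬝ᵥ (Matrix.mulVec (ampl (pauliMap c) (Matrix.vecMulVec ω (star ω))) φ)
      = ((1 + c 2 - c 0 - c 1 : ℝ) : ℂ) := by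
    simp only [Matrix.mulVec, dotProduct, Fintype.sum_prod_type, ampl, Matrix.of_apply, hblock]
    simp only [Fin.sum_univ_two]
    have e : ∀ a b : Fin 2, Matrix.single a b (1 : ℂ) = !![Matrix.single a b (1 : ℂ) 0 0,
      Matrix.single a b (1 : ℂ) 0 1; Matrix.single a b (1 : ℂ) 1 0,
      Matrix.single a b (1 : ℂ) 1 1] := fun a b => Matrix.eta_fin_two _
    rw [e 0 0, e 0 1, e 1 0, e 1 1]
    simp only [pauliMap_fin_two]
    simp [φ]
    ring
  rw [h2] at h1
  exact_mod_cast h1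

end PauliMaps

/-! ### Bloch form of two-qubit operators and states near the stationary ones -/

section Bloch

/-- The operators `R_k = tr_S (ρ (1 ⊗ σ_k))` on the ancilla. Together with `ρ_A` they determine
`ρ`, see `eq_bloch`. -/
noncomputable def corrOp (ρ : OpAS) (k : Fin 3) : Op2 := marginalA (ρ * ((1 : Op2) ⊗ₖ pauli k))

theorem corrOp_apply (ρ : OpAS) (k : Fin 3) (a b : Fin 2) :
    corrOp ρ k a b = (pauli k * Matrix.of fun i j => ρ (a, i) (b, j)).trace := by
  have h : ∀ i, (ρ * ((1 : Op2) ⊗ₖ pauli k)) (a, i) (b, i) = ∑ j, ρ (a, i) (b, j) * pauli k j i := by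
    intro i
    simp only [Matrix.mul_apply, Fintype.sum_prod_type, Matrix.kroneckerMap_apply]
    rw [Finset.sum_eq_single b]
    · simp
    · intro c _ hc
      simp [Matrix.one_apply_ne hc]
    · simp
  simp only [corrOp, marginalA, Matrix.of_apply, h]
  rw [Matrix.trace_mul_comm]
  simp [Matrix.trace, Matrix.mul_apply]

theorem ampl_pauliMap_eq (c : Fin 3 → ℝ) (ρ : OpAS) :
    ampl (pauliMap c) ρ = (1 / 2 : ℝ) • (marginalA ρ ⊗ₖ (1 : Op2)
      + pauliSum fun k => c k • corrOp ρ k) := by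
  ext ⟨a, i⟩ ⟨b, j⟩
  change pauliMap c (Matrix.of fun i j => ρ (a, i) (b, j)) i j = _
  have ht : (Matrix.of fun i j => ρ (a, i) (b, j) : Op2).trace = marginalA ρ a b := by
    simp [Matrix.trace, marginalA]
  simp only [pauliMap, LinearMap.coe_mk, AddHom.coe_mk, ht, ← corrOp_apply, pauliSum,
    Matrix.smul_apply, Matrix.add_apply, Matrix.sum_apply, Matrix.kroneckerMap_apply, smul_eq_mul,
    Complex.real_smul]
  push_cast
  rfl

/-- The Bloch form of an operator with respect to the system. -/
theorem eq_bloch (ρ : OpAS) :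
    ρ = (1 / 2 : ℝ) • (marginalA ρ ⊗ₖ (1 : Op2) + pauliSum (corrOp ρ)) := by
  have h := ampl_pauliMap_eq (fun _ => 1) ρ
  simp only [one_smul] at h
  rw [pauliMap_one_eq_id] at h
  rw [← h]
  rfl

theorem marginalA_bloch (M : Op2) (R : Fin 3 → Op2) :
    marginalA ((1 / 2 : ℝ) • (M ⊗ₖ (1 : Op2) + pauliSum R)) = M := by
  rw [marginalA_rsmul, marginalA_add, marginalA_pauliSum, marginalA_kronecker, Matrix.trace_one]
  ext i j
  simp

theorem marginalS_bloch {M : Op2} (hM : M.trace = 1) (R : Fin 3 → Op2) :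
    marginalS ((1 / 2 : ℝ) • (M ⊗ₖ (1 : Op2) + pauliSum R))
      = (1 / 2 : ℝ) • (1 + ∑ k, (R k).trace • pauli k) := by
  rw [marginalS_rsmul, marginalS_add, marginalS_pauliSum, marginalS_kronecker, hM, one_smul]

theorem corrOp_bloch (M : Op2) (R : Fin 3 → Op2) (k : Fin 3) :
    corrOp ((1 / 2 : ℝ) • (M ⊗ₖ (1 : Op2) + pauliSum R)) k = R k := by
  rw [corrOp, smul_mul_assoc, add_mul, marginalA_rsmul, marginalA_add, ← Matrix.mul_kronecker_mul,
    mul_one, one_mul, marginalA_kronecker, trace_pauli, zero_smul, zero_add, pauliSum,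
    Finset.sum_mul, marginalA_sum, Finset.sum_eq_single k]
  · rw [← Matrix.mul_kronecker_mul, mul_one, marginalA_kronecker, trace_pauli_mul, if_pos rfl]
    ext i j
    simp
  · intro l _ hl
    rw [← Matrix.mul_kronecker_mul, mul_one, marginalA_kronecker, trace_pauli_mul, if_neg hl,
      zero_smul]
  · simp

theorem marginalA_ampl_pauliMap (c : Fin 3 → ℝ) (ρ : OpAS) :
    marginalA (ampl (pauliMap c) ρ) = marginalA ρ := by
  rw [ampl_pauliMap_eq, marginalA_bloch]

theorem corrOp_ampl_pauliMap (c : Fin 3 → ℝ) (ρ : OpAS) (k : Fin 3) :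
    corrOp (ampl (pauliMap c) ρ) k = c k • corrOp ρ k := by
  rw [ampl_pauliMap_eq, corrOp_bloch]

theorem marginalA_mul_one_kronecker_sq (ρ : OpAS) (s : Op2) :
    marginalA (ρ * ((1 : Op2) ⊗ₖ (s * s)))
      = marginalA (((1 : Op2) ⊗ₖ s) * ρ * ((1 : Op2) ⊗ₖ s)) := by
  refine Matrix.ext_iff_trace_mul_right.2 fun A => ?_
  rw [← trace_mul_kronecker_one, ← trace_mul_kronecker_one, mul_assoc, mul_assoc, mul_assoc,
    Matrix.trace_mul_comm _ (_ * (_ * _)), mul_assoc, mul_assoc, ← Matrix.mul_kronecker_mul,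
    ← Matrix.mul_kronecker_mul, ← Matrix.mul_kronecker_mul]
  simp

theorem marginalA_add_corrOp_posSemidef {ρ : OpAS} (hρ : ρ.PosSemidef) (k : Fin 3) :
    (marginalA ρ + corrOp ρ k).PosSemidef := by
  have h := marginalA_posSemidef
    (hρ.conjTranspose_mul_mul_same ((1 : Op2) ⊗ₖ (1 + pauli k)))
  rw [Matrix.conjTranspose_kronecker, Matrix.conjTranspose_one, Matrix.conjTranspose_add,
    pauli_conjTranspose, Matrix.conjTranspose_one, ← marginalA_mul_one_kronecker_sq] at h
  have e : (1 + pauli k) * (1 + pauli k) = (2 : ℝ) • (1 + pauli k) := by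
    rw [two_smul]
    simp only [add_mul, mul_add, pauli_mul_self, one_mul, mul_one]
    abel
  rw [e, Matrix.kronecker_smul, Matrix.kronecker_add, Matrix.one_kronecker_one, mul_smul_comm,
    mul_add, mul_one, marginalA_rsmul, marginalA_add] at h
  have := PosSemidef.rsmul h (c := 1 / 2) (by norm_num)
  rwa [smul_smul, one_div, inv_mul_cancel₀ two_ne_zero, one_smul] at this

theorem marginalA_sub_corrOp_posSemidef {ρ : OpAS} (hρ : ρ.PosSemidef) (k : Fin 3) :
    (marginalA ρ - corrOp ρ k).PosSemidef := by
  have h := marginalA_posSemidef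
    (hρ.conjTranspose_mul_mul_same ((1 : Op2) ⊗ₖ (1 - pauli k)))
  rw [Matrix.conjTranspose_kronecker, Matrix.conjTranspose_one, Matrix.conjTranspose_sub,
    pauli_conjTranspose, Matrix.conjTranspose_one, ← marginalA_mul_one_kronecker_sq] at h
  have e : (1 - pauli k) * (1 - pauli k) = (2 : ℝ) • (1 + (-1 : ℝ) • pauli k) := by
    rw [two_smul]
    simp only [sub_mul, mul_sub, pauli_mul_self, one_mul, mul_one, neg_smul, one_smul]
    abel
  rw [e, Matrix.kronecker_smul, Matrix.kronecker_add, Matrix.one_kronecker_one, mul_smul_comm,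
    mul_add, mul_one, marginalA_rsmul, marginalA_add, Matrix.kronecker_smul, mul_smul_comm,
    marginalA_rsmul, neg_smul, one_smul, ← sub_eq_add_neg] at h
  have := PosSemidef.rsmul h (c := 1 / 2) (by norm_num)
  rwa [smul_smul, one_div, inv_mul_cancel₀ two_ne_zero, one_smul] at this

theorem isState_marginalA {ρ : OpAS} (hρ : IsState ρ) : IsState (marginalA ρ) :=
  ⟨marginalA_posSemidef hρ.1, by rw [trace_marginalA, hρ.2]⟩

/-- `d M ± R` are positive semidefinite. -/
def RelBound (d : ℝ) (M R : Op2) : Prop := (d • M - R).PosSemidef ∧ (d • M + R).PosSemidef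

theorem RelBound.smul {d a e : ℝ} {M R : Op2} (hM : M.PosSemidef) (h : RelBound d M R)
    (ha : |a| * d ≤ e) : RelBound e M (a • R) := by
  have hrest : ((e - |a| * d) • M).PosSemidef := PosSemidef.rsmul hM (by linarith)
  rcases abs_cases a with ⟨h1, h2⟩ | ⟨h1, h2⟩
  · constructor
    · have e1 : e • M - a • R = a • (d • M - R) + (e - |a| * d) • M := by rw [h1]; module
      rw [e1]
      exact (PosSemidef.rsmul h.1 h2).add hrest
    · have e1 : e • M + a • R = a • (d • M + R) + (e - |a| * d) • M := by rw [h1]; module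
      rw [e1]
      exact (PosSemidef.rsmul h.2 h2).add hrest
  · constructor
    · have e1 : e • M - a • R = (-a) • (d • M + R) + (e - |a| * d) • M := by rw [h1]; module
      rw [e1]
      exact (PosSemidef.rsmul h.2 (by linarith)).add hrest
    · have e1 : e • M + a • R = (-a) • (d • M - R) + (e - |a| * d) • M := by rw [h1]; module
      rw [e1]
      exact (PosSemidef.rsmul h.1 (by linarith)).add hrest

theorem RelBound.isHermitian {d : ℝ} {M R : Op2} (hM : M.IsHermitian) (h : RelBound d M R) :
    R.IsHermitian := by
  have h := h.2.isHermitian.sub (hM.smul (k := d) (star_trivial d))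
  rwa [add_sub_cancel_left] at h

theorem RelBound.trace_eq {d : ℝ} {M R : Op2} (hM : M.IsHermitian) (h : RelBound d M R) :
    R.trace = (rtr R : ℂ) := by
  refine Complex.ext rfl ?_
  have h1 : star R.trace = R.trace := by
    rw [← Matrix.trace_conjTranspose, (h.isHermitian hM).eq]
  have h2 := congrArg Complex.im h1
  simp only [Complex.star_def, Complex.conj_im] at h2
  rw [Complex.ofReal_im]
  linarith

theorem RelBound.abs_rtr_le {d : ℝ} {M R : Op2} (h : RelBound d M R) :
    |rtr R| ≤ d * rtr M := by
  have h1 := rtr_nonneg h.1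
  have h2 := rtr_nonneg h.2
  rw [map_sub, map_smul, smul_eq_mul] at h1
  rw [map_add, map_smul, smul_eq_mul] at h2
  exact abs_le.2 ⟨by linarith, by linarith⟩

theorem relBound_corrOp {ρ : OpAS} (hρ : ρ.PosSemidef) (k : Fin 3) :
    RelBound 1 (marginalA ρ) (corrOp ρ k) := by
  constructor
  · rw [one_smul]; exact marginalA_sub_corrOp_posSemidef hρ k
  · rw [one_smul]; exact marginalA_add_corrOp_posSemidef hρ k

/-- The states whose correlation operators satisfy `-d ρ_A ≤ R_k ≤ d ρ_A`. For `d = 0` these are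
the stationary states. -/
def nearStationary (d : ℝ) : Set OpAS :=
  {ρ | IsState ρ ∧ ∀ k, RelBound d (marginalA ρ) (corrOp ρ k)}

theorem nearStationary_mono {d e : ℝ} (h : d ≤ e) : nearStationary d ⊆ nearStationary e := by
  rintro ρ ⟨hρ, hR⟩
  refine ⟨hρ, fun k => ?_⟩
  have := (hR k).smul (marginalA_posSemidef hρ.1) (a := 1) (e := e) (by simpa using h)
  rwa [one_smul] at this

/-- Since `-ρ_A ≤ R_k ≤ ρ_A` for every state, damping all Pauli components by factors at most `d`
leads into `nearStationary d`. -/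
theorem ampl_mem_nearStationary {d : ℝ} (hd : d ≤ 1 / 3) {c : Fin 3 → ℝ} (hc : ∀ k, |c k| ≤ d)
    {ρ : OpAS} (hρ : IsState ρ) : ampl (pauliMap c) ρ ∈ nearStationary d := by
  refine ⟨isState_ampl_pauliMap (pauliWeight_nonneg_of_abs_le fun k => (hc k).trans hd) hρ,
    fun k => ?_⟩
  rw [marginalA_ampl_pauliMap, corrOp_ampl_pauliMap]
  exact (relBound_corrOp hρ.1 k).smul (marginalA_posSemidef hρ.1) (by simpa using hc k)

/-- An operator bounded by a rank-one state is a multiple of it. -/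
theorem RelBound.eq_smul_of_not_posDef {d : ℝ} {M R : Op2} (hM : IsState M) (hM' : ¬ M.PosDef)
    (h : RelBound d M R) : R = rtr R • M := by
  have hMh := hM.1.isHermitian
  have hRh := h.isHermitian hMh
  let D := SpecDecomp.ofIsHermitian hMh
  have htr : D.val 0 + D.val 1 = 1 := by
    have h1 := D.rtr_comb D.val
    rw [D.comb_val, Fin.sum_univ_two, rtr_apply, hM.2] at h1
    simpa using h1.symm
  have hval : ∃ i j, D.val i = 0 ∧ D.proj i + D.proj j = 1 ∧ M = D.proj j := by
    rw [hMh.posDef_iff_eigenvalues_pos] at hM'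
    push Not at hM'
    obtain ⟨i, hi⟩ := hM'
    have hi0 : D.val i = 0 := le_antisymm hi (D.val_nonneg hM.1 i)
    have hs := D.sum_proj
    have hv := D.sum_val
    rw [Fin.sum_univ_two] at hs hv
    fin_cases i
    · have hj : D.val 1 = 1 := by
        change D.val 0 = 0 at hi0
        linarith
      refine ⟨0, 1, hi0, hs, ?_⟩
      change D.val 0 = 0 at hi0
      rw [hi0, hj, zero_smul, zero_add, one_smul] at hv
      exact hv.symm
    · have hj : D.val 0 = 1 := by
        change D.val 1 = 0 at hi0
        linarith
      refine ⟨1, 0, hi0, by rw [add_comm]; exact hs, ?_⟩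
      change D.val 1 = 0 at hi0
      rw [hi0, hj, zero_smul, add_zero, one_smul] at hv
      exact hv.symm
  obtain ⟨i, j, hi, hs, hMj⟩ := hval
  have hMi : M * D.proj i = 0 := by rw [D.mul_proj, hi, zero_smul]
  -- the positive operator `d M + R` vanishes on the kernel of `M`
  have hker : (d • M + R) * D.proj i = 0 := by
    have h0 : rtr (D.proj i * R) = 0 := by
      have h1 := D.rtr_proj_mul_nonneg i h.1
      have h2 := D.rtr_proj_mul_nonneg i h.2
      rw [rtr_mul_comm, sub_mul, smul_mul_assoc, hMi, smul_zero, zero_sub, map_neg,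
        rtr_mul_comm] at h1
      rw [rtr_mul_comm, add_mul, smul_mul_assoc, hMi, smul_zero, zero_add, rtr_mul_comm] at h2
      linarith
    obtain ⟨B, hB⟩ : ∃ B : Op2, d • M + R = B.conjTranspose * B := by
      let E := SpecDecomp.ofIsHermitian h.2.isHermitian
      refine ⟨E.comb fun i => √(E.val i), ?_⟩
      rw [E.comb_herm, E.comb_mul]
      simp only [Real.mul_self_sqrt (E.val_nonneg h.2 _)]
      exact E.comb_val.symm
    have h3 : rtr ((B * D.proj i).conjTranspose * (B * D.proj i)) = 0 := by
      rw [Matrix.conjTranspose_mul, D.proj_herm, mul_assoc, ← mul_assoc B.conjTranspose, ← hB,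
        ← mul_assoc, rtr_mul_comm, ← mul_assoc, D.proj_idem, mul_add, mul_smul_comm, D.proj_mul, hi,
        zero_smul, smul_zero, zero_add, h0]
    have h4 : B * D.proj i = 0 := by
      have hp := Matrix.posSemidef_conjTranspose_mul_self (B * D.proj i)
      refine Matrix.trace_conjTranspose_mul_self_eq_zero_iff.1 ?_
      exact Complex.ext h3 (Complex.le_def.1 hp.trace_nonneg).2.symm
    rw [hB, mul_assoc, h4, mul_zero]
  have hRi : R * D.proj i = 0 := by
    rw [add_mul, smul_mul_assoc, hMi, smul_zero, zero_add] at hker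
    exact hker
  have hRi' : D.proj i * R = 0 := by
    have := congrArg Matrix.conjTranspose hRi
    rwa [Matrix.conjTranspose_mul, D.proj_herm, hRh.eq, Matrix.conjTranspose_zero] at this
  have hPRP : R = M * R * M := by
    rw [hMj]
    have e : D.proj j = 1 - D.proj i := eq_sub_of_add_eq' hs
    rw [e]
    simp only [sub_mul, mul_sub, one_mul, mul_one, hRi, hRi', sub_zero]
  have hdet : M 0 0 * M 1 1 = M 0 1 * M 1 0 := by
    have hid := congrFun (congrFun (D.proj_idem j) 0) 0
    have ht := D.trace_proj j
    rw [← hMj] at hid ht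
    rw [Matrix.mul_apply, Fin.sum_univ_two] at hid
    rw [Matrix.trace_fin_two] at ht
    linear_combination (-1) * hid + M 0 0 * ht
  have htr2 : (M * R * M) = (M * R).trace • M := by
    ext a b
    fin_cases a <;> fin_cases b <;>
      simp [Matrix.mul_apply, Fin.sum_univ_two, Matrix.trace_fin_two]
    · linear_combination (-R 1 1) * hdet
    · linear_combination (R 0 1) * hdet
    · linear_combination (R 1 0) * hdet
    · linear_combination (-R 0 0) * hdet
  have hMM : (M * R).trace = R.trace := by
    have : M * R = R := by
      rw [hMj, eq_sub_of_add_eq' hs, sub_mul, one_mul, hRi', sub_zero]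
    rw [this]
  rw [htr2, hMM, h.trace_eq hMh] at hPRP
  rwa [Complex.coe_smul] at hPRP

end Bloch

/-! ### The derivative of the mutual information -/

section MutualInfoDerivative

theorem kronecker_sum_pauli {n : Type*} [Fintype n] (M : Matrix n n ℂ) (r : Fin 3 → ℝ) :
    M ⊗ₖ (∑ k, r k • pauli k) = pauliSum fun k => r k • M := by
  rw [pauliSum]
  ext x y
  simp only [Matrix.kroneckerMap_apply, Matrix.sum_apply, Matrix.smul_apply, Complex.real_smul,
    Finset.mul_sum]
  exact Finset.sum_congr rfl fun k _ => by ring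

/-- At a state with correlation operators `R_k` bounded by `d ρ_A`, the velocity
`-½ ∑ₖ Γₖ Rₖ ⊗ σₖ` increases the entropy of the composite by at least as much as the entropy of
the system; `-∑ log g_i tr (A' q_i)` is the rate of change of an entropy with velocity `A'`. -/
theorem sum_log_marginalS_le {ρ : OpAS} {d c G : ℝ} {Γ : Fin 3 → ℝ} (hρ : ρ ∈ nearStationary d)
    (hd : 0 ≤ d) (hd1 : d ≤ 1 / 60) (hΓ0 : 0 < c) (hΓ : ∀ k, c ≤ Γ k) (hΓ' : ∀ k, Γ k ≤ G)
    (hdc : 20 * G * d ≤ c) (hM : (marginalA ρ).PosDef)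
    {ι κ : Type*} [Fintype ι] [Fintype κ]
    (E : SpecDecomp ρ ι) (F : SpecDecomp (marginalS ρ) κ)
    (hE : ∀ i, 0 < E.val i) (hF : ∀ i, 0 < F.val i) :
    ∑ i, Real.log (F.val i) * rtr (marginalS (pauliSum fun k => Γ k • corrOp ρ k) * F.proj i)
      ≤ ∑ j, Real.log (E.val j) * rtr ((pauliSum fun k => Γ k • corrOp ρ k) * E.proj j) := by
  obtain ⟨hst, hR⟩ := hρ
  have hMst := isState_marginalA hst
  have hMh := hM.isHermitian
  set M := marginalA ρ with hMdef
  set R := corrOp ρ with hRdef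
  set K := pauliSum fun k => Γ k • R k with hK
  let DM := SpecDecomp.ofIsHermitian hMh
  have hDM : ∀ i, 0 < DM.val i := DM.val_pos hM
  have hMtr : rtr M = 1 := by rw [rtr_apply, hMst.2, Complex.one_re]
  have hr : ∀ k, |rtr (R k)| ≤ d := fun k => by simpa [hMtr] using (hR k).abs_rtr_le
  have hW : (2 : ℝ) • ρ + (0 : ℝ) • (1 : OpAS) = M ⊗ₖ (1 : Op2) + pauliSum R := by
    rw [zero_smul, add_zero]
    conv_lhs => rw [eq_bloch ρ]
    rw [smul_smul]
    norm_num
    rfl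
  have hw : (2 : ℝ) • marginalS ρ + (0 : ℝ) • (1 : Op2) = 1 + ∑ k, rtr (R k) • pauli k := by
    rw [zero_smul, add_zero]
    conv_lhs => rw [eq_bloch ρ, marginalS_bloch hMst.2]
    rw [smul_smul]
    have : ∀ k, (corrOp ρ k).trace • pauli k = rtr (R k) • pauli k := fun k => by
      rw [(hR k).trace_eq hMh, Complex.coe_smul]
    simp only [this]
    norm_num
  have hN : M ⊗ₖ ((2 : ℝ) • marginalS ρ + (0 : ℝ) • (1 : Op2))
      = M ⊗ₖ (1 : Op2) + pauliSum fun k => rtr (R k) • M := by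
    rw [hw, Matrix.kronecker_add, kronecker_sum_pauli]
  have hWpos : ∀ i, 0 < (E.affine 2 0).val i := fun i => by
    change 0 < 2 * E.val i + 0
    linarith [hE i]
  have hwpos : ∀ i, 0 < (F.affine 2 0).val i := fun i => by
    change 0 < 2 * F.val i + 0
    linarith [hF i]
  have hKA : marginalA K = 0 := marginalA_pauliSum _
  have hK0 : rtr K = 0 := by
    rw [rtr_apply, ← trace_marginalA, hKA]
    simp
  have hKS0 : rtr (marginalS K) = 0 := by
    rw [rtr_apply, trace_marginalS, ← rtr_apply, hK0]
  have key := sum_log_le_of_resolvent DM (F.affine 2 0) (E.affine 2 0) (K := K)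
    (Y := pauliSum fun k => R k - rtr (R k) • M) (v := ∑ k, (Γ k * rtr (R k)) • pauli k)
    hDM hwpos hWpos hKA
    (by
      rw [marginalS_pauliSum]
      refine Finset.sum_eq_zero fun k _ => ?_
      rw [Matrix.trace_sub, Matrix.trace_smul, hMst.2, (hR k).trace_eq hMh, Complex.real_smul,
        mul_one, sub_self, zero_smul])
    (fun l hl => by
      rw [kronecker_sum_pauli]
      exact resolvent_trace_le DM hDM hd hd1 (fun k => (hR k).1) (fun k => (hR k).2) hr hΓ0 hΓ hΓ'
        hdc hW hN (E.affine 2 0) hWpos (DM.kron (F.affine 2 0))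
        (fun p => mul_pos (hDM p.1) (hwpos p.2)) hl)
  -- the factor `2` contributes `log 2` times a vanishing trace
  have eF : ∑ i, Real.log ((F.affine 2 0).val i) * rtr (marginalS K * (F.affine 2 0).proj i)
      = ∑ i, Real.log (F.val i) * rtr (marginalS K * F.proj i) := by
    have : ∀ i, Real.log ((F.affine 2 0).val i) * rtr (marginalS K * (F.affine 2 0).proj i)
        = Real.log 2 * rtr (marginalS K * F.proj i)
          + Real.log (F.val i) * rtr (marginalS K * F.proj i) := fun i => by
      change Real.log (2 * F.val i + 0) * rtr (marginalS K * F.proj i) = _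
      rw [add_zero, Real.log_mul two_ne_zero (hF i).ne', add_mul]
    simp only [this, Finset.sum_add_distrib]
    rw [← Finset.mul_sum, sum_rtr_mul_proj F hKS0, mul_zero, zero_add]
  have eE : ∑ i, Real.log ((E.affine 2 0).val i) * rtr (K * (E.affine 2 0).proj i)
      = ∑ i, Real.log (E.val i) * rtr (K * E.proj i) := by
    have : ∀ i, Real.log ((E.affine 2 0).val i) * rtr (K * (E.affine 2 0).proj i)
        = Real.log 2 * rtr (K * E.proj i) + Real.log (E.val i) * rtr (K * E.proj i) := fun i => by
      change Real.log (2 * E.val i + 0) * rtr (K * E.proj i) = _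
      rw [add_zero, Real.log_mul two_ne_zero (hE i).ne', add_mul]
    simp only [this, Finset.sum_add_distrib]
    rw [← Finset.mul_sum, sum_rtr_mul_proj E hK0, mul_zero, zero_add]
  rwa [eF, eE] at key

theorem posDef_of_mem_nearStationary {ρ : OpAS} {d : ℝ} (hρ : ρ ∈ nearStationary d)
    (hd1 : d ≤ 1 / 60) (hM : (marginalA ρ).PosDef) : ρ.PosDef := by
  have h1 : ((1 - 3 * d) • (marginalA ρ ⊗ₖ (1 : Op2))).PosDef :=
    (hM.kronecker Matrix.PosDef.one).smul (by linarith)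
  have h2 := neg_le_pauliSum (fun k => (hρ.2 k).1) (fun k => (hρ.2 k).2)
  have h3 : ((1 / 2 : ℝ) • (((1 - 3 * d) • (marginalA ρ ⊗ₖ (1 : Op2)))
      + ((3 * d) • (marginalA ρ ⊗ₖ (1 : Op2)) + pauliSum (corrOp ρ)))).PosDef :=
    (h1.add_posSemidef h2).smul (by norm_num)
  rw [eq_bloch ρ]
  convert h3 using 2
  module

/-- Near the stationary states positivity is robust: it survives factors `cₖ` up to `2`;
factors larger than `1` occur when the curve is followed backwards in time. -/
theorem ampl_pauliMap_posSemidef_of_abs_le_two {ρ : OpAS} {d : ℝ} (hρ : ρ ∈ nearStationary d)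
    (hd : 0 ≤ d) (hd1 : d ≤ 1 / 60) {c : Fin 3 → ℝ} (hc : ∀ k, |c k| ≤ 2) :
    (ampl (pauliMap c) ρ).PosSemidef := by
  have hM := marginalA_posSemidef hρ.1.1
  have hR : ∀ k, RelBound (1 / 3) (marginalA ρ) (c k • corrOp ρ k) := fun k =>
    (hρ.2 k).smul hM (by nlinarith [hc k])
  have h2 := neg_le_pauliSum (fun k => (hR k).1) (fun k => (hR k).2)
  rw [ampl_pauliMap_eq]
  refine PosSemidef.rsmul ?_ (by norm_num)
  convert h2 using 2
  norm_num

theorem mutualInfo_kronecker_eq_zero {n m : Type*} [Fintype n] [Fintype m] [DecidableEq n]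
    [DecidableEq m] {A : Matrix n n ℂ} {B : Matrix m m ℂ}
    (hA : A.IsHermitian) (hB : B.IsHermitian) (hA1 : A.trace = 1) (hB1 : B.trace = 1) :
    mutualInfo (A ⊗ₖ B) = 0 := by
  let D := SpecDecomp.ofIsHermitian hA
  let E := SpecDecomp.ofIsHermitian hB
  have hD : ∑ i, D.val i = 1 := by
    rw [← D.rtr_comb, D.comb_val, rtr_apply, hA1, Complex.one_re]
  have hE : ∑ i, E.val i = 1 := by
    rw [← E.rtr_comb, E.comb_val, rtr_apply, hB1, Complex.one_re]
  rw [mutualInfo, marginalA_kronecker, marginalS_kronecker, hA1, hB1, one_smul, one_smul,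
    D.entropy_eq, E.entropy_eq, (D.kron E).entropy_eq, Fintype.sum_prod_type]
  have : ∀ i j, Real.negMulLog ((D.kron E).val (i, j))
      = E.val j * Real.negMulLog (D.val i) + D.val i * Real.negMulLog (E.val j) := fun i j =>
    Real.negMulLog_mul _ _
  simp only [this, Finset.sum_add_distrib, ← Finset.sum_mul, ← Finset.mul_sum, hD, hE]
  ring

/-- Along a Pauli diagonal curve of maps with `cₖ(t) = 1`, `cₖ'(t) = -Γₖ`, the mutual information
of a state close enough to the stationary states has a nonpositive derivative. -/
theorem exists_hasDerivWithinAt_mutualInfo {ρ : OpAS} {d c G : ℝ} {Γ : Fin 3 → ℝ}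
    (hρ : ρ ∈ nearStationary d)
    (hd : 0 ≤ d) (hd1 : d ≤ 1 / 60) (hΓ0 : 0 < c) (hΓ : ∀ k, c ≤ Γ k) (hΓ' : ∀ k, Γ k ≤ G)
    (hdc : 20 * G * d ≤ c) {f : Fin 3 → ℝ → ℝ} {S : Set ℝ} {t : ℝ} (hft : ∀ k, f k t = 1)
    (hf : ∀ k, HasDerivWithinAt (f k) (-Γ k) S t) :
    ∃ D : ℝ, D ≤ 0 ∧
      HasDerivWithinAt (fun s => mutualInfo (ampl (pauliMap fun k => f k s) ρ)) D S t := by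
  have hMst := isState_marginalA hρ.1
  have hMh := hMst.1.isHermitian
  by_cases hM : (marginalA ρ).PosDef
  · have hρpos := posDef_of_mem_nearStationary hρ hd1 hM
    let E := SpecDecomp.ofIsHermitian hρpos.isHermitian
    have hSpos : (marginalS ρ).PosDef := marginalS_posDef hρpos
    let F := SpecDecomp.ofIsHermitian hSpos.isHermitian
    set K := pauliSum fun k => Γ k • corrOp ρ k with hK
    set A' : OpAS := (-(1 / 2) : ℝ) • K with hA'
    have hpsd : ∀ᶠ s in 𝓝[S] t, (ampl (pauliMap fun k => f k s) ρ).PosSemidef := by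
      have hev : ∀ k, ∀ᶠ s in 𝓝[S] t, |f k s| < 2 := fun k =>
        (hf k).continuousWithinAt.abs.eventually_lt_const (by change |f k t| < 2; rw [hft k]; norm_num)
      filter_upwards [Filter.eventually_all.2 hev] with s hs
      exact ampl_pauliMap_posSemidef_of_abs_le_two hρ hd hd1 fun k => (hs k).le
    have hAt : ampl (pauliMap fun k => f k t) ρ = ρ := by
      simp only [hft]
      rw [pauliMap_one_eq_id]
      rfl
    have hA : ∀ x y, HasDerivWithinAt (fun s => ampl (pauliMap fun k => f k s) ρ x y)
        (A' x y) S t := by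
      intro x y
      have e : (fun s => ampl (pauliMap fun k => f k s) ρ x y)
          = fun s => ((1 / 2 : ℝ) : ℂ) * ((marginalA ρ ⊗ₖ (1 : Op2)) x y
            + ∑ k, (f k s : ℂ) * (corrOp ρ k ⊗ₖ pauli k) x y) := by
        funext s
        rw [ampl_pauliMap_eq]
        simp only [pauliSum, Matrix.smul_apply, Matrix.add_apply, Matrix.sum_apply,
          Complex.real_smul, Matrix.smul_kronecker]
      have h := (HasDerivWithinAt.const_add ((marginalA ρ ⊗ₖ (1 : Op2)) x y)
        (HasDerivWithinAt.fun_sum (u := Finset.univ) fun k _ =>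
          ((hf k).ofReal_comp.mul_const ((corrOp ρ k ⊗ₖ pauli k) x y)))).const_mul
            ((1 / 2 : ℝ) : ℂ)
      rw [e]
      refine h.congr_deriv ?_
      simp only [hA', hK, pauliSum, Matrix.smul_apply, Matrix.sum_apply,
        Complex.real_smul, Matrix.smul_kronecker, Finset.mul_sum]
      refine Finset.sum_congr rfl fun k _ => ?_
      push_cast
      ring
    have hAS : ∀ i j, HasDerivWithinAt
        (fun s => marginalS (ampl (pauliMap fun k => f k s) ρ) i j) (marginalS A' i j) S t := by
      intro i j
      simp only [marginalS, Matrix.of_apply]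
      exact HasDerivWithinAt.fun_sum fun a _ => hA (a, i) (a, j)
    have h1 := hasDerivWithinAt_entropy E (E.val_pos hρpos) hAt hA hpsd
    have h2 := hasDerivWithinAt_entropy F (F.val_pos hSpos) (congrArg marginalS hAt) hAS
      (hpsd.mono fun s hs => marginalS_posSemidef hs)
    refine ⟨_, ?_, (h2.const_add (entropy (marginalA ρ))).sub h1 |>.congr_of_eventuallyEq
      (Filter.Eventually.of_forall fun s => ?_) ?_⟩
    · have key := sum_log_marginalS_le hρ hd hd1 hΓ0 hΓ hΓ' hdc hM E F (E.val_pos hρpos)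
        (F.val_pos hSpos)
      have e1 : rtr (marginalS A') = rtr A' := by
        rw [rtr_apply, trace_marginalS, ← rtr_apply]
      have e2 : ∑ j, Real.log (E.val j) * rtr (A' * E.proj j)
          = -(1 / 2) * ∑ j, Real.log (E.val j) * rtr (K * E.proj j) := by
        rw [Finset.mul_sum]
        refine Finset.sum_congr rfl fun j _ => ?_
        rw [hA', smul_mul_assoc, map_smul, smul_eq_mul]
        ring
      have e3 : ∑ j, Real.log (F.val j) * rtr (marginalS A' * F.proj j)
          = -(1 / 2) * ∑ j, Real.log (F.val j) * rtr (marginalS K * F.proj j) := by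
        rw [Finset.mul_sum]
        refine Finset.sum_congr rfl fun j _ => ?_
        rw [hA', marginalS_rsmul, smul_mul_assoc, map_smul, smul_eq_mul]
        ring
      rw [e1, e2, e3]
      linarith
    · simp only [mutualInfo, marginalA_ampl_pauliMap, Pi.sub_apply]
    · simp only [mutualInfo, marginalA_ampl_pauliMap, Pi.sub_apply]
  · -- for a pure ancilla state all states in the neighbourhood are product states
    refine ⟨0, le_rfl, (hasDerivWithinAt_const t S (0 : ℝ)).congr_of_eventuallyEq
      (Filter.Eventually.of_forall fun s => ?_) ?_⟩
    all_goals
      have hzero : ∀ s, mutualInfo (ampl (pauliMap fun k => f k s) ρ) = 0 := by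
        intro s
        have e : ampl (pauliMap fun k => f k s) ρ
            = marginalA ρ ⊗ₖ ((1 / 2 : ℝ) • ((1 : Op2)
              + ∑ k, (f k s * rtr (corrOp ρ k)) • pauli k)) := by
          rw [ampl_pauliMap_eq, Matrix.kronecker_smul, Matrix.kronecker_add, kronecker_sum_pauli]
          congr 3
          funext k
          conv_lhs => rw [(hρ.2 k).eq_smul_of_not_posDef hMst hM]
          rw [smul_smul]
        rw [e]
        refine mutualInfo_kronecker_eq_zero hMh ?_ hMst.2 ?_
        · rw [Matrix.IsHermitian, Matrix.conjTranspose_smul, Matrix.conjTranspose_add,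
            Matrix.conjTranspose_sum]
          simp [Matrix.conjTranspose_smul, pauli_conjTranspose]
        · rw [Matrix.trace_smul, Matrix.trace_add, Matrix.trace_sum]
          simp [Matrix.trace_smul, trace_pauli]
      exact hzero _

end MutualInfoDerivative

/-! ### Neighbourhoods, rates and intermediate maps -/

section Neighbourhood

/-- The damping rate `Γ_k = γ_i + γ_j` of `σ_k`. -/
def rateSum (g : Fin 3 → ℝ) (k : Fin 3) : ℝ := g (k + 1) + g (k + 2)

theorem PairwisePos.rateSum_pos {g : Fin 3 → ℝ} (h : PairwisePos g) (k : Fin 3) :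
    0 < rateSum g k := h _ _ (by fin_cases k <;> decide)

/-- The radius of the neighbourhood on which the mutual information decreases: one twentieth of the
ratio of the smallest damping rate to the sum of all three. -/
noncomputable def radius (g : Fin 3 → ℝ) : ℝ :=
  min (min (rateSum g 0) (rateSum g 1)) (rateSum g 2)
    / (20 * (rateSum g 0 + rateSum g 1 + rateSum g 2))

theorem PairwisePos.radius_pos {g : Fin 3 → ℝ} (h : PairwisePos g) : 0 < radius g := by
  have h0 := h.rateSum_pos 0
  have h1 := h.rateSum_pos 1
  have h2 := h.rateSum_pos 2
  exact div_pos (lt_min (lt_min h0 h1) h2) (by positivity)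

theorem PairwisePos.radius_le {g : Fin 3 → ℝ} (h : PairwisePos g) : radius g ≤ 1 / 60 := by
  have h0 := h.rateSum_pos 0
  have h1 := h.rateSum_pos 1
  have h2 := h.rateSum_pos 2
  rw [radius, div_le_iff₀ (by positivity)]
  have e1 := min_le_left (min (rateSum g 0) (rateSum g 1)) (rateSum g 2)
  have e2 := min_le_right (min (rateSum g 0) (rateSum g 1)) (rateSum g 2)
  have e3 := min_le_left (rateSum g 0) (rateSum g 1)
  have e4 := min_le_right (rateSum g 0) (rateSum g 1)
  linarith

theorem corrOp_continuous (k : Fin 3) : Continuous fun ρ : OpAS => corrOp ρ k := by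
  refine continuous_matrix fun a b => ?_
  simp only [corrOp, marginalA, Matrix.of_apply]
  exact continuous_finsetSum _ fun i _ =>
    (continuous_id.matrix_mul continuous_const).matrix_elem _ _

theorem marginalA_continuous : Continuous fun ρ : OpAS => marginalA ρ := by
  refine continuous_matrix fun a b => ?_
  simp only [marginalA, Matrix.of_apply]
  exact continuous_finsetSum _ fun i _ => continuous_id.matrix_elem _ _

theorem stationary_eq_bloch (ρA : Op2) :
    stationary ρA = (1 / 2 : ℝ) • (ρA ⊗ₖ (1 : Op2) + pauliSum fun _ => 0) := by
  have : pauliSum (fun _ => (0 : Op2)) = 0 := by simp [pauliSum]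
  rw [this, add_zero, stationary, Matrix.kronecker_smul]
  ext x y
  simp

theorem marginalA_stationary (ρA : Op2) : marginalA (stationary ρA) = ρA := by
  rw [stationary_eq_bloch, marginalA_bloch]

theorem corrOp_stationary (ρA : Op2) (k : Fin 3) : corrOp (stationary ρA) k = 0 := by
  rw [stationary_eq_bloch, corrOp_bloch]

theorem nearStationary_mem_nhdsWithin {d : ℝ} (hd : 0 < d) {ρA : Op2} (hpos : ρA.PosDef) :
    nearStationary d ∈ 𝓝[{ρ | IsState ρ}] (stationary ρA) := by
  have hev : ∀ e : ℝ, ∀ k, ∀ᶠ ρ in 𝓝 (stationary ρA),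
      0 < (d • marginalA ρ + e • corrOp ρ k).trace.re
        ∧ 0 < (d • marginalA ρ + e • corrOp ρ k).det.re := by
    intro e k
    have hc : Continuous fun ρ : OpAS => d • marginalA ρ + e • corrOp ρ k :=
      (marginalA_continuous.const_smul d).add ((corrOp_continuous k).const_smul e)
    have h0 : d • marginalA (stationary ρA) + e • corrOp (stationary ρA) k = d • ρA := by
      rw [marginalA_stationary, corrOp_stationary, smul_zero, add_zero]
    have h1 : (d • ρA).PosDef := hpos.smul hd
    refine ((Complex.continuous_re.comp hc.matrix_trace).continuousAt.eventually
      (lt_mem_nhds ?_)).and ((Complex.continuous_re.comp hc.matrix_det).continuousAt.eventually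
      (lt_mem_nhds ?_))
    · simp only [Function.comp_apply, h0]
      exact (Complex.lt_def.1 h1.trace_pos).1
    · simp only [Function.comp_apply, h0]
      exact (Complex.lt_def.1 h1.det_pos).1
  have hall : ∀ᶠ ρ in 𝓝[{ρ | IsState ρ}] (stationary ρA), ∀ k,
      (0 < (d • marginalA ρ + (-1 : ℝ) • corrOp ρ k).trace.re
        ∧ 0 < (d • marginalA ρ + (-1 : ℝ) • corrOp ρ k).det.re)
      ∧ (0 < (d • marginalA ρ + (1 : ℝ) • corrOp ρ k).trace.re
        ∧ 0 < (d • marginalA ρ + (1 : ℝ) • corrOp ρ k).det.re) :=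
    Filter.eventually_all.2 fun k => nhdsWithin_le_nhds ((hev (-1) k).and (hev 1 k))
  filter_upwards [hall, self_mem_nhdsWithin] with ρ hρ hst
  refine ⟨hst, fun k => ?_⟩
  have hMh := (isState_marginalA hst).1.isHermitian
  have hRh := (relBound_corrOp hst.1 k).isHermitian hMh
  have hherm : ∀ e : ℝ, (d • marginalA ρ + e • corrOp ρ k).IsHermitian := fun e =>
    (hMh.smul (k := d) (star_trivial d)).add (hRh.smul (k := e) (star_trivial e))
  constructor
  · have := posSemidef_of_trace_det (hherm (-1)) (hρ k).1.1.le (hρ k).1.2.le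
    rwa [neg_one_smul, ← sub_eq_add_neg] at this
  · have := posSemidef_of_trace_det (hherm 1) (hρ k).2.1.le (hρ k).2.2.le
    rwa [one_smul] at this

/-- Over a pure ancilla state the correlation operators are multiples of `ρ_A`, so that the bound only
concerns their traces. -/
theorem nearStationary_mem_nhdsWithin_fiber {d : ℝ} (hd : 0 < d) {ρA : Op2} (hρA : IsState ρA) :
    nearStationary d ∈ 𝓝[{ρ | IsState ρ ∧ marginalA ρ = ρA}] (stationary ρA) := by
  by_cases hpos : ρA.PosDef
  · exact nhdsWithin_mono _ (fun ρ h => h.1) (nearStationary_mem_nhdsWithin hd hpos)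
  have hev : ∀ k, ∀ᶠ ρ in 𝓝 (stationary ρA), |rtr (corrOp ρ k)| < d := by
    intro k
    have hc : Continuous fun ρ : OpAS => |rtr (corrOp ρ k)| :=
      (Complex.continuous_re.comp (corrOp_continuous k).matrix_trace).abs
    refine hc.continuousAt.eventually (gt_mem_nhds ?_)
    simpa [corrOp_stationary] using hd
  filter_upwards [nhdsWithin_le_nhds (Filter.eventually_all.2 hev), self_mem_nhdsWithin]
    with ρ hρ hst
  obtain ⟨hst, hA⟩ := hst
  refine ⟨hst, fun k => ?_⟩
  have hR := relBound_corrOp hst.1 k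
  rw [hA] at hR ⊢
  have hself : RelBound 1 ρA ρA := by
    constructor
    · rw [one_smul, sub_self]
      exact Matrix.PosSemidef.zero
    · rw [one_smul]
      exact hρA.1.add hρA.1
  rw [hR.eq_smul_of_not_posDef hρA hpos]
  exact hself.smul hρA.1 (by simpa using (hρ k).le)

end Neighbourhood

section Rates

variable {γ : Fin 3 → ℝ → ℝ}

theorem ampl_comp {n : Type*} (Φ Ψ : Op2 →ₗ[ℂ] Op2) (ρ : Matrix (n × Fin 2) (n × Fin 2) ℂ) :
    ampl (Φ ∘ₗ Ψ) ρ = ampl Φ (ampl Ψ ρ) := rfl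

theorem interMap_congr {γ' : Fin 3 → ℝ → ℝ} {s t : ℝ}
    (h : ∀ k, ∀ τ ∈ Set.uIcc t s, γ k τ = γ' k τ) : interMap γ s t = interMap γ' s t := by
  unfold interMap
  congr 1
  funext k
  congr 2
  exact intervalIntegral.integral_congr fun τ hτ => by simp only [h _ τ hτ]

theorem continuous_rateSum (hγ : ∀ k, Continuous (γ k)) (k : Fin 3) :
    Continuous fun τ => rateSum (fun k => γ k τ) k := (hγ _).add (hγ _)

theorem interMap_comp (hγ : ∀ k, Continuous (γ k)) (s t u : ℝ) :
    interMap γ s t ∘ₗ interMap γ t u = interMap γ s u := by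
  rw [interMap, interMap, interMap, pauliMap_comp]
  congr 1
  funext k
  have hi : ∀ a b, IntervalIntegrable (fun τ => γ (k + 1) τ + γ (k + 2) τ) MeasureTheory.volume a b :=
    fun a b => (continuous_rateSum hγ k).intervalIntegrable a b
  rw [← Real.exp_add, ← intervalIntegral.integral_add_adjacent_intervals (hi u t) (hi t s)]
  ring_nf

theorem hasDerivAt_exp_neg_integral (hγ : ∀ k, Continuous (γ k)) (t : ℝ) (k : Fin 3) :
    HasDerivAt (fun s => Real.exp (-∫ τ in t..s, (γ (k + 1) τ + γ (k + 2) τ)))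
      (-rateSum (fun k => γ k t) k) t := by
  have h := (((continuous_rateSum hγ k).integral_hasStrictDerivAt t t).hasDerivAt.neg).exp
  simpa only [rateSum, intervalIntegral.integral_same, neg_zero, Real.exp_zero, one_mul,
    Pi.neg_apply] using h

/-- For states in the neighbourhood attached to the present rates the mutual information has a
nonpositive derivative. -/
theorem exists_hasDerivAt_mutualInfo_interMap (hγ : ∀ k, Continuous (γ k)) {t : ℝ}
    (hpos : PairwisePos fun k => γ k t) {ρ : OpAS}
    (hρ : ρ ∈ nearStationary (radius fun k => γ k t)) :
    ∃ D : ℝ, D ≤ 0 ∧ HasDerivAt (fun s => mutualInfo (ampl (interMap γ s t) ρ)) D t := by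
  set g : Fin 3 → ℝ := fun k => γ k t with hg
  have h0 := hpos.rateSum_pos 0
  have h1 := hpos.rateSum_pos 1
  have h2 := hpos.rateSum_pos 2
  obtain ⟨D, hD, h⟩ := exists_hasDerivWithinAt_mutualInfo (S := Set.univ) (t := t)
    (Γ := rateSum g) (c := min (min (rateSum g 0) (rateSum g 1)) (rateSum g 2))
    (G := rateSum g 0 + rateSum g 1 + rateSum g 2) hρ hpos.radius_pos.le hpos.radius_le
    (lt_min (lt_min h0 h1) h2)
    (fun k => by fin_cases k <;> simp)
    (fun k => by fin_cases k <;> simp <;> linarith)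
    (le_of_eq (by rw [radius]; field_simp))
    (f := fun k s => Real.exp (-∫ τ in t..s, (γ (k + 1) τ + γ (k + 2) τ)))
    (fun k => by simp) (fun k => (hasDerivAt_exp_neg_integral hγ t k).hasDerivWithinAt)
  exact ⟨D, hD, hasDerivWithinAt_univ.1 h⟩

/-- The same for rates on `[0, ∞)`, extended to negative times by their values at `0`. -/
theorem exists_hasDerivWithinAt_mutualInfo_interMap (hγ : ∀ k, ContinuousOn (γ k) (Set.Ici 0))
    {t : ℝ} (ht : 0 ≤ t) (hpos : PairwisePos fun k => γ k t) {ρ : OpAS}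
    (hρ : ρ ∈ nearStationary (radius fun k => γ k t)) :
    ∃ D : ℝ, D ≤ 0 ∧
      HasDerivWithinAt (fun s => mutualInfo (ampl (interMap γ s t) ρ)) D (Set.Ici 0) t := by
  let γ' : Fin 3 → ℝ → ℝ := fun k τ => γ k (max τ 0)
  have hγ' : ∀ k, Continuous (γ' k) := fun k =>
    (hγ k).comp_continuous (continuous_id.max continuous_const) fun τ => le_max_right τ 0
  have e : (fun k => γ' k t) = fun k => γ k t := by simp [γ', ht]
  obtain ⟨D, hD, h⟩ := exists_hasDerivAt_mutualInfo_interMap hγ' (t := t) (ρ := ρ)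
    (by rw [e]; exact hpos) (by rw [e]; exact hρ)
  have hc : ∀ s ∈ Set.Ici (0 : ℝ), interMap γ s t = interMap γ' s t := fun s hs =>
    interMap_congr fun k τ hτ => by
      have : 0 ≤ τ := (le_min ht hs).trans hτ.1
      simp [γ', this]
  exact ⟨D, hD, h.hasDerivWithinAt.congr (fun s hs => by rw [hc s hs]) (by rw [hc t ht])⟩

theorem antitoneOn_mutualInfo_of_mem_nearStationary (hγ : ∀ k, Continuous (γ k)) {a b : ℝ}
    {ρ : OpAS} (hpos : ∀ t ∈ Set.Icc a b, PairwisePos fun k => γ k t)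
    (hρ : ∀ t ∈ Set.Icc a b, ampl (interMap γ t a) ρ ∈ nearStationary (radius fun k => γ k t)) :
    AntitoneOn (fun s => mutualInfo (ampl (interMap γ s a) ρ)) (Set.Icc a b) := by
  have h : ∀ t ∈ Set.Icc a b, ∃ D : ℝ, D ≤ 0 ∧
      HasDerivAt (fun s => mutualInfo (ampl (interMap γ s a) ρ)) D t := by
    intro t ht
    have h1 := exists_hasDerivAt_mutualInfo_interMap hγ (hpos t ht) (hρ t ht)
    simp only [← ampl_comp, interMap_comp hγ] at h1
    exact h1
  refine antitoneOn_of_deriv_nonpos (convex_Icc a b) (fun t ht => ?_) (fun t ht => ?_)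
    (fun t ht => ?_)
  · obtain ⟨D, -, hD⟩ := h t ht
    exact hD.continuousAt.continuousWithinAt
  · obtain ⟨D, -, hD⟩ := h t (interior_subset ht)
    exact hD.differentiableAt.differentiableWithinAt
  · obtain ⟨D, hD0, hD⟩ := h t (interior_subset ht)
    rw [hD.deriv]
    exact hD0

theorem exists_weights_of_nonneg (hγ : ∀ k, Continuous (γ k)) {s t : ℝ} (hts : t ≤ s)
    (hnn : ∀ τ ∈ Set.Icc t s, ∀ k, 0 ≤ γ k τ) :
    ∃ c, interMap γ s t = pauliMap c ∧ ∀ k, 0 ≤ pauliWeight c k := by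
  refine ⟨fun k => Real.exp (-((∫ τ in t..s, γ (k + 1) τ) + ∫ τ in t..s, γ (k + 2) τ)), ?_,
    fun k => pauliWeight_nonneg_of_rates (a := fun k => ∫ τ in t..s, γ k τ)
      (fun k => intervalIntegral.integral_nonneg hts fun τ hτ => hnn τ hτ k) k⟩
  unfold interMap
  congr 1
  funext k
  rw [intervalIntegral.integral_add ((hγ _).intervalIntegrable _ _)
    ((hγ _).intervalIntegrable _ _)]

/-- Nonnegative rates give a CP-divisible dynamics; the mutual information decreases by the data
processing inequality. -/
theorem antitoneOn_mutualInfo_of_nonneg (hγ : ∀ k, Continuous (γ k)) {b : ℝ}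
    (hnn : ∀ τ ∈ Set.Icc 0 b, ∀ k, 0 ≤ γ k τ) {ρ : OpAS} (hρ : IsState ρ) :
    AntitoneOn (fun s => mutualInfo (ampl (dynMap γ s) ρ)) (Set.Icc 0 b) := by
  intro t ht s hs hts
  obtain ⟨c, hc, hc0⟩ := exists_weights_of_nonneg hγ ht.1 (s := t)
    fun τ hτ => hnn τ ⟨hτ.1, hτ.2.trans ht.2⟩
  obtain ⟨c', hc', hc0'⟩ := exists_weights_of_nonneg hγ hts
    fun τ hτ => hnn τ ⟨ht.1.trans hτ.1, hτ.2.trans hs.2⟩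
  simp only [dynMap]
  rw [← interMap_comp hγ s t 0, ampl_comp, hc, hc']
  exact mutualInfo_ampl_pauliMap_le hc0' (isState_ampl_pauliMap hc0 hρ)

theorem isCPTP_dynMap_of_nonneg (hγ : ∀ k, Continuous (γ k)) {t : ℝ} (ht : 0 ≤ t)
    (hnn : ∀ τ ∈ Set.Icc 0 t, ∀ k, 0 ≤ γ k τ) : IsCPTP (dynMap γ t) := by
  obtain ⟨c, hc, hc0⟩ := exists_weights_of_nonneg hγ ht hnn
  rw [dynMap, hc]
  exact isCPTP_pauliMap hc0

theorem isPDivisible_dynMap (hγ : ∀ k, Continuous (γ k))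
    (hpos : ∀ t, 0 ≤ t → PairwisePos fun k => γ k t) : IsPDivisible (dynMap γ) := by
  intro t s ht hts
  refine ⟨interMap γ s t, isTP_pauliMap _, isPositive_pauliMap fun k => ?_,
    (interMap_comp hγ s t 0).symm⟩
  rw [abs_of_pos (Real.exp_pos _), Real.exp_le_one_iff, neg_nonpos]
  exact intervalIntegral.integral_nonneg hts fun τ hτ =>
    ((hpos τ (ht.trans hτ.1)).rateSum_pos k).le

/-- A negative rate violates complete positivity: `1 + c₂ - c₀ - c₁` vanishes at `s = t` and has
derivative `2 γ₂(t)` there. -/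
theorem eventually_not_isCP_interMap (hγ : ∀ k, Continuous (γ k)) {t : ℝ} (hneg : γ 2 t < 0) :
    ∀ᶠ s in 𝓝[>] t, ¬ IsCP (interMap γ s t) := by
  let f : Fin 3 → ℝ → ℝ := fun k s => Real.exp (-∫ τ in t..s, (γ (k + 1) τ + γ (k + 2) τ))
  have hf : ∀ k, HasDerivAt (f k) (-rateSum (fun k => γ k t) k) t :=
    hasDerivAt_exp_neg_integral hγ t
  have hft : ∀ k, f k t = 1 := fun k => by simp [f]
  have h : HasDerivAt (fun s => 1 + f 2 s - f 0 s - f 1 s) (2 * γ 2 t) t := by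
    refine ((((hf 2).const_add 1).sub (hf 0)).sub (hf 1)).congr_deriv ?_
    simp only [rateSum]
    simp only [show (2 : Fin 3) + 1 = 0 from rfl, show (2 : Fin 3) + 2 = 1 from rfl,
      show (0 : Fin 3) + 1 = 1 from rfl, show (0 : Fin 3) + 2 = 2 from rfl,
      show (1 : Fin 3) + 1 = 2 from rfl, show (1 : Fin 3) + 2 = 0 from rfl]
    ring
  have hs := (hasDerivAt_iff_tendsto_slope.1 h).eventually (gt_mem_nhds
    (show 2 * γ 2 t < 0 by linarith))
  have hle : 𝓝[>] t ≤ 𝓝[≠] t := nhdsWithin_mono t fun s hs => ne_of_gt hs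
  filter_upwards [hle hs, self_mem_nhdsWithin] with s hs hts hcp
  have h1 := le_of_isCP_pauliMap hcp
  rw [slope_def_field, div_lt_iff₀ (sub_pos.2 hts), zero_mul] at hs
  simp only [hft] at hs
  have h2 : 0 ≤ 1 + f 2 s - f 0 s - f 1 s := h1
  linarith

theorem not_isCPDivisible_dynMap (hγ : ∀ k, Continuous (γ k)) {t : ℝ} (ht : 0 ≤ t)
    (hneg : γ 2 t < 0) : ¬ IsCPDivisible (dynMap γ) := by
  intro hdiv
  obtain ⟨s, hs, hts⟩ := ((eventually_not_isCP_interMap hγ hneg).and self_mem_nhdsWithin).exists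
  obtain ⟨V, -, hV, hVeq⟩ := hdiv t s ht (le_of_lt hts)
  -- the maps `Λ_t` are invertible, hence `V` is the intermediate map
  have hinv : dynMap γ t ∘ₗ interMap γ 0 t = LinearMap.id := by
    rw [dynMap, interMap_comp hγ, interMap]
    simp only [intervalIntegral.integral_same, neg_zero, Real.exp_zero]
    exact pauliMap_one_eq_id
  have : V = interMap γ s t := by
    rw [← LinearMap.comp_id V, ← hinv, ← LinearMap.comp_assoc, ← hVeq, dynMap, interMap_comp hγ]
  exact hs (this ▸ hV)

/-- The radii along a compact piece of a curve of rates have a positive lower bound. -/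
theorem exists_le_radius (hγ : ∀ k, Continuous (γ k)) {a b : ℝ} (hab : a ≤ b)
    (hpos : ∀ t ∈ Set.Icc a b, PairwisePos fun k => γ k t) :
    ∃ δ : ℝ, 0 < δ ∧ δ ≤ 1 / 60 ∧ ∀ t ∈ Set.Icc a b, δ ≤ radius fun k => γ k t := by
  have hc : ContinuousOn (fun t => radius fun k => γ k t) (Set.Icc a b) := by
    have h := continuous_rateSum hγ
    refine ContinuousOn.div (((h 0).min (h 1)).min (h 2)).continuousOn
      (continuous_const.mul (((h 0).add (h 1)).add (h 2))).continuousOn fun t ht => ?_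
    have h0 := (hpos t ht).rateSum_pos 0
    have h1 := (hpos t ht).rateSum_pos 1
    have h2 := (hpos t ht).rateSum_pos 2
    positivity
  obtain ⟨t, ht, hmin⟩ := isCompact_Icc.exists_isMinOn (Set.nonempty_Icc.2 hab) hc
  exact ⟨_, (hpos t ht).radius_pos, (hpos t ht).radius_le, fun s hs => hmin hs⟩

theorem exp_neg_le_of_inv_le {δ x : ℝ} (hδ : 0 < δ) (hx : δ⁻¹ ≤ x) : Real.exp (-x) ≤ δ := by
  rw [Real.exp_neg]
  exact inv_le_of_inv_le₀ hδ (hx.trans (by linarith [Real.add_one_le_exp x]))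

/-- A damping rate of at least `m` on `[0, a]` brings the factor below `δ` if `m a ≥ 1 / δ`, and it
stays there as long as the damping rate is nonnegative. -/
theorem exp_neg_integral_le (hγ : ∀ k, Continuous (γ k)) {a t m δ : ℝ} {k : Fin 3} (ha : 0 ≤ a)
    (hat : a ≤ t) (h1 : ∀ τ ∈ Set.Icc 0 a, m ≤ rateSum (fun k => γ k τ) k)
    (h2 : ∀ τ ∈ Set.Icc a t, 0 ≤ rateSum (fun k => γ k τ) k) (hδ : 0 < δ) (hm : δ⁻¹ ≤ m * a) :
    |Real.exp (-∫ τ in (0 : ℝ)..t, (γ (k + 1) τ + γ (k + 2) τ))| ≤ δ := by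
  have hi : ∀ a b, IntervalIntegrable (fun τ => γ (k + 1) τ + γ (k + 2) τ) MeasureTheory.volume a b :=
    fun a b => (continuous_rateSum hγ k).intervalIntegrable a b
  rw [abs_of_pos (Real.exp_pos _)]
  refine exp_neg_le_of_inv_le hδ (hm.trans ?_)
  rw [← intervalIntegral.integral_add_adjacent_intervals (hi 0 a) (hi a t)]
  have e1 : m * a ≤ ∫ τ in (0 : ℝ)..a, (γ (k + 1) τ + γ (k + 2) τ) := by
    have := intervalIntegral.integral_mono_on ha intervalIntegrable_const (hi 0 a) h1
    simpa [mul_comm] using this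
  have e2 : 0 ≤ ∫ τ in a..t, (γ (k + 1) τ + γ (k + 2) τ) :=
    intervalIntegral.integral_nonneg hat h2
  linarith

/-- A phase `[0, a]` with nonnegative rates that brings all states close to the stationary ones,
followed by a phase with positive damping rates. -/
theorem antitoneOn_mutualInfo_of_two_phases (hγ : ∀ k, Continuous (γ k)) {a b : ℝ} (ha : 0 ≤ a)
    (hab : a ≤ b) (hnn : ∀ τ ∈ Set.Icc 0 a, ∀ k, 0 ≤ γ k τ)
    (hpos : ∀ t ∈ Set.Icc a b, PairwisePos fun k => γ k t)
    (hmem : ∀ t ∈ Set.Icc a b, ∀ ρ, IsState ρ →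
      ampl (dynMap γ t) ρ ∈ nearStationary (radius fun k => γ k t)) {ρ : OpAS} (hρ : IsState ρ) :
    AntitoneOn (fun t => mutualInfo (ampl (dynMap γ t) ρ)) (Set.Icc 0 b) := by
  have h1 := antitoneOn_mutualInfo_of_nonneg hγ hnn hρ
  have h2 := antitoneOn_mutualInfo_of_mem_nearStationary hγ (ρ := ampl (dynMap γ a) ρ) hpos
    fun t ht => by
      rw [← ampl_comp, dynMap, interMap_comp hγ]
      exact hmem t ht ρ hρ
  simp only [← ampl_comp, dynMap, interMap_comp hγ] at h2
  rw [← Set.Icc_union_Icc_eq_Icc ha hab]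
  exact h1.union_right h2 (isGreatest_Icc ha) (isLeast_Icc hab)

end Rates

/-! ### The quasi-eternal model and the other evolutions -/

section QuasiEternal

variable {α : ℝ}

theorem continuous_quasiEternal (α t₀ : ℝ) (k : Fin 3) : Continuous (quasiEternal α t₀ k) := by
  have h : Continuous fun t : ℝ => -(α / 2) * Real.tanh (t - t₀) := by
    simp only [Real.tanh_eq_sinh_div_cosh]
    exact continuous_const.mul ((Real.continuous_sinh.comp (continuous_id.sub continuous_const)).div
      (Real.continuous_cosh.comp (continuous_id.sub continuous_const))
      fun t => (Real.cosh_pos _).ne')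
  fin_cases k
  · exact continuous_const
  · exact continuous_const
  · exact h

theorem quasiEternal_eq_shift (α t₀ t : ℝ) (k : Fin 3) :
    quasiEternal α t₀ k t = quasiEternal α 0 k (t - t₀) := by
  fin_cases k <;> simp [quasiEternal]

theorem tanh_nonneg_of_nonneg {x : ℝ} (hx : 0 ≤ x) : 0 ≤ Real.tanh x := by
  rw [Real.tanh_eq_sinh_div_cosh]
  exact div_nonneg (Real.sinh_nonneg_iff.2 hx) (Real.cosh_pos x).le

theorem tanh_pos_of_pos {x : ℝ} (hx : 0 < x) : 0 < Real.tanh x := by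
  rw [Real.tanh_eq_sinh_div_cosh]
  exact div_pos (Real.sinh_pos_iff.2 hx) (Real.cosh_pos x)

theorem tanh_nonpos_of_nonpos {x : ℝ} (hx : x ≤ 0) : Real.tanh x ≤ 0 := by
  have := tanh_nonneg_of_nonneg (neg_nonneg.2 hx)
  rw [Real.tanh_neg] at this
  linarith

theorem pairwisePos_quasiEternal (hα : 0 < α) (t₀ t : ℝ) :
    PairwisePos fun k => quasiEternal α t₀ k t := by
  have h1 := Real.tanh_lt_one (t - t₀)
  intro i j hij
  fin_cases i <;> fin_cases j <;> first | exact absurd rfl hij | (simp [quasiEternal]; nlinarith)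

theorem quasiEternal_nonneg (hα : 0 < α) {t₀ t : ℝ} (ht : t ≤ t₀) (k : Fin 3) :
    0 ≤ quasiEternal α t₀ k t := by
  have h1 := tanh_nonpos_of_nonpos (sub_nonpos.2 ht)
  fin_cases k <;> simp [quasiEternal] <;> nlinarith

theorem half_le_rateSum_quasiEternal (hα : 0 < α) {t₀ t : ℝ} (ht : t ≤ t₀) (k : Fin 3) :
    α / 2 ≤ rateSum (fun k => quasiEternal α t₀ k t) k := by
  have h1 := tanh_nonpos_of_nonpos (sub_nonpos.2 ht)
  fin_cases k <;> simp [quasiEternal, rateSum] <;> nlinarith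

theorem quasiEternal_two_neg (hα : 0 < α) {t₀ t : ℝ} (ht : t₀ < t) :
    quasiEternal α t₀ 2 t < 0 := by
  have h1 := tanh_pos_of_pos (sub_pos.2 ht)
  simp [quasiEternal]
  nlinarith

end QuasiEternal

theorem dynMap_mem_of_small {γ : Fin 3 → ℝ → ℝ} {t δ e : ℝ} (hδ : δ ≤ 1 / 60)
    (hc : ∀ k, |Real.exp (-∫ τ in (0 : ℝ)..t, (γ (k + 1) τ + γ (k + 2) τ))| ≤ δ) (he : δ ≤ e)
    {ρ : OpAS} (hρ : IsState ρ) : ampl (dynMap γ t) ρ ∈ nearStationary e :=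
  nearStationary_mono he (ampl_mem_nearStationary (hδ.trans (by norm_num)) hc hρ)

theorem isCPTP_of_small {c : Fin 3 → ℝ} {δ : ℝ} (hδ : δ ≤ 1 / 60)
    (hc : ∀ k, |c k| ≤ δ) : IsCPTP (pauliMap c) :=
  isCPTP_pauliMap (pauliWeight_nonneg_of_abs_le fun k => (hc k).trans (hδ.trans (by norm_num)))

/-- The quasi-eternal model: its rates are nonnegative up to `t₀`, and from `t₀` to `t₀ + T` they run
through a curve that does not depend on `t₀`. -/
theorem quasiEternal_dynamics (α T : ℝ) (hα : 0 < α) (hT : 0 < T) :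
    ∃ τ₀ : ℝ, 0 < τ₀ ∧ ∀ t₀ : ℝ, τ₀ ≤ t₀ →
      (∀ t : ℝ, 0 ≤ t → IsCPTP (dynMap (quasiEternal α t₀) t)) ∧
      (∀ t : ℝ, PairwisePos fun k => quasiEternal α t₀ k t) ∧
      IsPDivisible (dynMap (quasiEternal α t₀)) ∧
      ¬ IsCPDivisible (dynMap (quasiEternal α t₀)) ∧
      (∀ t : ℝ, t₀ < t → ∀ᶠ s in 𝓝[>] t, ¬ IsCP (interMap (quasiEternal α t₀) s t)) ∧
      (∀ t ∈ Set.Icc t₀ (t₀ + T), ∀ ρ : OpAS, IsState ρ →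
        ampl (dynMap (quasiEternal α t₀) t) ρ
          ∈ nearStationary (radius fun k => quasiEternal α t₀ k t)) ∧
      (∀ ρ : OpAS, IsState ρ →
        AntitoneOn (fun t => mutualInfo (ampl (dynMap (quasiEternal α t₀) t) ρ))
          (Set.Icc 0 (t₀ + T))) := by
  obtain ⟨δ, hδ0, hδ1, hδ⟩ := exists_le_radius (continuous_quasiEternal α 0) hT.le
    fun t _ => pairwisePos_quasiEternal hα 0 t
  -- up to `t₀` all damping rates are at least `α / 2`, so all factors are at most `δ` afterwards
  refine ⟨2 / (α * δ), by positivity, fun t₀ ht₀ => ?_⟩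
  have hτ : 0 < 2 / (α * δ) := by positivity
  have h0 : 0 < t₀ := hτ.trans_le ht₀
  have hγ := continuous_quasiEternal α t₀
  have hpos := fun t => pairwisePos_quasiEternal hα t₀ t
  have hsmall : ∀ t, t₀ ≤ t → ∀ k, |Real.exp (-∫ τ in (0 : ℝ)..t,
      (quasiEternal α t₀ (k + 1) τ + quasiEternal α t₀ (k + 2) τ))| ≤ δ := fun t ht k => by
    refine exp_neg_integral_le hγ h0.le ht
      (fun τ hτ => half_le_rateSum_quasiEternal hα hτ.2 k)
      (fun τ _ => ((hpos τ).rateSum_pos k).le) hδ0 ?_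
    have : δ⁻¹ = α / 2 * (2 / (α * δ)) := by field_simp
    rw [this]
    gcongr
  have hmem : ∀ t ∈ Set.Icc t₀ (t₀ + T), ∀ ρ : OpAS, IsState ρ →
      ampl (dynMap (quasiEternal α t₀) t) ρ
        ∈ nearStationary (radius fun k => quasiEternal α t₀ k t) := by
    intro t ht ρ hρ
    refine dynMap_mem_of_small hδ1 (hsmall t ht.1) ?_ hρ
    simp only [quasiEternal_eq_shift α t₀]
    exact hδ (t - t₀) ⟨by linarith [ht.1], by linarith [ht.2]⟩
  refine ⟨fun t ht => ?_, hpos, isPDivisible_dynMap hγ fun t _ => hpos t,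
    not_isCPDivisible_dynMap hγ (t := t₀ + 1) (by linarith)
      (quasiEternal_two_neg hα (by linarith)),
    fun t ht => eventually_not_isCP_interMap hγ (quasiEternal_two_neg hα ht), hmem,
    fun ρ hρ => antitoneOn_mutualInfo_of_two_phases hγ h0.le (by linarith)
      (fun τ hτ k => quasiEternal_nonneg hα hτ.2 k) (fun t _ => hpos t) hmem hρ⟩
  rcases le_total t t₀ with h | h
  · exact isCPTP_dynMap_of_nonneg hγ ht fun τ hτ k => quasiEternal_nonneg hα (hτ.2.trans h) k
  · exact isCPTP_of_small hδ1 (hsmall t h)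

/-- A strong constant depolarization on `[0, t₁]` makes every later evolution with positive damping
rates free of backflow. -/
theorem exists_rates_before (t₁ t₂ : ℝ) (h1 : 0 < t₁) (h12 : t₁ ≤ t₂) (γ : Fin 3 → ℝ → ℝ)
    (hcont : ∀ k, ContinuousOn (γ k) (Set.Icc t₁ t₂))
    (hpos : ∀ t ∈ Set.Icc t₁ t₂, PairwisePos fun k => γ k t) :
    ∃ κ : Fin 3 → ℝ → ℝ,
      (∀ k, ContinuousOn (κ k) (Set.Icc 0 t₁)) ∧
      (∀ k, ∀ t ∈ Set.Icc 0 t₁, 0 < κ k t) ∧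
      (∀ ρ : OpAS, IsState ρ →
        ampl (dynMap κ t₁) ρ ∈ nearStationary (radius fun k => γ k t₁)) ∧
      (∀ s ∈ Set.Icc t₁ t₂, IsCPTP (interMap γ s t₁ ∘ₗ dynMap κ t₁)) ∧
      (∀ ρ : OpAS, IsState ρ →
        AntitoneOn (fun s => mutualInfo (ampl (dynMap κ s) ρ)) (Set.Icc 0 t₁) ∧
        AntitoneOn (fun s => mutualInfo (ampl (interMap γ s t₁ ∘ₗ dynMap κ t₁) ρ))
          (Set.Icc t₁ t₂)) := by
  -- continuous extension of the rates to the whole line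
  let γ' : Fin 3 → ℝ → ℝ := fun k => Set.IccExtend h12 ((Set.Icc t₁ t₂).domRestrict (γ k))
  have hγ' : ∀ k, Continuous (γ' k) := fun k => (hcont k).domRestrict.Icc_extend'
  have hext : ∀ k, ∀ τ ∈ Set.Icc t₁ t₂, γ' k τ = γ k τ := fun k τ hτ =>
    Set.IccExtend_of_mem h12 _ hτ
  have hpos' : ∀ t ∈ Set.Icc t₁ t₂, PairwisePos fun k => γ' k t := fun t ht => by
    simp only [hext _ t ht]
    exact hpos t ht
  have hmap : ∀ s ∈ Set.Icc t₁ t₂, interMap γ s t₁ = interMap γ' s t₁ := fun s hs =>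
    interMap_congr fun k τ hτ => by
      rw [Set.uIcc_of_le hs.1] at hτ
      exact (hext k τ ⟨hτ.1, hτ.2.trans hs.2⟩).symm
  obtain ⟨δ, hδ0, hδ1, hδ⟩ := exists_le_radius hγ' h12 hpos'
  -- each damping rate is `2 / (δ t₁)`, so all factors at time `t₁` are at most `δ`
  let κ : Fin 3 → ℝ → ℝ := fun _ _ => 1 / (δ * t₁)
  have hκ : ∀ k, Continuous (κ k) := fun k => continuous_const
  have hκ0 : 0 < 1 / (δ * t₁) := by positivity
  have hsmall : ∀ k, |Real.exp (-∫ τ in (0 : ℝ)..t₁, (κ (k + 1) τ + κ (k + 2) τ))| ≤ δ := fun k => by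
    refine exp_neg_integral_le hκ (k := k) h1.le le_rfl (m := 1 / (δ * t₁))
      (fun τ _ => ?_) (fun τ _ => ?_) hδ0 (le_of_eq (by field_simp))
    · simp only [rateSum, κ]
      linarith
    · simp only [rateSum, κ]
      linarith
  have hcomp : ∀ s ∈ Set.Icc t₁ t₂, ∃ c, interMap γ s t₁ ∘ₗ dynMap κ t₁ = pauliMap c
      ∧ ∀ k, |c k| ≤ δ := by
    intro s hs
    rw [hmap s hs, dynMap, interMap, interMap, pauliMap_comp]
    refine ⟨_, rfl, fun k => ?_⟩
    rw [abs_mul]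
    refine (mul_le_of_le_one_left (abs_nonneg _) ?_).trans (hsmall k)
    rw [abs_of_pos (Real.exp_pos _), Real.exp_le_one_iff, neg_nonpos]
    exact intervalIntegral.integral_nonneg hs.1 fun τ hτ =>
      ((hpos' τ ⟨hτ.1, hτ.2.trans hs.2⟩).rateSum_pos k).le
  have hrad : ∀ t ∈ Set.Icc t₁ t₂, δ ≤ radius fun k => γ k t := fun t ht => by
    have := hδ t ht
    simpa only [hext _ t ht] using this
  have hmemI : t₁ ∈ Set.Icc t₁ t₂ := ⟨le_rfl, h12⟩
  refine ⟨κ, fun k => (hκ k).continuousOn, fun k t _ => hκ0,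
    fun ρ hρ => dynMap_mem_of_small hδ1 hsmall (hrad t₁ hmemI) hρ, fun s hs => ?_,
    fun ρ hρ => ⟨antitoneOn_mutualInfo_of_nonneg hκ (fun τ _ k => hκ0.le) hρ, ?_⟩⟩
  · obtain ⟨c, hc, hcδ⟩ := hcomp s hs
    rw [hc]
    exact isCPTP_of_small hδ1 hcδ
  · have h := antitoneOn_mutualInfo_of_mem_nearStationary hγ' (ρ := ampl (dynMap κ t₁) ρ) hpos'
      fun t ht => by
        rw [← hmap t ht, ← ampl_comp]
        obtain ⟨c, hc, hcδ⟩ := hcomp t ht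
        rw [hc]
        exact nearStationary_mono (hδ t ht)
          (ampl_mem_nearStationary (hδ1.trans (by norm_num)) hcδ hρ)
    refine h.congr fun s hs => ?_
    simp only [hmap s hs, ampl_comp]

/-- The rates `(1, 1, h)`. -/
def rates (h : ℝ) : Fin 3 → ℝ := ![1, 1, h]

theorem pairwisePos_rates {h : ℝ} (hh : -1 < h) : PairwisePos (rates h) := by
  intro i j hij
  fin_cases i <;> fin_cases j <;>
    first | exact absurd rfl hij | (simp [rates] <;> linarith)

theorem exists_nonMarkovian_no_backflow :
    ∃ γ : Fin 3 → ℝ → ℝ,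
      (∀ k, ContinuousOn (γ k) (Set.Ici 0)) ∧
      (∀ t : ℝ, 0 ≤ t → PairwisePos fun k => γ k t) ∧
      (∀ t : ℝ, 0 ≤ t → IsCPTP (dynMap γ t)) ∧
      IsPDivisible (dynMap γ) ∧ ¬ IsCPDivisible (dynMap γ) ∧
      (∀ ρ : OpAS, IsState ρ →
        AntitoneOn (fun t => mutualInfo (ampl (dynMap γ t) ρ)) (Set.Ici 0)) := by
  have hrates : ∀ k, Continuous fun h => rates h k := fun k => by
    fin_cases k
    · exact continuous_const
    · exact continuous_const
    · exact continuous_id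
  obtain ⟨δ, hδ0, hδ1, hδ⟩ := exists_le_radius hrates (a := -1 / 2) (b := 0) (by norm_num)
    fun h hh => pairwisePos_rates (by linarith [hh.1])
  -- the third rate decreases from `a > 0` through `0` at time `a` to `-1 / 2`
  set a : ℝ := 2 * δ⁻¹ with ha
  have ha0 : 0 < a := by positivity
  let f : ℝ → ℝ := fun t => max (-1 / 2) (a - t)
  have hf : ∀ t, -1 / 2 ≤ f t := fun t => le_max_left _ _
  have hf0 : ∀ t, t ≤ a → 0 ≤ f t := fun t ht => le_max_of_le_right (by linarith)
  have hf1 : ∀ t, a ≤ t → f t ≤ 0 := fun t ht => max_le (by norm_num) (by linarith)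
  let γ : Fin 3 → ℝ → ℝ := fun k t => rates (f t) k
  have hγ : ∀ k, Continuous (γ k) := fun k =>
    (hrates k).comp (continuous_const.max (continuous_const.sub continuous_id))
  have hpos : ∀ t, PairwisePos fun k => γ k t := fun t =>
    pairwisePos_rates (by linarith [hf t])
  have hnn : ∀ t, t ≤ a → ∀ k, 0 ≤ γ k t := fun t ht k => by
    have := hf0 t ht
    fin_cases k <;> simp [γ, rates, this]
  have hsmall : ∀ t, a ≤ t → ∀ k, |Real.exp (-∫ τ in (0 : ℝ)..t, (γ (k + 1) τ + γ (k + 2) τ))| ≤ δ :=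
    fun t ht k => by
      refine exp_neg_integral_le hγ ha0.le ht (m := 1 / 2) (fun τ _ => ?_)
        (fun τ _ => ((hpos τ).rateSum_pos k).le) hδ0 (le_of_eq (by rw [ha]; ring))
      have := hf τ
      fin_cases k <;> simp [γ, rates, rateSum] <;> linarith
  have hmem : ∀ t, a ≤ t → ∀ ρ, IsState ρ →
      ampl (dynMap γ t) ρ ∈ nearStationary (radius fun k => γ k t) := fun t ht ρ hρ =>
    dynMap_mem_of_small hδ1 (hsmall t ht) (hδ (f t) ⟨hf t, hf1 t ht⟩) hρ
  refine ⟨γ, fun k => (hγ k).continuousOn, fun t _ => hpos t, fun t ht => ?_,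
    isPDivisible_dynMap hγ fun t _ => hpos t,
    not_isCPDivisible_dynMap hγ (t := a + 1) (by linarith) ?_, fun ρ hρ t ht s hs hts => ?_⟩
  · rcases le_total t a with h | h
    · exact isCPTP_dynMap_of_nonneg hγ ht fun τ hτ k => hnn τ (hτ.2.trans h) k
    · exact isCPTP_of_small hδ1 (hsmall t h)
  · change max (-1 / 2) (a - (a + 1)) < 0
    exact max_lt (by norm_num) (by linarith)
  · exact antitoneOn_mutualInfo_of_two_phases hγ ha0.le (le_max_left a s) (fun τ hτ k => hnn τ hτ.2 k)
      (fun t _ => hpos t) (fun t ht ρ hρ => hmem t ht.1 ρ hρ) hρ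
      ⟨ht, hts.trans (le_max_right a s)⟩ ⟨hs, le_max_right a s⟩ hts

end QubitDyn

theorem mainTheorem5 :
    ∃ U : (Fin 3 → ℝ) → Set OpAS,
      -- the neighbourhood `U g` of the stationary states
      (∀ g : Fin 3 → ℝ, PairwisePos g →
        U g ⊆ {ρ | IsState ρ} ∧
        (∀ ρA : Op2, IsState ρA → ρA.PosDef → U g ∈ 𝓝[{ρ | IsState ρ}] (stationary ρA)) ∧
        (∀ ρA : Op2, IsState ρA →
          U g ∈ 𝓝[{ρ | IsState ρ ∧ marginalA ρ = ρA}] (stationary ρA)) ∧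
        (∃ ε : ℝ, 0 < ε ∧ ∀ c : Fin 3 → ℝ, (∀ k, |c k| ≤ ε) →
          ∀ ρ : OpAS, IsState ρ → ampl (pauliMap c) ρ ∈ U g) ∧
        (∀ γ : Fin 3 → ℝ → ℝ, (∀ k, ContinuousOn (γ k) (Set.Ici 0)) →
          ∀ t : ℝ, 0 ≤ t → (∀ k, γ k t = g k) →
          ∀ ρ ∈ U g, ∃ d : ℝ, d ≤ 0 ∧
            HasDerivWithinAt (fun s => mutualInfo (ampl (interMap γ s t) ρ)) d (Set.Ici 0) t)) ∧
      -- the quasi-eternal model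
      (∀ α T : ℝ, 0 < α → 0 < T → ∃ τ₀ : ℝ, 0 < τ₀ ∧ ∀ t₀ : ℝ, τ₀ ≤ t₀ →
        (∀ t : ℝ, 0 ≤ t → IsCPTP (dynMap (quasiEternal α t₀) t)) ∧
        (∀ t : ℝ, PairwisePos fun k => quasiEternal α t₀ k t) ∧
        IsPDivisible (dynMap (quasiEternal α t₀)) ∧
        ¬ IsCPDivisible (dynMap (quasiEternal α t₀)) ∧
        (∀ t : ℝ, t₀ < t → ∀ᶠ s in 𝓝[>] t, ¬ IsCP (interMap (quasiEternal α t₀) s t)) ∧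
        (∀ t ∈ Set.Icc t₀ (t₀ + T), ∀ ρ : OpAS, IsState ρ →
          ampl (dynMap (quasiEternal α t₀) t) ρ ∈ U fun k => quasiEternal α t₀ k t) ∧
        (∀ ρ : OpAS, IsState ρ →
          AntitoneOn (fun t => mutualInfo (ampl (dynMap (quasiEternal α t₀) t) ρ))
            (Set.Icc 0 (t₀ + T)))) ∧
      -- P-divisible evolutions preceded by a suitable CP-divisible one
      (∀ t₁ t₂ : ℝ, 0 < t₁ → t₁ ≤ t₂ → ∀ γ : Fin 3 → ℝ → ℝ,
        (∀ k, ContinuousOn (γ k) (Set.Icc t₁ t₂)) →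
        (∀ t ∈ Set.Icc t₁ t₂, PairwisePos fun k => γ k t) →
        ∃ κ : Fin 3 → ℝ → ℝ,
          (∀ k, ContinuousOn (κ k) (Set.Icc 0 t₁)) ∧
          (∀ k, ∀ t ∈ Set.Icc 0 t₁, 0 < κ k t) ∧
          (∀ ρ : OpAS, IsState ρ → ampl (dynMap κ t₁) ρ ∈ U fun k => γ k t₁) ∧
          (∀ s ∈ Set.Icc t₁ t₂, IsCPTP (interMap γ s t₁ ∘ₗ dynMap κ t₁)) ∧
          (∀ ρ : OpAS, IsState ρ →
            AntitoneOn (fun s => mutualInfo (ampl (dynMap κ s) ρ)) (Set.Icc 0 t₁) ∧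
            AntitoneOn (fun s => mutualInfo (ampl (interMap γ s t₁ ∘ₗ dynMap κ t₁) ρ))
              (Set.Icc t₁ t₂))) ∧
      -- a non-Markovian P-divisible dynamics on `[0, ∞)` without any backflow
      (∃ γ : Fin 3 → ℝ → ℝ,
        (∀ k, ContinuousOn (γ k) (Set.Ici 0)) ∧
        (∀ t : ℝ, 0 ≤ t → PairwisePos fun k => γ k t) ∧
        (∀ t : ℝ, 0 ≤ t → IsCPTP (dynMap γ t)) ∧
        IsPDivisible (dynMap γ) ∧ ¬ IsCPDivisible (dynMap γ) ∧
        (∀ ρ : OpAS, IsState ρ →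
          AntitoneOn (fun t => mutualInfo (ampl (dynMap γ t) ρ)) (Set.Ici 0))) := by
  refine ⟨fun g => nearStationary (radius g), fun g hg => ⟨fun ρ hρ => hρ.1,
    fun ρA _ hpos => nearStationary_mem_nhdsWithin hg.radius_pos hpos,
    fun ρA hρA => nearStationary_mem_nhdsWithin_fiber hg.radius_pos hρA,
    ⟨radius g, hg.radius_pos, fun c hc ρ hρ =>
      ampl_mem_nearStationary (hg.radius_le.trans (by norm_num)) hc hρ⟩,
    fun γ hγ t ht hγg ρ hρ => ?_⟩,
    quasiEternal_dynamics, exists_rates_before, exists_nonMarkovian_no_backflow⟩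
  have e : (fun k => γ k t) = g := funext hγg
  exact exists_hasDerivWithinAt_mutualInfo_interMap hγ ht (e ▸ hg) (e ▸ hρ)
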